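/- Let $q\ge 1$ and $[q]=\{1,\dots,q\}$, and let $\Lambda$ be a finite collection of predicates $P:[q]^k\to\{0,1\}$, where the arity $k=\mathrm{ar}(P)$ may depend on $P$. An instance $\mathcal F$ of $\Lambda$ consists of variables $x_1,\dots,x_n$ and a list of constraints $C_1,\dots,C_m$ (repetitions allowed), $C_r=(P_r,S_r)$, where $P_r\in\Lambda$ and the scope $S_r$ is an ordered tuple of $\mathrm{ar}(P_r)$ distinct variables. The instance is regular if all its variables occur in the same number of scopes. A weighted instance has, in addition, rational weights $w_1,\dots,w_m\ge 0$ with $\sum_r w_r=1$, given in binary as fractions in lowest terms; an unweighted instance is one in which every constraint has weight $w_r=1/m$. The value of an assignment $\chi:\{x_1,\dots,x_n\}\to[q]$ is $\mathrm{Val}_\chi(\mathcal F)=\sum_{r=1}^m w_r\,P_r(\chi(S_r))$, and $\mathrm{Opt}(\mathcal F)=\max_\chi \mathrm{Val}_\chi(\mathcal F)$. For real $\alpha$, an $\alpha$-approximation algorithm for a class of instances of Max-CSP $\Lambda$ is a deterministic algorithm that, given an instance $\mathcal F$ from the class (with its $n$ variables listed explicitly), outputs, in time polynomial in the length of the input,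 an assignment $\chi$ with $\mathrm{Val}_\chi(\mathcal F)\ge\alpha\cdot\mathrm{Opt}(\mathcal F)$. Theorem 1. If there is a polynomial-time $\alpha$-approximation algorithm for the unweighted regular instances of Max-CSP $\Lambda$, then for every $\delta>0$ there is a polynomial-time $(\alpha-\delta)$-approximation algorithm for weighted Max-CSP $\Lambda$, that is, for all weighted instances of $\Lambda$, with no regularity assumed. -/

import Mathlib

/-- A predicate `P : [q]^k → {0,1}` over the alphabet `[q]`, bundled with its arity `k`. -/
structure CSPPredicate (q : ℕ) where
  /-- the arity `k` of the predicate -/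
  arity : ℕ
  /-- the truth table of the predicate -/
  holds : (Fin arity → Fin q) → Bool

/-- A constraint satisfaction problem over the alphabet `[q]`: a finite collection of predicates,
possibly of different arities. -/
abbrev CSP (q : ℕ) : Type := Finset (CSPPredicate q)

/-- A constraint of `Λ` on the variables `x_0, …, x_{n-1}`: a predicate of `Λ` together with its
scope, an ordered tuple of distinct variables. -/
structure CSPConstraint {q : ℕ} (Λ : CSP q) (n : ℕ) where
  /-- the predicate -/
  pred : {P : CSPPredicate q // P ∈ Λ}
  /-- the scope -/
  scope : Fin pred.1.arity ↪ Fin n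

/-- The value `P(χ(S)) ∈ {0,1}` of the constraint `(P, S)` under the assignment `χ`. -/
def CSPConstraint.eval {q : ℕ} {Λ : CSP q} {n : ℕ} (C : CSPConstraint Λ n)
    (χ : Fin n → Fin q) : ℝ :=
  if C.pred.1.holds (fun p => χ (C.scope p)) = true then 1 else 0

/-- An (unweighted) instance of `Λ`: finitely many variables and constraints `C_1, …, C_m` on
them. The same constraint may be listed more than once. -/
structure CSPInstance {q : ℕ} (Λ : CSP q) where
  /-- the number `n` of variables -/
  numVars : ℕ
  /-- the number `m` of constraints -/
  numConstraints : ℕ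
  /-- the constraints -/
  constraint : Fin numConstraints → CSPConstraint Λ numVars

/-- A weighted instance of `Λ`: every constraint has a non-negative weight, and the weights sum up
to `1`. The weights are rational, so that an instance is a finite object. -/
structure WeightedCSPInstance {q : ℕ} (Λ : CSP q) extends CSPInstance Λ where
  /-- the weights -/
  weight : Fin numConstraints → ℚ≥0
  /-- the weights sum up to one -/
  weight_sum : ∑ r, weight r = 1

/-- The degree of a variable: the number of constraints in whose scope it occurs. -/
def CSPInstance.degree {q : ℕ} {Λ : CSP q} (F : CSPInstance Λ) (i : Fin F.numVars) : ℕ :=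
  (Finset.univ.filter fun r => ∃ p, (F.constraint r).scope p = i).card

/-- An instance is regular if all its variables have the same degree. -/
def CSPInstance.IsRegular {q : ℕ} {Λ : CSP q} (F : CSPInstance Λ) : Prop :=
  ∀ i j, F.degree i = F.degree j

/-- The value of an assignment to an unweighted instance, in which each of the `m` constraints
has weight `1 / m`: the fraction of satisfied constraints. -/
noncomputable def CSPInstance.val {q : ℕ} {Λ : CSP q} (F : CSPInstance Λ)
    (χ : Fin F.numVars → Fin q) : ℝ :=
  ∑ r, 1 / (F.numConstraints : ℝ) * (F.constraint r).eval χ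

/-- The value of an assignment to a weighted instance: the total weight of the satisfied
constraints. -/
noncomputable def WeightedCSPInstance.val {q : ℕ} {Λ : CSP q} (F : WeightedCSPInstance Λ)
    (χ : Fin F.numVars → Fin q) : ℝ :=
  ∑ r, (F.weight r : ℝ) * (F.constraint r).eval χ

/-- The finite alphabet in which instances of `Λ` are written: one symbol for each predicate
of `Λ`, a tally mark, the binary digits and a separator. -/
inductive CSPSymbol {q : ℕ} (Λ : CSP q) : Type
  | pred (P : {P : CSPPredicate q // P ∈ Λ})
  | tally
  | bit (b : Bool)
  | sep

/-- The word for a constraint: the symbol of its predicate, and then the variables of its scope,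
where `x_i` is written as a separator and `i` tally marks. -/
def CSPConstraint.encode {q : ℕ} {Λ : CSP q} {n : ℕ} (C : CSPConstraint Λ n) :
    List (CSPSymbol Λ) :=
  CSPSymbol.pred C.pred ::
    (List.ofFn C.scope).flatMap fun i => CSPSymbol.sep :: List.replicate i.val CSPSymbol.tally

/-- The word for a non-negative rational number: numerator and denominator, in lowest terms and in
binary (least significant digit first), each preceded by a separator. -/
def encodeWeight {q : ℕ} (Λ : CSP q) (w : ℚ≥0) : List (CSPSymbol Λ) :=
  (CSPSymbol.sep :: w.num.bits.map CSPSymbol.bit) ++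
    (CSPSymbol.sep :: w.den.bits.map CSPSymbol.bit)

/-- The word for an unweighted instance: the list of the `n` variables, as `n` tally marks, and then
the constraints one after the other. As the variables of an instance are listed, it makes only a
polynomial difference to the length of the word that indices of variables are written in unary. -/
def CSPInstance.encode {q : ℕ} {Λ : CSP q} (F : CSPInstance Λ) : List (CSPSymbol Λ) :=
  List.replicate F.numVars CSPSymbol.tally ++
    (List.finRange F.numConstraints).flatMap fun r => (F.constraint r).encode

/-- The word for a weighted instance: as for an unweighted one, but each constraint is followed by
its weight, in binary. -/
def WeightedCSPInstance.encode {q : ℕ} {Λ : CSP q} (F : WeightedCSPInstance Λ) :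
    List (CSPSymbol Λ) :=
  List.replicate F.numVars CSPSymbol.tally ++
    (List.finRange F.numConstraints).flatMap fun r =>
      (F.constraint r).encode ++ encodeWeight Λ (F.weight r)

/-- There is an `α`-approximation algorithm for the following maximization problem: an input is an
object `F` of the class `I`, given by the word `encode F`; a solution is an assignment
`χ : [numVars F] → [q]`, and it is written as the word of its values; the value of the solution
`χ` is `val F χ`.

The algorithm is a (multi-stack) Turing machine that halts on the inputs from `I` after a number of
steps that is bounded by a polynomial in the length of the input, and its output is an assignment
of value at least `α` times the optimal value. If `1 ≤ q` then the supremum that defines the optimal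
value is a maximum over a finite non-empty set. -/
def HasPolyTimeApprox (q : ℕ) {I Sym : Type} (encode : I → List Sym) (numVars : I → ℕ)
    (val : (F : I) → (Fin (numVars F) → Fin q) → ℝ) (α : ℝ) : Prop :=
  ∃ A : (F : I) → Fin (numVars F) → Fin q,
    Nonempty (Turing.TM2ComputableInPolyTime encode (id : List (Fin q) → List (Fin q))
      fun F => List.ofFn (A F)) ∧
    ∀ F, val F (A F) ≥ α * ⨆ χ, val F χ

/-- There is a polynomial-time `α`-approximation algorithm for the unweighted regular instances of
Max-CSP `Λ`. (Nothing is required of the algorithm on other instances.) -/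
def HasRegularMaxCSPApprox {q : ℕ} (Λ : CSP q) (α : ℝ) : Prop :=
  HasPolyTimeApprox q (I := {F : CSPInstance Λ // F.IsRegular})
    (fun F => F.1.encode) (fun F => F.1.numVars) (fun F => F.1.val) α

/-- There is a polynomial-time `α`-approximation algorithm for weighted Max-CSP `Λ`. -/
def HasWeightedMaxCSPApprox {q : ℕ} (Λ : CSP q) (α : ℝ) : Prop :=
  HasPolyTimeApprox q (I := WeightedCSPInstance Λ)
    (fun F => F.encode) (fun F => F.numVars) (fun F => F.val) α

/-! A weighted instance is turned into a regular unweighted one in two steps, and an assignment to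
the latter is turned back into one to the former. `C` is a fixed natural number with `C ≥ α / δ` and
`C ≥ 1 / δ`.

Weights. Constraints with unsatisfiable predicates are discarded; say `m` constraints remain. Unless
all their weights vanish, the weights are multiplied by the least power of two for which some
weight, rounded down, is at least `N = C * m + 1`, and each constraint is repeated as often as its
rounded weight says. Rounding loses at most `m` in total (`score_copies_bounds`), whereas some
single constraint, which can be satisfied, already contributes more than `C * m` (`rounding_spec`).
By minimality of the power all multiplicities are at most `2 * N`, so the new list `G` has
polynomial length.

Regularity. Every occurrence of a variable in `G` becomes a variable of its own, a slot; the
occurrences of one old variable form a cloud. With `K` a bound for the arities, a constraint is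
replaced by `T ^ K` constraints: each slot of its scope runs through a list of `T` members of its
cloud, in which every member appears `T / D` times, where `D` is the size of the cloud, and the
remainder is filled with the slot itself. Over all lists of a cloud every member then appears
exactly `T` times, so that all degrees are `T ^ K` (`isRegular_regularInstance`). Assignments that
are constant on clouds score exactly `T ^ K` times what they score on `G` (`score_blowup_comp`).
Conversely, an arbitrary assignment is made constant on one cloud after another. Giving the whole
cloud the value of a random member preserves the expected score apart from the remainders
(`weight_collapse`), so the best constant loses little (`score_le_of_collapse`). For `T > C * n *
|G| * |vars G|` the loss over all `n` clouds is at most `T ^ K / C` (`mul_score_le`).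
`mul_weightedScore_le` combines both losses.

Complexity. The algorithm is a genuine Turing machine, assembled from program fragments that work on
a stack of binary trees. `Computes` and `PolyT` express polynomial-time computability by such
fragments and are closed under composition, pairing, case distinctions and folds of controlled
growth. The given algorithm is built in as a subroutine (`Computes.call`). As `Computes` speaks of a
family of inputs only, nothing has to be known about the subroutine outside of regular instances. -/

/-! ### Program fragments of stack machines -/

namespace Turing

/-! ### Reachability in boundedly many steps -/

section Reach

variable {C : Type}

/-- The configuration `c'` is reached from `c` in at most `t` steps. -/
def ReachIn (f : C → Option C) (t : ℕ) (c c' : C) : Prop :=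
  ∃ s ≤ t, (flip bind f)^[s] (some c) = some c'

theorem ReachIn.refl (f : C → Option C) (c : C) : ReachIn f 0 c c := ⟨0, le_rfl, rfl⟩

theorem ReachIn.single {f : C → Option C} {c c' : C} (h : f c = some c') : ReachIn f 1 c c' :=
  ⟨1, le_rfl, by simpa [flip] using h⟩

theorem ReachIn.mono {f : C → Option C} {t t' : ℕ} {c c' : C} (h : ReachIn f t c c')
    (ht : t ≤ t') : ReachIn f t' c c' :=
  let ⟨s, hs, e⟩ := h
  ⟨s, hs.trans ht, e⟩

theorem ReachIn.trans {f : C → Option C} {t t' : ℕ} {a b c : C} (h : ReachIn f t a b)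
    (h' : ReachIn f t' b c) : ReachIn f (t + t') a c := by
  obtain ⟨s, hs, e⟩ := h
  obtain ⟨s', hs', e'⟩ := h'
  exact ⟨s' + s, by omega, by rw [Function.iterate_add_apply, e, e']⟩

end Reach

/-! ### Composition of fragments by relabelling jumps -/

section Fragment

variable {K : Type} {Γ : K → Type} {σ : Type}

/-- Renaming of the labels of a statement. -/
def TM2.Stmt.mapLabel {Λ Λ' : Type} (φ : Λ → Λ') : TM2.Stmt Γ Λ σ → TM2.Stmt Γ Λ' σ
  | .push k f q => .push k f (q.mapLabel φ)
  | .peek k f q => .peek k f (q.mapLabel φ)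
  | .pop k f q => .pop k f (q.mapLabel φ)
  | .load f q => .load f (q.mapLabel φ)
  | .branch f q q' => .branch f (q.mapLabel φ) (q'.mapLabel φ)
  | .goto l => .goto fun v => φ (l v)
  | .halt => .halt

theorem TM2.Stmt.mapLabel_mapLabel {Λ Λ' Λ'' : Type} (φ : Λ → Λ') (ψ : Λ' → Λ'')
    (s : TM2.Stmt Γ Λ σ) : (s.mapLabel φ).mapLabel ψ = s.mapLabel fun l => ψ (φ l) := by
  induction s <;> simp_all [mapLabel]

theorem TM2.Stmt.mapLabel_id {Λ : Type} (s : TM2.Stmt Γ Λ σ) : s.mapLabel (fun l => l) = s := by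
  induction s <;> simp_all [mapLabel]

theorem TM2.stepAux_mapLabel [DecidableEq K] {Λ Λ' : Type} (φ : Λ → Λ') (s : TM2.Stmt Γ Λ σ) (v : σ)
    (S : ∀ k, List (Γ k)) :
    TM2.stepAux (s.mapLabel φ) v S =
      ⟨(TM2.stepAux s v S).l.map φ, (TM2.stepAux s v S).var, (TM2.stepAux s v S).stk⟩ := by
  induction s generalizing v S with
  | branch f q q' ih ih' =>
    simp only [Stmt.mapLabel, TM2.stepAux]
    cases f v <;> simp [ih, ih']
  | _ => simp_all [Stmt.mapLabel, TM2.stepAux]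

/-- Relabelling affects nothing but the target of the jump. This is the single-step case on which
all control structures rest. -/
theorem TM2.reachIn_one_of_mapLabel [DecidableEq K] {Λ Λ' : Type} {m : Λ → TM2.Stmt Γ Λ σ} {l : Λ}
    {s : TM2.Stmt Γ Λ' σ} (ψ : Λ' → Λ) (hm : m l = s.mapLabel ψ) {v v' : σ} {b : Λ'}
    {S S' : ∀ k, List (Γ k)} (h : TM2.stepAux s v S = ⟨some b, v', S'⟩) :
    ReachIn (TM2.step m) 1 ⟨some l, v, S⟩ ⟨some (ψ b), v', S'⟩ := by
  refine ReachIn.single ?_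
  rw [TM2.step, hm, TM2.stepAux_mapLabel, h]
  rfl

variable (Γ σ) in
/-- A program fragment: a program with an entry and an exit, the label `none`. -/
structure Frag where
  /-- the labels -/
  Lab : Type
  /-- there are finitely many labels -/
  [fin : Fintype Lab]
  /-- the entry -/
  entry : Lab
  /-- the program -/
  code : Lab → TM2.Stmt Γ (Option Lab) σ

attribute [instance] Frag.fin

namespace Frag

/-- The fragment is part of the program `m`. -/
def Embeds (F : Frag Γ σ) {Λ : Type} (m : Λ → TM2.Stmt Γ Λ σ) (φ : Option F.Lab → Λ) : Prop :=
  ∀ l, m (φ (some l)) = (F.code l).mapLabel φ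

variable [DecidableEq K]

/-- Inside of every program, the fragment turns the stacks `S` into `S'` in at most `t` steps. -/
def Runs (F : Frag Γ σ) (v : σ) (S S' : ∀ k, List (Γ k)) (t : ℕ) : Prop :=
  ∀ (Λ : Type) (m : Λ → TM2.Stmt Γ Λ σ) (φ : Option F.Lab → Λ), F.Embeds m φ →
    ReachIn (TM2.step m) t ⟨some (φ (some F.entry)), v, S⟩ ⟨some (φ none), v, S'⟩

theorem Runs.mono {F : Frag Γ σ} {v : σ} {S S' : ∀ k, List (Γ k)} {t t' : ℕ}
    (h : F.Runs v S S' t) (ht : t ≤ t') : F.Runs v S S' t' :=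
  fun Λ m φ e => (h Λ m φ e).mono ht

/-- A statement without jumps. -/
def basic (s : TM2.Stmt Γ Unit σ) : Frag Γ σ where
  Lab := Unit
  entry := ()
  code _ := s.mapLabel fun _ => none

theorem runs_basic {s : TM2.Stmt Γ Unit σ} {v : σ} {S S' : ∀ k, List (Γ k)}
    (h : TM2.stepAux s v S = ⟨some (), v, S'⟩) : (basic s).Runs v S S' 1 := fun _ _ φ e =>
  TM2.reachIn_one_of_mapLabel (fun _ => φ none)
    ((e ()).trans (TM2.Stmt.mapLabel_mapLabel _ _ _)) h

/-- One fragment after the other. -/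
def seq (F G : Frag Γ σ) : Frag Γ σ where
  Lab := F.Lab ⊕ G.Lab
  entry := .inl F.entry
  code
    | .inl l => (F.code l).mapLabel fun o => some (o.elim (.inr G.entry) .inl)
    | .inr l => (G.code l).mapLabel fun o => o.map .inr

/-- An embedding of the composite restricts to embeddings of both parts, the exit of `F` being
identified with the entry of `G`. The other control structures follow the same pattern. -/
theorem Runs.seq {F G : Frag Γ σ} {v : σ} {S S' S'' : ∀ k, List (Γ k)} {t t' : ℕ}
    (h : F.Runs v S S' t) (h' : G.Runs v S' S'' t') : (F.seq G).Runs v S S'' (t + t') :=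
  fun Λ m φ e =>
    ReachIn.trans
      (h Λ m (fun o => φ (some (o.elim (.inr G.entry) .inl))) fun l =>
        (e (.inl l)).trans (TM2.Stmt.mapLabel_mapLabel _ _ _))
      (h' Λ m (fun o => φ (o.map .inr)) fun l =>
        (e (.inr l)).trans (TM2.Stmt.mapLabel_mapLabel _ _ _))

/-- A case distinction; the test is a statement with two exits. -/
def ite (s : TM2.Stmt Γ Bool σ) (F G : Frag Γ σ) : Frag Γ σ where
  Lab := Option (F.Lab ⊕ G.Lab)
  entry := none
  code
    | none => s.mapLabel fun b => some (some (bif b then .inl F.entry else .inr G.entry))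
    | some (.inl l) => (F.code l).mapLabel fun o => o.map fun l => some (.inl l)
    | some (.inr l) => (G.code l).mapLabel fun o => o.map fun l => some (.inr l)

theorem runs_ite_true {s : TM2.Stmt Γ Bool σ} {F G : Frag Γ σ} {v : σ}
    {S S' S'' : ∀ k, List (Γ k)} {t : ℕ} (h : TM2.stepAux s v S = ⟨some true, v, S'⟩)
    (h' : F.Runs v S' S'' t) : (ite s F G).Runs v S S'' (1 + t) := fun Λ m φ e =>
  ReachIn.trans
    (TM2.reachIn_one_of_mapLabel
      (fun b => φ (some (some (bif b then .inl F.entry else .inr G.entry))))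
      ((e none).trans (TM2.Stmt.mapLabel_mapLabel _ _ _)) h)
    (h' Λ m (fun o => φ (o.map fun l => some (.inl l))) fun l =>
      (e (some (.inl l))).trans (TM2.Stmt.mapLabel_mapLabel _ _ _))

theorem runs_ite_false {s : TM2.Stmt Γ Bool σ} {F G : Frag Γ σ} {v : σ}
    {S S' S'' : ∀ k, List (Γ k)} {t : ℕ} (h : TM2.stepAux s v S = ⟨some false, v, S'⟩)
    (h' : G.Runs v S' S'' t) : (ite s F G).Runs v S S'' (1 + t) := fun Λ m φ e =>
  ReachIn.trans
    (TM2.reachIn_one_of_mapLabel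
      (fun b => φ (some (some (bif b then .inl F.entry else .inr G.entry))))
      ((e none).trans (TM2.Stmt.mapLabel_mapLabel _ _ _)) h)
    (h' Λ m (fun o => φ (o.map fun l => some (.inr l))) fun l =>
      (e (some (.inr l))).trans (TM2.Stmt.mapLabel_mapLabel _ _ _))

/-- A while loop; the test is a statement with two exits. -/
def loopWhile (s : TM2.Stmt Γ Bool σ) (F : Frag Γ σ) : Frag Γ σ where
  Lab := Option F.Lab
  entry := none
  code
    | none => s.mapLabel fun b => bif b then some (some F.entry) else none
    | some l => (F.code l).mapLabel fun o => some o

theorem runs_loopWhile_true {s : TM2.Stmt Γ Bool σ} {F : Frag Γ σ} {v : σ}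
    {S S₁ S₂ S' : ∀ k, List (Γ k)} {t t' : ℕ} (h : TM2.stepAux s v S = ⟨some true, v, S₁⟩)
    (h' : F.Runs v S₁ S₂ t) (h'' : (loopWhile s F).Runs v S₂ S' t') :
    (loopWhile s F).Runs v S S' (1 + t + t') := fun Λ m φ e =>
  ReachIn.trans
    (ReachIn.trans
      (TM2.reachIn_one_of_mapLabel (fun b => φ (bif b then some (some F.entry) else none))
        ((e none).trans (TM2.Stmt.mapLabel_mapLabel _ _ _)) h)
      (h' Λ m (fun o => φ (some o)) fun l =>
        (e (some l)).trans (TM2.Stmt.mapLabel_mapLabel _ _ _)))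
    (h'' Λ m φ e)

theorem runs_loopWhile_false {s : TM2.Stmt Γ Bool σ} {F : Frag Γ σ} {v : σ}
    {S S' : ∀ k, List (Γ k)} (h : TM2.stepAux s v S = ⟨some false, v, S'⟩) :
    (loopWhile s F).Runs v S S' 1 := fun _ _ φ e =>
  TM2.reachIn_one_of_mapLabel (fun b => φ (bif b then some (some F.entry) else none))
    ((e none).trans (TM2.Stmt.mapLabel_mapLabel _ _ _)) h

/-- A loop whose body is the test. -/
def loop (s : TM2.Stmt Γ Bool σ) : Frag Γ σ where
  Lab := Unit
  entry := ()
  code _ := s.mapLabel fun b => bif b then some () else none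

theorem runs_loop_true {s : TM2.Stmt Γ Bool σ} {v : σ}
    {S S₁ S' : ∀ k, List (Γ k)} {t : ℕ} (h : TM2.stepAux s v S = ⟨some true, v, S₁⟩)
    (h' : (loop s).Runs v S₁ S' t) : (loop s).Runs v S S' (1 + t) := fun Λ m φ e =>
  ReachIn.trans
    (TM2.reachIn_one_of_mapLabel (fun b => φ (bif b then some () else none))
      ((e ()).trans (TM2.Stmt.mapLabel_mapLabel _ _ _)) h)
    (h' Λ m φ e)

theorem runs_loop_false {s : TM2.Stmt Γ Bool σ} {v : σ}
    {S S' : ∀ k, List (Γ k)} (h : TM2.stepAux s v S = ⟨some false, v, S'⟩) :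
    (loop s).Runs v S S' 1 := fun _ _ φ e =>
  TM2.reachIn_one_of_mapLabel (fun b => φ (bif b then some () else none))
    ((e ()).trans (TM2.Stmt.mapLabel_mapLabel _ _ _)) h

end Frag

end Fragment

end Turing

/-! ### A stack machine for binary trees, with a subroutine -/

namespace Turing

/-- Binary trees with labelled leaves. -/
inductive BTree (A : Type) : Type
  | leaf (a : A)
  | node (l r : BTree A)

namespace BTree

variable {A : Type}

/-- The word of a tree, in prefix notation; `none` stands for an inner node. -/
def word : BTree A → List (Option A)
  | leaf a => [some a]
  | node l r => none :: (l.word ++ r.word)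

/-- The number of nodes. -/
def size : BTree A → ℕ
  | leaf _ => 1
  | node l r => l.size + r.size + 1

theorem size_pos (t : BTree A) : 0 < t.size := by cases t <;> simp [size]

theorem length_word (t : BTree A) : t.word.length = t.size := by
  induction t <;> simp_all [word, size]

/-- The label of the root, if the tree is a leaf. -/
def root : BTree A → Option A
  | leaf a => some a
  | node _ _ => none

end BTree

/-- The stacks of the machine, apart from those of its subroutine. -/
inductive OwnStack : Type
  | inp | out | val | aux₁ | aux₂ | cnt
  deriving DecidableEq

instance : Fintype OwnStack :=
  ⟨{.inp, .out, .val, .aux₁, .aux₂, .cnt}, fun x => by cases x <;> simp⟩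

namespace TreeMachine

open OwnStack

/-- The labels of leaves. -/
abbrev Leaf (Bi Bo : Type) : Type := Bool ⊕ (Bi ⊕ Bo)

variable {Bi Bo : Type} (M : TM2ComputableAux Bi Bo)

/-- The alphabets of the stacks. -/
abbrev Alphabet : OwnStack ⊕ M.tm.K → Type
  | .inl .inp => Bi
  | .inl .out => Bo
  | .inl .val => Option (Leaf Bi Bo)
  | .inl .aux₁ => Option (Leaf Bi Bo)
  | .inl .aux₂ => Option (Leaf Bi Bo)
  | .inl .cnt => Unit
  | .inr k => M.tm.Γ k

/-- The memory: a register for a symbol, and the memory of the subroutine. -/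
abbrev Memory : Type := Option (Option (Leaf Bi Bo)) × M.tm.σ

/-- The memory between two fragments. -/
def idle : Memory M := (none, M.tm.initialState)

/-- The stacks with given contents. -/
def conf (i : List Bi) (o : List Bo) (w a b : List (Option (Leaf Bi Bo))) (c : List Unit)
    (T : ∀ k, List (M.tm.Γ k)) : ∀ k, List (Alphabet M k)
  | .inl .inp => i
  | .inl .out => o
  | .inl .val => w
  | .inl .aux₁ => a
  | .inl .aux₂ => b
  | .inl .cnt => c
  | .inr k => T k

/-- All stacks are empty, apart from the stack `val`. -/
abbrev vals (w : List (Option (Leaf Bi Bo))) : ∀ k, List (Alphabet M k) :=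
  conf M [] [] w [] [] [] fun _ => []

/-! ### Writing to and reading from a single stack -/

section update

variable (i : List Bi) (o : List Bo) (w a b : List (Option (Leaf Bi Bo))) (c : List Unit)
    (T : ∀ k, List (M.tm.Γ k))

@[simp] theorem update_inp (x : List Bi) :
    Function.update (conf M i o w a b c T) (.inl .inp) x = conf M x o w a b c T := by
  funext k; rcases k with (_ | _ | _ | _ | _ | _) | k <;> rfl

@[simp] theorem update_out (x : List Bo) :
    Function.update (conf M i o w a b c T) (.inl .out) x = conf M i x w a b c T := by
  funext k; rcases k with (_ | _ | _ | _ | _ | _) | k <;> rfl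

@[simp] theorem update_val (x : List (Option (Leaf Bi Bo))) :
    Function.update (conf M i o w a b c T) (.inl .val) x = conf M i o x a b c T := by
  funext k; rcases k with (_ | _ | _ | _ | _ | _) | k <;> rfl

@[simp] theorem update_aux₁ (x : List (Option (Leaf Bi Bo))) :
    Function.update (conf M i o w a b c T) (.inl .aux₁) x = conf M i o w x b c T := by
  funext k; rcases k with (_ | _ | _ | _ | _ | _) | k <;> rfl

@[simp] theorem update_aux₂ (x : List (Option (Leaf Bi Bo))) :
    Function.update (conf M i o w a b c T) (.inl .aux₂) x = conf M i o w a x c T := by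
  funext k; rcases k with (_ | _ | _ | _ | _ | _) | k <;> rfl

@[simp] theorem update_cnt (x : List Unit) :
    Function.update (conf M i o w a b c T) (.inl .cnt) x = conf M i o w a b x T := by
  funext k; rcases k with (_ | _ | _ | _ | _ | _) | k <;> rfl

@[simp] theorem update_inr (k : M.tm.K) (x : List (M.tm.Γ k)) :
    Function.update (conf M i o w a b c T) (.inr k) x =
      conf M i o w a b c (Function.update T k x) := by
  funext l
  rcases l with (_ | _ | _ | _ | _ | _) | l
  iterate 6 rfl
  by_cases h : l = k
  · subst h; simp [conf]
  · have : (Sum.inr l : OwnStack ⊕ M.tm.K) ≠ .inr k := by simpa using h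
    rw [Function.update_of_ne this]
    simp [conf, h]

@[simp] theorem conf_inp : conf M i o w a b c T (.inl .inp) = i := rfl
@[simp] theorem conf_out : conf M i o w a b c T (.inl .out) = o := rfl
@[simp] theorem conf_val : conf M i o w a b c T (.inl .val) = w := rfl
@[simp] theorem conf_aux₁ : conf M i o w a b c T (.inl .aux₁) = a := rfl
@[simp] theorem conf_aux₂ : conf M i o w a b c T (.inl .aux₂) = b := rfl
@[simp] theorem conf_cnt : conf M i o w a b c T (.inl .cnt) = c := rfl
@[simp] theorem conf_inr (k : M.tm.K) : conf M i o w a b c T (.inr k) = T k := rfl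

end update

/-- Statements of the machine. -/
abbrev MStmt (Λ : Type) : Type := TM2.Stmt (Alphabet M) Λ (Memory M)

/-- Fragments of programs of the machine. -/
abbrev MFrag : Type 1 := Frag (Alphabet M) (Memory M)

variable {M}

/-- Empty the register and leave the test. -/
def answer (b : Bool) : MStmt M Bool := .load (fun v => (none, v.2)) (.goto fun _ => b)

@[simp] theorem stepAux_answer (b : Bool) (r : Option (Option (Leaf Bi Bo)))
    (S : ∀ k, List (Alphabet M k)) :
    TM2.stepAux (answer b) (r, M.tm.initialState) S = ⟨some b, idle M, S⟩ := rfl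

/-- Push a symbol on `val`. -/
def pushVal (s : Option (Leaf Bi Bo)) : MFrag M :=
  .basic (.push (.inl .val) (fun _ => s) (.goto fun _ => ()))

theorem runs_pushVal (s : Option (Leaf Bi Bo)) (w : List (Option (Leaf Bi Bo))) :
    (pushVal (M := M) s).Runs (idle M) (vals M w) (vals M (s :: w)) 1 :=
  Frag.runs_basic (by simp)

/-- Pop a symbol from `val`. -/
def popVal : MFrag M := .basic (.pop (.inl .val) (fun v _ => v) (.goto fun _ => ()))

theorem runs_popVal (s : Option (Leaf Bi Bo)) (w : List (Option (Leaf Bi Bo))) :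
    (popVal (M := M)).Runs (idle M) (vals M (s :: w)) (vals M w) 1 :=
  Frag.runs_basic (by simp)

/-- The loop that moves trees from `val` to `aux₁` and to `aux₂`, as far as the flags say so;
the stack `cnt` counts the trees that remain to be moved. -/
def moveTest (f₁ f₂ : Bool) : MStmt M Bool :=
  .pop (.inl .cnt) (fun v s => (s.map fun _ => none, v.2)) <|
  .branch (fun v => v.1.isSome)
    (.pop (.inl .val) (fun v s => (s, v.2)) <|
     .branch (fun v => v.1.any Option.isNone)
      (.push (.inl .cnt) (fun _ => ()) <| .push (.inl .cnt) (fun _ => ()) <| push')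
      push')
    (answer false)
where
  push' : MStmt M Bool :=
    .branch (fun _ => f₁)
      (.push (.inl .aux₁) (fun v => v.1.getD none) push'')
      push''
  push'' : MStmt M Bool :=
    .branch (fun _ => f₂)
      (.push (.inl .aux₂) (fun v => v.1.getD none) (answer true))
      (answer true)

theorem stepAux_moveTest_nil (f₁ f₂ : Bool) (w a b : List (Option (Leaf Bi Bo))) :
    TM2.stepAux (moveTest (M := M) f₁ f₂) (idle M) (conf M [] [] w a b [] fun _ => []) =
      ⟨some false, idle M, conf M [] [] w a b [] fun _ => []⟩ := by
  simp [moveTest, idle]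

theorem stepAux_moveTest_node (f₁ f₂ : Bool) (w a b : List (Option (Leaf Bi Bo)))
    (c : List Unit) :
    TM2.stepAux (moveTest (M := M) f₁ f₂) (idle M)
        (conf M [] [] (none :: w) a b (() :: c) fun _ => []) =
      ⟨some true, idle M, conf M [] [] w (bif f₁ then none :: a else a)
        (bif f₂ then none :: b else b) (() :: () :: c) fun _ => []⟩ := by
  cases f₁ <;> cases f₂ <;> simp [moveTest, moveTest.push', moveTest.push'', idle]

theorem stepAux_moveTest_leaf (f₁ f₂ : Bool) (s : Leaf Bi Bo) (w a b : List (Option (Leaf Bi Bo)))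
    (c : List Unit) :
    TM2.stepAux (moveTest (M := M) f₁ f₂) (idle M)
        (conf M [] [] (some s :: w) a b (() :: c) fun _ => []) =
      ⟨some true, idle M, conf M [] [] w (bif f₁ then some s :: a else a)
        (bif f₂ then some s :: b else b) c fun _ => []⟩ := by
  cases f₁ <;> cases f₂ <;> simp [moveTest, moveTest.push', moveTest.push'', idle]

/-- The rest of the run is a hypothesis, because the same loop handles both subtrees of a node: the
counter exchanges one pending tree for two, and the induction hypotheses are applied one inside the
other. -/
theorem runs_moveTest (f₁ f₂ : Bool) (t : BTree (Leaf Bi Bo)) :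
    ∀ (w a b : List (Option (Leaf Bi Bo))) (c : List Unit) (n : ℕ)
      (S : ∀ k, List (Alphabet M k)),
      (Frag.loop (moveTest (M := M) f₁ f₂)).Runs (idle M)
        (conf M [] [] w (bif f₁ then t.word.reverse ++ a else a)
          (bif f₂ then t.word.reverse ++ b else b) c fun _ => []) S n →
      (Frag.loop (moveTest (M := M) f₁ f₂)).Runs (idle M)
        (conf M [] [] (t.word ++ w) a b (() :: c) fun _ => []) S (t.size + n) := by
  induction t with
  | leaf s =>
    intro w a b c n S h
    exact Frag.runs_loop_true (stepAux_moveTest_leaf f₁ f₂ s w a b c) h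
  | node l r ihl ihr =>
    intro w a b c n S h
    have e : (l.node r).size + n = 1 + (l.size + (r.size + n)) := by simp only [BTree.size]; omega
    have e' : (l.node r).word ++ w = none :: (l.word ++ (r.word ++ w)) := by simp [BTree.word]
    rw [e, e']
    refine Frag.runs_loop_true (stepAux_moveTest_node f₁ f₂ _ a b c) ?_
    refine ihl _ _ _ _ _ _ (ihr _ _ _ _ _ _ ?_)
    cases f₁ <;> cases f₂ <;> simpa [BTree.word] using h

/-- Move the tree on the top of `val` to `aux₁` and to `aux₂`, as far as the flags say so. -/
def move (f₁ f₂ : Bool) : MFrag M :=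
  (Frag.basic (.push (.inl .cnt) (fun _ => ()) (.goto fun _ => ()))).seq
    (.loop (moveTest f₁ f₂))

theorem runs_move (f₁ f₂ : Bool) (t : BTree (Leaf Bi Bo)) (w a b : List (Option (Leaf Bi Bo))) :
    (move (M := M) f₁ f₂).Runs (idle M) (conf M [] [] (t.word ++ w) a b [] fun _ => [])
      (conf M [] [] w (bif f₁ then t.word.reverse ++ a else a)
          (bif f₂ then t.word.reverse ++ b else b) [] fun _ => []) (t.size + 2) := by
  refine (Frag.Runs.seq (Frag.runs_basic (S' := conf M [] [] (t.word ++ w) a b [()] fun _ => [])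
    (by simp)) (runs_moveTest f₁ f₂ t w a b [] 1 _
      (Frag.runs_loop_false (stepAux_moveTest_nil f₁ f₂ _ _ _)))).mono ?_
  omega

/-- Move the content of `aux₁` to `val`. -/
def pour₁ : MFrag M :=
  .loop <| .pop (.inl .aux₁) (fun v s => (s, v.2)) <|
    .branch (fun v => v.1.isSome) (.push (.inl .val) (fun v => v.1.getD none) (answer true))
      (answer false)

theorem runs_pour₁ (a : List (Option (Leaf Bi Bo))) : ∀ w b : List (Option (Leaf Bi Bo)),
    (pour₁ (M := M)).Runs (idle M) (conf M [] [] w a b [] fun _ => [])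
      (conf M [] [] (a.reverse ++ w) [] b [] fun _ => []) (a.length + 1) := by
  induction a with
  | nil =>
    intro w b
    exact Frag.runs_loop_false (by simp [idle])
  | cons s a ih =>
    intro w b
    have h := ih (s :: w) b
    rw [List.reverse_cons, List.append_assoc]
    refine (Frag.runs_loop_true ?_ h).mono (by simp only [List.length_cons]; omega)
    simp [idle]

/-- Move the content of `aux₂` to `val`. -/
def pour₂ : MFrag M :=
  .loop <| .pop (.inl .aux₂) (fun v s => (s, v.2)) <|
    .branch (fun v => v.1.isSome) (.push (.inl .val) (fun v => v.1.getD none) (answer true))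
      (answer false)

theorem runs_pour₂ (b : List (Option (Leaf Bi Bo))) : ∀ w a : List (Option (Leaf Bi Bo)),
    (pour₂ (M := M)).Runs (idle M) (conf M [] [] w a b [] fun _ => [])
      (conf M [] [] (b.reverse ++ w) a [] [] fun _ => []) (b.length + 1) := by
  induction b with
  | nil =>
    intro w b
    exact Frag.runs_loop_false (by simp [idle])
  | cons s a ih =>
    intro w b
    have h := ih (s :: w) b
    rw [List.reverse_cons, List.append_assoc]
    refine (Frag.runs_loop_true ?_ h).mono (by simp only [List.length_cons]; omega)
    simp [idle]

/-- Remove the tree on the top of `val`. -/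
def drop : MFrag M := move false false

theorem runs_drop (t : BTree (Leaf Bi Bo)) (w : List (Option (Leaf Bi Bo))) :
    (drop (M := M)).Runs (idle M) (vals M (t.word ++ w)) (vals M w) (t.size + 2) :=
  runs_move false false t w [] []

/-- Duplicate the tree on the top of `val`. -/
def dup : MFrag M := ((move true true).seq pour₁).seq pour₂

theorem runs_dup (t : BTree (Leaf Bi Bo)) (w : List (Option (Leaf Bi Bo))) :
    (dup (M := M)).Runs (idle M) (vals M (t.word ++ w)) (vals M (t.word ++ (t.word ++ w)))
      (3 * t.size + 4) := by
  have h := ((runs_move (M := M) true true t w [] []).seq (runs_pour₁ _ _ _)).seq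
    (runs_pour₂ _ _ _)
  simp only [cond_true, List.append_nil, List.reverse_reverse, List.length_reverse,
    BTree.length_word] at h
  exact h.mono (by omega)

/-- Exchange the two trees on the top of `val`. -/
def swap : MFrag M := (((move true false).seq (move false true)).seq pour₁).seq pour₂

/-- The trees are parked on different auxiliary stacks; emptying `aux₁` first puts the former top
below. -/
theorem runs_swap (t u : BTree (Leaf Bi Bo)) (w : List (Option (Leaf Bi Bo))) :
    (swap (M := M)).Runs (idle M) (vals M (t.word ++ (u.word ++ w)))
      (vals M (u.word ++ (t.word ++ w))) (2 * t.size + 2 * u.size + 6) := by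
  have h := (((runs_move (M := M) true false t (u.word ++ w) [] []).seq
    (runs_move false true u w _ _)).seq (runs_pour₁ _ _ _)).seq (runs_pour₂ _ _ _)
  simp only [cond_true, cond_false, List.append_nil, List.reverse_reverse, List.length_reverse,
    BTree.length_word] at h
  exact h.mono (by omega)

/-- Test the root of the first component of the pair on the top of `val`. -/
def rootTest (p : Option (Leaf Bi Bo) → Bool) : MStmt M Bool :=
  .pop (.inl .val) (fun v _ => v) <| .peek (.inl .val) (fun v s => (s, v.2)) <|
    .push (.inl .val) (fun _ => none) <|
    .branch (fun v => v.1.any p) (answer true) (answer false)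

/-- In prefix notation the root of the first component lies directly below the `none` of the pair,
which is lifted off for a moment. -/
theorem stepAux_rootTest (p : Option (Leaf Bi Bo) → Bool) (t u : BTree (Leaf Bi Bo))
    (w : List (Option (Leaf Bi Bo))) :
    TM2.stepAux (rootTest (M := M) p) (idle M) (vals M ((t.node u).word ++ w)) =
      ⟨some (p t.root), idle M, vals M ((t.node u).word ++ w)⟩ := by
  cases t with
  | leaf s => cases h : p (some s) <;> simp [rootTest, idle, BTree.word, BTree.root, h]
  | node l r => cases h : p none <;> simp [rootTest, idle, BTree.word, BTree.root, h]

/-- The tree of a list of trees. -/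
def listTree (l : List (BTree (Leaf Bi Bo))) : BTree (Leaf Bi Bo) :=
  l.foldr .node (.leaf (.inl false))

/-- The tree of a word in the input alphabet. -/
def inWord (l : List Bi) : BTree (Leaf Bi Bo) := listTree (l.map fun s => .leaf (.inr (.inl s)))

/-- The tree of a word in the output alphabet. -/
def outWord (l : List Bo) : BTree (Leaf Bi Bo) := listTree (l.map fun s => .leaf (.inr (.inr s)))

theorem size_inWord (l : List Bi) : (inWord l : BTree (Leaf Bi Bo)).size = 2 * l.length + 1 := by
  induction l with
  | nil => rfl
  | cons s l ih => simp_all [inWord, listTree, BTree.size]; omega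

theorem size_outWord (l : List Bo) : (outWord l : BTree (Leaf Bi Bo)).size = 2 * l.length + 1 := by
  induction l with
  | nil => rfl
  | cons s l ih => simp_all [outWord, listTree, BTree.size]; omega

/-- Move the input to `val`. -/
def load : MFrag M :=
  (Frag.basic (.push (.inl .val) (fun _ => some (.inl false)) (.goto fun _ => ()))).seq <|
  .loop <| .pop (.inl .inp) (fun v s => (s.map fun s => some (.inr (.inl s)), v.2)) <|
    .branch (fun v => v.1.isSome)
      (.push (.inl .val) (fun v => v.1.getD none) <|
        .push (.inl .val) (fun _ => none) (answer true))
      (answer false)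

/-- Popping symbols and putting them in front of a list reverses the word; hence the reversals in
later statements about whole words. -/
theorem runs_load (l : List Bi) :
    (load (M := M)).Runs (idle M) (conf M l [] [] [] [] [] fun _ => [])
      (vals M (inWord l.reverse).word) (l.length + 2) := by
  have key : ∀ (l l' : List Bi),
      (Frag.loop <| .pop (.inl .inp) (fun v s => (s.map fun s => some (.inr (.inl s)), v.2)) <|
        .branch (fun v => v.1.isSome)
          (.push (.inl .val) (fun v => v.1.getD none) <|
            .push (.inl .val) (fun _ => none) (answer (M := M) true))
          (answer false)).Runs (idle M) (conf M l [] (inWord l').word [] [] [] fun _ => [])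
        (vals M (inWord (l.reverse ++ l')).word) (l.length + 1) := by
    intro l
    induction l with
    | nil =>
      intro l'
      exact Frag.runs_loop_false (by simp [idle])
    | cons s l ih =>
      intro l'
      have h := ih (s :: l')
      rw [List.reverse_cons, List.append_assoc]
      refine (Frag.runs_loop_true ?_ h).mono (by simp only [List.length_cons]; omega)
      simp [idle, inWord, listTree, BTree.word]
  have h := key l []
  rw [List.append_nil] at h
  refine (Frag.Runs.seq (Frag.runs_basic ?_) h).mono (by omega)
  simp [inWord, listTree, BTree.word]

/-- Move the result to the output. -/
def unload [Inhabited Bo] : MFrag M :=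
  .loop <| .pop (.inl .val) (fun v s => (s, v.2)) <|
    .branch (fun v => v.1.any Option.isNone)
      (.pop (.inl .val) (fun v s => (s, v.2)) <|
        .push (.inl .out) (fun v => match v.1 with
          | some (some (.inr (.inr s))) => s
          | _ => default) (answer true))
      (answer false)

theorem runs_unload [Inhabited Bo] (l : List Bo) : ∀ l' : List Bo,
    (unload (M := M)).Runs (idle M) (conf M [] l' (outWord l).word [] [] [] fun _ => [])
      (conf M [] (l.reverse ++ l') [] [] [] [] fun _ => []) (l.length + 1) := by
  induction l with
  | nil =>
    intro l'
    exact Frag.runs_loop_false (by simp [idle, outWord, listTree, BTree.word])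
  | cons s l ih =>
    intro l'
    have h := ih (s :: l')
    rw [List.reverse_cons, List.append_assoc]
    refine (Frag.runs_loop_true ?_ h).mono (by simp only [List.length_cons]; omega)
    simp [idle, outWord, listTree, BTree.word]

/-! #### The subroutine -/

/-- A statement of the subroutine, as a statement of the machine. -/
def liftStmt : TM2.Stmt M.tm.Γ M.tm.Λ M.tm.σ → MStmt M (Option M.tm.Λ)
  | .push k f q => .push (.inr k) (fun v => f v.2) (liftStmt q)
  | .peek k f q => .peek (.inr k) (fun v s => (v.1, f v.2 s)) (liftStmt q)
  | .pop k f q => .pop (.inr k) (fun v s => (v.1, f v.2 s)) (liftStmt q)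
  | .load f q => .load (fun v => (v.1, f v.2)) (liftStmt q)
  | .branch f q q' => .branch (fun v => f v.2) (liftStmt q) (liftStmt q')
  | .goto f => .goto fun v => some (f v.2)
  | .halt => .goto fun _ => none

/-- A halted subroutine has the label `none`, which is also the exit of a fragment, so halting
becomes leaving the fragment. -/
theorem stepAux_liftStmt (s : TM2.Stmt M.tm.Γ M.tm.Λ M.tm.σ) (v : M.tm.σ)
    (w : List (Option (Leaf Bi Bo))) (T : ∀ k, List (M.tm.Γ k)) :
    TM2.stepAux (liftStmt s) (none, v) (conf M [] [] w [] [] [] T) =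
      ⟨some (TM2.stepAux s v T).l, (none, (TM2.stepAux s v T).var),
        conf M [] [] w [] [] [] (TM2.stepAux s v T).stk⟩ := by
  induction s generalizing v T with
  | branch f q q' ih ih' =>
    simp only [liftStmt, TM2.stepAux]
    cases f v <;> simp [ih, ih']
  | _ => simp_all [liftStmt]

/-- The subroutine. -/
def sub : MFrag M where
  Lab := M.tm.Λ
  fin := M.tm.ΛFin
  entry := M.tm.main
  code l := liftStmt (M.tm.m l)

/-- The subroutine starts and ends with its memory in the initial state and with all its stacks
empty but one. It can therefore be run in the middle of a computation. -/
theorem runs_sub {l : List (M.tm.Γ M.tm.k₀)} {l' : List (M.tm.Γ M.tm.k₁)} {n : ℕ}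
    (h : TM2OutputsInTime M.tm l (some l') n) (w : List (Option (Leaf Bi Bo))) :
    (sub (M := M)).Runs (idle M) (conf M [] [] w [] [] [] (initList M.tm l).stk)
      (conf M [] [] w [] [] [] (haltList M.tm l').stk) n := by
  intro Λ m φ e
  have key : ∀ (s : ℕ) (c c' : TM2.Cfg M.tm.Γ M.tm.Λ M.tm.σ),
      (flip bind (TM2.step M.tm.m))^[s] (some c) = some c' →
      ReachIn (TM2.step m) s
        ⟨some (φ c.l), ((none, c.var) : Memory M), conf M [] [] w [] [] [] c.stk⟩
        ⟨some (φ c'.l), ((none, c'.var) : Memory M), conf M [] [] w [] [] [] c'.stk⟩ := by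
    intro s
    induction s with
    | zero =>
      intro c c' hc
      obtain rfl : c = c' := by simpa using hc
      exact ReachIn.refl _ _
    | succ s ih =>
      rintro ⟨_ | l, v, T⟩ c' hc
      -- A halted configuration has no successor, so no further step can lead to `c'`.
      · exfalso
        have h0 : ∀ s, (flip bind (TM2.step M.tm.m))^[s] none = none := by
          intro s
          induction s with
          | zero => rfl
          | succ s ih => rw [Function.iterate_succ_apply]; exact ih
        rw [Function.iterate_succ_apply] at hc
        exact absurd ((h0 s).symm.trans hc) (by simp)
      · rw [Function.iterate_succ_apply] at hc
        rw [add_comm]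
        exact (TM2.reachIn_one_of_mapLabel φ (e l) (stepAux_liftStmt _ _ _ _)).trans (ih _ _ hc)
  exact (key h.steps _ _ h.evals_in_steps).mono h.steps_le_m

theorem initList_stk (l : List (M.tm.Γ M.tm.k₀)) :
    (initList M.tm l).stk = Function.update (fun _ => []) M.tm.k₀ l := by
  funext k
  by_cases h : k = M.tm.k₀
  · subst h; simp [initList]
  · simp [initList, h]

theorem haltList_stk (l : List (M.tm.Γ M.tm.k₁)) :
    (haltList M.tm l).stk = Function.update (fun _ => []) M.tm.k₁ l := by
  funext k
  by_cases h : k = M.tm.k₁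
  · subst h; simp [haltList]
  · simp [haltList, h]

/-- Move a word from `val` to the input of the subroutine. -/
def feed [Inhabited Bi] : MFrag M :=
  .loop <| .pop (.inl .val) (fun v s => (s, v.2)) <|
    .branch (fun v => v.1.any Option.isNone)
      (.pop (.inl .val) (fun v s => (s, v.2)) <|
        .push (.inr M.tm.k₀) (fun v => M.inputAlphabet.symm <| match v.1 with
          | some (some (.inr (.inl s))) => s
          | _ => default) (answer true))
      (answer false)

theorem runs_feed [Inhabited Bi] (w : List (Option (Leaf Bi Bo))) (l : List Bi) :
    ∀ l' : List (M.tm.Γ M.tm.k₀),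
    (feed (M := M)).Runs (idle M)
      (conf M [] [] ((inWord l).word ++ w) [] [] [] (Function.update (fun _ => []) M.tm.k₀ l'))
      (conf M [] [] w [] [] [] (Function.update (fun _ => []) M.tm.k₀
        ((l.map M.inputAlphabet.symm).reverse ++ l'))) (l.length + 1) := by
  induction l with
  | nil =>
    intro l'
    exact Frag.runs_loop_false (by simp [idle, inWord, listTree, BTree.word])
  | cons s l ih =>
    intro l'
    have h := ih (M.inputAlphabet.symm s :: l')
    rw [List.map_cons, List.reverse_cons, List.append_assoc]
    refine (Frag.runs_loop_true ?_ h).mono (by simp only [List.length_cons]; omega)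
    simp [idle, inWord, listTree, BTree.word]

/-- Move a word from the output of the subroutine to `val`. -/
def collect : MFrag M :=
  (pushVal (some (.inl false))).seq <|
  .loop <| .pop (.inr M.tm.k₁)
      (fun v s => (s.map fun s => some (.inr (.inr (M.outputAlphabet s))), v.2)) <|
    .branch (fun v => v.1.isSome)
      (.push (.inl .val) (fun v => v.1.getD none) <|
        .push (.inl .val) (fun _ => none) (answer true))
      (answer false)

theorem runs_collect (w : List (Option (Leaf Bi Bo))) (l : List (M.tm.Γ M.tm.k₁)) :
    (collect (M := M)).Runs (idle M)
      (conf M [] [] w [] [] [] (Function.update (fun _ => []) M.tm.k₁ l))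
      (vals M ((outWord (l.map M.outputAlphabet).reverse).word ++ w)) (l.length + 2) := by
  have key : ∀ (l : List (M.tm.Γ M.tm.k₁)) (l' : List Bo),
      (Frag.loop <| .pop (.inr M.tm.k₁)
          (fun v s => (s.map fun s => some (.inr (.inr (M.outputAlphabet s))), v.2)) <|
        .branch (fun v => v.1.isSome)
          (.push (.inl .val) (fun v => v.1.getD none) <|
            .push (.inl .val) (fun _ => none) (answer (M := M) true))
          (answer false)).Runs (idle M)
        (conf M [] [] ((outWord l').word ++ w) [] [] [] (Function.update (fun _ => []) M.tm.k₁ l))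
        (vals M ((outWord ((l.map M.outputAlphabet).reverse ++ l')).word ++ w))
        (l.length + 1) := by
    intro l
    induction l with
    | nil =>
      intro l'
      refine Frag.runs_loop_false ?_
      simp [idle]
    | cons s l ih =>
      intro l'
      have h := ih (M.outputAlphabet s :: l')
      rw [List.map_cons, List.reverse_cons, List.append_assoc]
      refine (Frag.runs_loop_true ?_ h).mono (by simp only [List.length_cons]; omega)
      simp [idle, outWord, listTree, BTree.word]
  have h := key l []
  rw [List.append_nil] at h
  refine (Frag.Runs.seq (Frag.runs_basic ?_) h).mono (by omega)
  simp [outWord, listTree, BTree.word]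

/-- Call the subroutine: the word on the top of `val`, which is the argument in reverse order, is
replaced by the result in reverse order. -/
def call [Inhabited Bi] : MFrag M := (feed.seq sub).seq collect

theorem runs_call [Inhabited Bi] {l : List Bi} {l' : List Bo} {n : ℕ}
    (h : TM2OutputsInTime M.tm (l.map M.inputAlphabet.invFun)
      (some (l'.map M.outputAlphabet.invFun)) n) (w : List (Option (Leaf Bi Bo))) :
    (call (M := M)).Runs (idle M) (vals M ((inWord l.reverse).word ++ w))
      (vals M ((outWord l'.reverse).word ++ w)) (l.length + n + l'.length + 3) := by
  have h1 := runs_feed (M := M) w l.reverse []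
  have h2 := runs_sub h w
  have h3 := runs_collect (M := M) w (l'.map M.outputAlphabet.invFun)
  rw [haltList_stk] at h2
  rw [initList_stk] at h2
  have e1 : Function.update (fun k => ([] : List (M.tm.Γ k))) M.tm.k₀ [] = fun _ => [] :=
    Function.update_eq_self _ _
  have e2 : (l.reverse.map M.inputAlphabet.symm).reverse ++ [] =
      l.map M.inputAlphabet.invFun := by
    rw [List.append_nil, ← List.map_reverse, List.reverse_reverse]; rfl
  have e3 : (l'.map M.outputAlphabet.invFun).map M.outputAlphabet = l' := by
    rw [List.map_map]
    convert List.map_id l'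
    funext x
    exact M.outputAlphabet.apply_symm_apply x
  rw [e1, e2] at h1
  rw [e3] at h3
  refine ((h1.seq h2).seq h3).mono ?_
  simp only [List.length_reverse, List.length_map]
  omega

end TreeMachine

end Turing

/-! ### Polynomial-time computable functions on trees -/

namespace Turing

namespace TreeMachine

theorem eval_mono (p : Polynomial ℕ) {a b : ℕ} (h : a ≤ b) : p.eval a ≤ p.eval b := by
  rw [Polynomial.eval_eq_sum_range, Polynomial.eval_eq_sum_range]
  exact Finset.sum_le_sum fun i _ => by gcongr

variable {Bi Bo : Type} {M : TM2ComputableAux Bi Bo}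

variable (M) in
/-- A fragment turns each of the trees `x i` into `y i`, in polynomial time. -/
def Computes {I : Type} (x y : I → BTree (Leaf Bi Bo)) : Prop :=
  ∃ (F : MFrag M) (p : Polynomial ℕ), ∀ i,
    (∀ w, F.Runs (idle M) (vals M ((x i).word ++ w)) (vals M ((y i).word ++ w))
      (p.eval (x i).size)) ∧ (y i).size ≤ p.eval (x i).size

namespace Computes

variable {I J : Type} {x y z : I → BTree (Leaf Bi Bo)}

theorem of_eq {x' y' : I → BTree (Leaf Bi Bo)} (h : Computes M x y) (hx : ∀ i, x' i = x i)
    (hy : ∀ i, y' i = y i) : Computes M x' y' := by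
  obtain rfl : x' = x := funext hx
  obtain rfl : y' = y := funext hy
  exact h

theorem reindex (h : Computes M x y) (g : J → I) :
    Computes M (fun j => x (g j)) (fun j => y (g j)) :=
  let ⟨F, p, hp⟩ := h
  ⟨F, p, fun j => hp (g j)⟩

theorem of_isEmpty [IsEmpty I] : Computes M x y :=
  ⟨drop, 0, fun i => isEmptyElim i⟩

theorem refl (x : I → BTree (Leaf Bi Bo)) : Computes M x x :=
  ⟨.basic (.goto fun _ => ()), Polynomial.X + 1, fun i =>
    ⟨fun w => (Frag.runs_basic (by simp)).mono (by simp), by simp⟩⟩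

/-- The size bound contained in `Computes` is needed here: it bounds the time of the second fragment
in terms of the first argument. -/
theorem trans (h : Computes M x y) (h' : Computes M y z) : Computes M x z := by
  obtain ⟨F, p, hp⟩ := h
  obtain ⟨G, r, hr⟩ := h'
  refine ⟨F.seq G, p + r.comp p, fun i => ⟨fun w => ?_, ?_⟩⟩
  · refine (((hp i).1 w).seq ((hr i).1 w)).mono ?_
    simpa using eval_mono r (hp i).2
  · refine ((hr i).2.trans (eval_mono r (hp i).2)).trans ?_
    simp

/-- The second component is computed first, from a copy, so that the first one ends up on top of it.
-/
theorem node (h : Computes M x y) (h' : Computes M x z) :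
    Computes M x (fun i => (y i).node (z i)) := by
  obtain ⟨F, p, hp⟩ := h
  obtain ⟨G, r, hr⟩ := h'
  refine ⟨(((dup.seq G).seq swap).seq F).seq (pushVal none), 5 * Polynomial.X + p + 3 * r + 11,
    fun i => ⟨fun w => ?_, ?_⟩⟩
  · have := (((((runs_dup (x i) w).seq ((hr i).1 _)).seq (runs_swap (z i) (x i) w)).seq
      ((hp i).1 _)).seq (runs_pushVal none _))
    have e : ((y i).node (z i)).word ++ w = none :: ((y i).word ++ ((z i).word ++ w)) := by
      simp [BTree.word]
    rw [e]
    refine this.mono ?_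
    have := (hr i).2
    simp
    omega
  · have := (hr i).2
    have := (hp i).2
    simp [BTree.size]
    omega

theorem fst (x y : I → BTree (Leaf Bi Bo)) : Computes M (fun i => (x i).node (y i)) x := by
  refine ⟨(popVal.seq swap).seq drop, 4 * Polynomial.X + 9, fun i => ⟨fun w => ?_, ?_⟩⟩
  · have := ((runs_popVal (M := M) none ((x i).word ++ ((y i).word ++ w))).seq
      (runs_swap _ _ _)).seq (runs_drop _ _)
    have e : ((x i).node (y i)).word ++ w = none :: ((x i).word ++ ((y i).word ++ w)) := by
      simp [BTree.word]
    rw [e]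
    refine this.mono ?_
    simp [BTree.size]
    omega
  · simp [BTree.size]
    omega

theorem snd (x y : I → BTree (Leaf Bi Bo)) : Computes M (fun i => (x i).node (y i)) y := by
  refine ⟨popVal.seq drop, Polynomial.X + 9, fun i => ⟨fun w => ?_, ?_⟩⟩
  · have := (runs_popVal (M := M) none ((x i).word ++ ((y i).word ++ w))).seq
      (runs_drop _ _)
    have e : ((x i).node (y i)).word ++ w = none :: ((x i).word ++ ((y i).word ++ w)) := by
      simp [BTree.word]
    rw [e]
    refine this.mono ?_
    simp [BTree.size]
    omega
  · simp [BTree.size]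
    omega

theorem const (x : I → BTree (Leaf Bi Bo)) (t : BTree (Leaf Bi Bo)) :
    Computes M x (fun _ => t) := by
  have key : ∃ (F : MFrag M) (n : ℕ), ∀ w, F.Runs (idle M) (vals M w) (vals M (t.word ++ w)) n := by
    induction t with
    | leaf s => exact ⟨pushVal (some s), 1, fun w => runs_pushVal _ _⟩
    | node l r ihl ihr =>
      obtain ⟨F, n, hF⟩ := ihl
      obtain ⟨G, m, hG⟩ := ihr
      refine ⟨(G.seq F).seq (pushVal none), m + n + 1, fun w => ?_⟩
      have := ((hG w).seq (hF _)).seq (runs_pushVal none _)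
      simpa [BTree.word] using this
  obtain ⟨F, n, hF⟩ := key
  refine ⟨drop.seq F, Polynomial.X + 2 + (n : Polynomial ℕ) + (t.size : Polynomial ℕ),
    fun i => ⟨fun w => ((runs_drop _ _).seq (hF w)).mono ?_, ?_⟩⟩ <;> simp

/-- Since families may be indexed by subtypes, either fragment has to be correct only where it is
actually executed. -/
theorem branch {x y : I → BTree (Leaf Bi Bo)} (p : Option (Leaf Bi Bo) → Bool)
    (h : Computes M (I := {i // p (x i).root = true}) (fun i => (x i).node (y i)) (fun i => z i))
    (h' : Computes M (I := {i // p (x i).root = false}) (fun i => (x i).node (y i))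
      (fun i => z i)) :
    Computes M (fun i => (x i).node (y i)) z := by
  obtain ⟨F, r, hr⟩ := h
  obtain ⟨G, s, hs⟩ := h'
  refine ⟨.ite (rootTest p) F G, r + s + 1, fun i => ?_⟩
  cases hi : p (x i).root with
  | true =>
    refine ⟨fun w => (Frag.runs_ite_true ((stepAux_rootTest p _ _ _).trans (by rw [hi]))
      ((hr ⟨i, hi⟩).1 w)).mono ?_, (hr ⟨i, hi⟩).2.trans ?_⟩
    · simp; omega
    · simp; omega
  | false =>
    refine ⟨fun w => (Frag.runs_ite_false ((stepAux_rootTest p _ _ _).trans (by rw [hi]))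
      ((hs ⟨i, hi⟩).1 w)).mono ?_, (hs ⟨i, hi⟩).2.trans ?_⟩
    · simp; omega
    · simp; omega

/-- The sizes have to be bounded along the whole run in terms of the initial size: iterating a
polynomial-time body polynomially often may otherwise lead to exponential growth. -/
theorem iterate {x y : I → ℕ → BTree (Leaf Bi Bo)} (p : Option (Leaf Bi Bo) → Bool) (n : I → ℕ)
    (h : Computes M (I := {i : I × ℕ // i.2 < n i.1})
      (fun i => (x i.1.1 i.1.2).node (y i.1.1 i.1.2))
      (fun i => (x i.1.1 (i.1.2 + 1)).node (y i.1.1 (i.1.2 + 1))))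
    (hp : ∀ i j, j < n i → p (x i j).root = true) (hp' : ∀ i, p (x i (n i)).root = false)
    (r : Polynomial ℕ) (hr : ∀ i j, j ≤ n i →
      ((x i j).node (y i j)).size ≤ r.eval ((x i 0).node (y i 0)).size)
    (hn : ∀ i, n i ≤ r.eval ((x i 0).node (y i 0)).size) :
    Computes M (fun i => (x i 0).node (y i 0)) (fun i => (x i (n i)).node (y i (n i))) := by
  obtain ⟨F, s, hs⟩ := h
  refine ⟨.loopWhile (rootTest p) F, r * (s.comp r + 1) + 1 + r, fun i => ⟨fun w => ?_, ?_⟩⟩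
  · have key : ∀ k j, j + k = n i → (Frag.loopWhile (rootTest p) F).Runs (idle M)
        (vals M (((x i j).node (y i j)).word ++ w))
        (vals M (((x i (n i)).node (y i (n i))).word ++ w))
        (k * (s.eval (r.eval ((x i 0).node (y i 0)).size) + 1) + 1) := by
      intro k
      induction k with
      | zero =>
        intro j hj
        obtain rfl : j = n i := by omega
        rw [zero_mul, zero_add]
        exact Frag.runs_loopWhile_false ((stepAux_rootTest p _ _ _).trans (by rw [hp' i]))
      | succ k ih =>
        intro j hj
        have h1 := ih (j + 1) (by omega)
        have h2 := hs ⟨(i, j), by simp; omega⟩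
        have h3 := Frag.runs_loopWhile_true
          ((stepAux_rootTest p _ _ _).trans (by rw [hp i j (by omega)])) (h2.1 w) h1
        refine h3.mono ?_
        have := eval_mono s (hr i j (by omega))
        simp only [add_mul, one_mul]
        omega
    refine (key (n i) 0 (by omega)).mono ?_
    have := Nat.mul_le_mul_right (s.eval (r.eval ((x i 0).node (y i 0)).size) + 1) (hn i)
    simp
    omega
  · refine (hr i _ le_rfl).trans ?_
    simp

end Computes

/-! #### Types with an encoding -/

/-- An encoding of the elements of a type as trees. -/
class TreeEnc (Bi Bo : Type) (α : Type) where
  /-- the tree of an element -/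
  enc : α → BTree (Leaf Bi Bo)

open TreeEnc

instance : TreeEnc Bi Bo Bool := ⟨fun b => .leaf (.inl b)⟩
instance : TreeEnc Bi Bo Bi := ⟨fun s => .leaf (.inr (.inl s))⟩
instance : TreeEnc Bi Bo Bo := ⟨fun s => .leaf (.inr (.inr s))⟩
instance : TreeEnc Bi Bo Unit := ⟨fun _ => .leaf (.inl false)⟩
instance {α β : Type} [TreeEnc Bi Bo α] [TreeEnc Bi Bo β] : TreeEnc Bi Bo (α × β) :=
  ⟨fun x => (enc x.1).node (enc x.2)⟩
instance {α : Type} [TreeEnc Bi Bo α] : TreeEnc Bi Bo (List α) := ⟨fun l => listTree (l.map enc)⟩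
instance : TreeEnc Bi Bo ℕ := ⟨fun n => listTree (List.replicate n (.leaf (.inl false)))⟩

variable (Bi Bo) in
/-- The elements of the type are encoded as leaves, with different labels. -/
class LeafEnc (α : Type) [TreeEnc Bi Bo α] : Prop where
  /-- the label of an element -/
  exists_label : ∃ e : α → Leaf Bi Bo, Function.Injective e ∧ ∀ a, (enc a : BTree (Leaf Bi Bo)) =
    .leaf (e a)

instance : LeafEnc Bi Bo Bool := ⟨.inl, Sum.inl_injective, fun _ => rfl⟩
instance : LeafEnc Bi Bo Bi := ⟨fun s => .inr (.inl s),
  Sum.inr_injective.comp Sum.inl_injective, fun _ => rfl⟩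
instance : LeafEnc Bi Bo Bo := ⟨fun s => .inr (.inr s),
  Sum.inr_injective.comp Sum.inr_injective, fun _ => rfl⟩

variable (Bi Bo) in
/-- The size of an element. -/
def sz {α : Type} [TreeEnc Bi Bo α] (a : α) : ℕ := (enc a : BTree (Leaf Bi Bo)).size

section sz

variable {α β : Type} [TreeEnc Bi Bo α] [TreeEnc Bi Bo β]

theorem sz_pos (a : α) : 0 < sz Bi Bo a := BTree.size_pos _

@[simp] theorem sz_mk (a : α) (b : β) : sz Bi Bo (a, b) = sz Bi Bo a + sz Bi Bo b + 1 := rfl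

@[simp] theorem sz_nil : sz Bi Bo ([] : List α) = 1 := rfl

@[simp] theorem sz_cons (a : α) (l : List α) :
    sz Bi Bo (a :: l) = sz Bi Bo a + sz Bi Bo l + 1 := rfl

@[simp] theorem sz_nat (n : ℕ) : sz Bi Bo n = 2 * n + 1 := by
  induction n with
  | zero => rfl
  | succ n ih =>
    have : sz Bi Bo (n + 1) = 1 + sz Bi Bo n + 1 := rfl
    omega

theorem sz_leaf {α : Type} [TreeEnc Bi Bo α] [LeafEnc Bi Bo α] (a : α) : sz Bi Bo a = 1 := by
  obtain ⟨e, -, h⟩ := LeafEnc.exists_label (Bi := Bi) (Bo := Bo) (α := α)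
  simp [sz, h, BTree.size]

theorem sz_append (l l' : List α) : sz Bi Bo (l ++ l') + 1 = sz Bi Bo l + sz Bi Bo l' := by
  induction l with
  | nil => simp; omega
  | cons a l ih => simp; omega

theorem length_le_sz (l : List α) : 2 * l.length + 1 ≤ sz Bi Bo l := by
  induction l with
  | nil => simp
  | cons a l ih =>
    have := sz_pos (Bi := Bi) (Bo := Bo) a
    simp; omega

theorem sz_le_of_mem {a : α} {l : List α} (h : a ∈ l) : sz Bi Bo a ≤ sz Bi Bo l := by
  induction l with
  | nil => simp at h
  | cons b l ih =>
    rcases List.mem_cons.1 h with rfl | h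
    · simp; omega
    · have := ih h
      simp; omega

theorem sz_le_of_forall {l : List α} {c : ℕ} (h : ∀ a ∈ l, sz Bi Bo a ≤ c) :
    sz Bi Bo l ≤ l.length * (c + 1) + 1 := by
  induction l with
  | nil => simp
  | cons a l ih =>
    have h1 := ih fun b hb => h b (List.mem_cons_of_mem _ hb)
    have h2 := h a List.mem_cons_self
    simp [add_mul]; omega

theorem sz_list_leaf [LeafEnc Bi Bo α] (l : List α) : sz Bi Bo l = 2 * l.length + 1 := by
  induction l with
  | nil => simp
  | cons a l ih => simp [ih, sz_leaf]; omega

theorem sz_take_add_sz_drop (l : List α) (k : ℕ) :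
    sz Bi Bo (l.take k) + sz Bi Bo (l.drop k) = sz Bi Bo l + 1 := by
  rw [← sz_append, List.take_append_drop]

end sz

variable (M) in
/-- The function is computable in polynomial time. -/
def PolyT {α β : Type} [TreeEnc Bi Bo α] [TreeEnc Bi Bo β] (f : α → β) : Prop :=
  Computes M (fun a : α => enc a) (fun a => enc (f a))

namespace PolyT

variable {I α β γ δ : Type} [TreeEnc Bi Bo I] [TreeEnc Bi Bo α] [TreeEnc Bi Bo β]
  [TreeEnc Bi Bo γ] [TreeEnc Bi Bo δ]

theorem of_eq {f g : α → β} (h : PolyT M f) (e : ∀ a, g a = f a) : PolyT M g := by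
  obtain rfl : g = f := funext e
  exact h

theorem sz_le {f : α → β} (h : PolyT M f) :
    ∃ p : Polynomial ℕ, ∀ a, sz Bi Bo (f a) ≤ p.eval (sz Bi Bo a) :=
  let ⟨_, p, hp⟩ := h
  ⟨p, fun a => (hp a).2⟩

theorem id : PolyT M fun a : α => a := Computes.refl _

theorem comp {g : β → γ} {f : α → β} (hg : PolyT M g) (hf : PolyT M f) :
    PolyT M fun a => g (f a) :=
  Computes.trans hf (Computes.reindex hg f)

theorem const (b : β) : PolyT M fun _ : α => b := Computes.const _ _

theorem pair {f : α → β} {g : α → γ} (hf : PolyT M f) (hg : PolyT M g) :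
    PolyT M fun a => (f a, g a) := Computes.node hf hg

theorem fst' : PolyT M (Prod.fst : α × β → α) := Computes.fst _ _

theorem snd' : PolyT M (Prod.snd : α × β → β) := Computes.snd _ _

theorem fst {f : α → β × γ} (hf : PolyT M f) : PolyT M fun a => (f a).1 := fst'.comp hf

theorem snd {f : α → β × γ} (hf : PolyT M f) : PolyT M fun a => (f a).2 := snd'.comp hf

/-- Case distinction on the value of a function with a finite range. -/
theorem finCases [Finite α] [LeafEnc Bi Bo α] {c : I → α} (hc : PolyT M c) {f : α → I → β}
    (h : ∀ a, PolyT M (f a)) : PolyT M fun x => f (c x) x := by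
  classical
  have := Fintype.ofFinite α
  obtain ⟨e, he, e_enc⟩ := LeafEnc.exists_label (Bi := Bi) (Bo := Bo) (α := α)
  -- Induction on the set of values that are still possible: each test splits off one value, and in
  -- the end the family is empty.
  have key : ∀ S : Finset α, Computes M (I := {x // c x ∈ S})
      (fun x => (enc (c x)).node (enc x.1)) (fun x => enc (f (c x) x)) := by
    intro S
    induction S using Finset.induction_on with
    | empty =>
      have : IsEmpty {x // c x ∈ (∅ : Finset α)} := ⟨fun x => by simpa using x.2⟩
      exact Computes.of_isEmpty
    | insert a S _ ih =>
      refine Computes.branch (fun s => decide (s = some (e a))) ?_ ?_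
      · refine (Computes.trans (Computes.snd _ _) (Computes.reindex (h a) fun x => x.1.1)).of_eq
          (fun _ => rfl) fun x => ?_
        have := x.2
        simp only [e_enc, BTree.root, Option.some.injEq, decide_eq_true_eq] at this
        rw [he this]
      · refine Computes.reindex (J := {x : {x // c x ∈ insert a S} //
          decide ((enc (c x.1) : BTree (Leaf Bi Bo)).root = some (e a)) = false}) ih
          (fun x => ⟨x.1.1, ?_⟩)
        have := x.2
        simp only [e_enc, BTree.root, Option.some.injEq, decide_eq_false_iff_not] at this
        refine (Finset.mem_insert.1 x.1.2).resolve_left fun h => this (by rw [h])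
  exact Computes.trans (Computes.node hc (Computes.refl _))
    (Computes.reindex (key Finset.univ) fun x => ⟨x, Finset.mem_univ _⟩)

theorem of_finite [Finite α] [LeafEnc Bi Bo α] (f : α → β) : PolyT M f :=
  finCases (f := fun a _ => f a) id fun _ => const _

theorem ite {c : α → Bool} {f g : α → β} (hc : PolyT M c) (hf : PolyT M f) (hg : PolyT M g) :
    PolyT M fun a => if c a = true then f a else g a :=
  (finCases (f := fun b a => if b = true then f a else g a) hc fun b => by
    cases b <;> simpa)

theorem not {c : α → Bool} (hc : PolyT M c) : PolyT M fun a => !c a := (of_finite _).comp hc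

theorem and {c d : α → Bool} (hc : PolyT M c) (hd : PolyT M d) : PolyT M fun a => c a && d a :=
  (ite hc hd (const false)).of_eq fun a => by cases c a <;> rfl

theorem or {c d : α → Bool} (hc : PolyT M c) (hd : PolyT M d) : PolyT M fun a => c a || d a :=
  (ite hc (const true) hd).of_eq fun a => by cases c a <;> rfl

/-- Case distinction on the form of a list. -/
theorem listCases {l : I → List α} (hl : PolyT M l) {f : I → β} {g : I → α → List α → β}
    (hf : PolyT M f) (hg : PolyT M fun x : I × α × List α => g x.1 x.2.1 x.2.2) :
    PolyT M fun x => match l x with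
      | [] => f x
      | a :: m => g x a m := by
  refine Computes.trans (Computes.node hl (Computes.refl _)) ?_
  -- The tree of a non-empty list is an inner node, and it coincides with the tree of the pair of
  -- head and tail.
  refine Computes.branch Option.isNone ?_ ?_
  · have h1 : PolyT M fun x : (α × List α) × I => g x.2 x.1.1 x.1.2 :=
      comp hg (pair (snd id) (pair (fst (fst id)) (snd (fst id))))
    have h2 : ∀ x : {x : I // (enc (l x) : BTree (Leaf Bi Bo)).root.isNone = true},
        l x ≠ [] := by
      rintro ⟨x, hx⟩ h
      simp only at h
      rw [h] at hx
      simp [enc, listTree, BTree.root] at hx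
    refine (Computes.reindex h1
      fun x : {x : I // (enc (l x) : BTree (Leaf Bi Bo)).root.isNone = true} =>
        (((l x).head (h2 x), (l x).tail), x.1)).of_eq
      (fun x => ?_) fun x => ?_
    · obtain ⟨x, hx⟩ := x
      have := h2 ⟨x, hx⟩
      simp only at this ⊢
      conv_lhs => rw [← List.cons_head_tail this]
      rfl
    · obtain ⟨x, hx⟩ := x
      generalize_proofs h3
      revert h3
      dsimp only
      generalize l x = m
      intro h3
      cases m with
      | nil => exact absurd rfl h3
      | cons a m => rfl
  · refine (Computes.trans (Computes.snd _ _) (Computes.reindex hf Subtype.val)).of_eq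
      (fun _ => rfl) fun x => ?_
    obtain ⟨x, hx⟩ := x
    simp only at hx ⊢
    generalize l x = m at hx
    cases m with
    | nil => rfl
    | cons a m => exact absurd hx (by simp [enc, listTree, BTree.root])

theorem cons {f : I → α} {g : I → List α} (hf : PolyT M f) (hg : PolyT M g) :
    PolyT M fun x => f x :: g x := Computes.node hf hg

/-- The bound `hb` concerns all intermediate states; it cannot be deduced from `hf`. -/
theorem foldl {l : I → List α} {s : I → β} {f : I → β → α → β} (hl : PolyT M l) (hs : PolyT M s)
    (hf : PolyT M fun x : I × β × α => f x.1 x.2.1 x.2.2)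
    (hb : ∃ p : Polynomial ℕ, ∀ x j,
      sz Bi Bo (((l x).take j).foldl (f x) (s x)) ≤ p.eval (sz Bi Bo x)) :
    PolyT M fun x => (l x).foldl (f x) (s x) := by
  obtain ⟨p, hp⟩ := hb
  obtain ⟨r, hr⟩ := hl.sz_le
  refine Computes.trans (Computes.node hl (Computes.node (Computes.refl _) hs)) ?_
  refine Computes.trans ?_ (Computes.trans (Computes.snd (fun x => enc ([] : List α)) _)
    (Computes.snd (fun x : I => enc x) _))
  -- The remaining list controls the loop, and `x` is carried along because the body may use it.
  have := Computes.iterate (M := M) (x := fun (x : I) j => enc ((l x).drop j))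
    (y := fun x j => (enc x).node (enc (((l x).take j).foldl (f x) (s x))))
    Option.isNone (fun x => (l x).length) ?_ ?_ ?_ (r + Polynomial.X + p + 2) ?_ ?_
  · exact this.of_eq (fun x => by simp) fun x => by simp
  · have h1 : PolyT M fun y : (α × List α) × (I × β) => (y.1.2, y.2.1, f y.2.1 y.2.2 y.1.1) :=
      pair (snd (fst id)) (pair (fst (snd id))
        (comp hf (pair (fst (snd id)) (pair (snd (snd id)) (fst (fst id))))))
    refine (Computes.reindex h1 fun i => (((l i.1.1)[i.1.2]'i.2, (l i.1.1).drop (i.1.2 + 1)),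
      (i.1.1, (((l i.1.1).take i.1.2).foldl (f i.1.1) (s i.1.1))))).of_eq (fun i => ?_) fun i => ?_
    · rw [List.drop_eq_getElem_cons i.2]
      rfl
    · dsimp only
      rw [List.take_succ_eq_append_getElem i.2, List.foldl_append]
      rfl
  · intro x j hj
    rw [List.drop_eq_getElem_cons hj]
    rfl
  · intro x
    simp only [List.drop_length]
    rfl
  · intro x j _
    have h1 := hp x j
    have h2 := sz_take_add_sz_drop (Bi := Bi) (Bo := Bo) (l x) j
    have h3 := hr x
    have h4 := sz_pos (Bi := Bi) (Bo := Bo) ((l x).take j)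
    have h5 : sz Bi Bo x ≤ ((enc ((l x).drop 0)).node
        ((enc x).node (enc (((l x).take 0).foldl (f x) (s x))) : BTree (Leaf Bi Bo))).size := by
      simp [BTree.size, sz]; omega
    have h6 := eval_mono r h5
    have h7 := eval_mono p h5
    generalize ((enc ((l x).drop 0)).node
        ((enc x).node (enc (((l x).take 0).foldl (f x) (s x))) : BTree (Leaf Bi Bo))).size = N at *
    simp only [BTree.size, Polynomial.eval_add, Polynomial.eval_X, Polynomial.eval_ofNat]
    simp only [sz] at *
    omega
  · intro x
    have := length_le_sz (Bi := Bi) (Bo := Bo) (l x)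
    simp [BTree.size, sz] at *
    omega

/-- A fold, each step of which enlarges the state by an amount that does not depend on the state. -/
theorem foldl_of_le {l : I → List α} {s : I → β} {f : I → β → α → β} (hl : PolyT M l)
    (hs : PolyT M s) (hf : PolyT M fun x : I × β × α => f x.1 x.2.1 x.2.2)
    (hb : ∃ p : Polynomial ℕ, ∀ x b, ∀ a ∈ l x,
      sz Bi Bo (f x b a) ≤ sz Bi Bo b + p.eval (sz Bi Bo x)) :
    PolyT M fun x => (l x).foldl (f x) (s x) := by
  obtain ⟨p, hp⟩ := hb
  obtain ⟨r, hr⟩ := hl.sz_le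
  obtain ⟨t, ht⟩ := hs.sz_le
  refine foldl hl hs hf ⟨t + r * p, fun x j => ?_⟩
  have key : ∀ (m : List α) (b : β), (∀ a ∈ m, a ∈ l x) →
      sz Bi Bo (m.foldl (f x) b) ≤ sz Bi Bo b + m.length * p.eval (sz Bi Bo x) := by
    intro m
    induction m with
    | nil => simp
    | cons a m ih =>
      intro b hm
      have h1 := hp x b a (hm a List.mem_cons_self)
      have h2 := ih (f x b a) fun a' ha' => hm a' (List.mem_cons_of_mem _ ha')
      simp only [List.foldl_cons, List.length_cons, add_mul, one_mul]
      omega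
  have h1 := key ((l x).take j) (s x) fun a ha => List.mem_of_mem_take ha
  have h2 := length_le_sz (Bi := Bi) (Bo := Bo) (l x)
  have h3 := hr x
  have h4 := ht x
  have h5 : ((l x).take j).length ≤ r.eval (sz Bi Bo x) := by
    have := List.length_take_le' j (l x)
    omega
  have h6 := Nat.mul_le_mul_right (p.eval (sz Bi Bo x)) h5
  simp only [Polynomial.eval_add, Polynomial.eval_mul]
  omega

end PolyT

end TreeMachine

end Turing

/-! ### A library of polynomial-time computable functions -/

namespace Turing

namespace TreeMachine

open TreeEnc

namespace PolyT

variable {Bi Bo : Type} {M : TM2ComputableAux Bi Bo}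
variable {I α β γ δ : Type} [TreeEnc Bi Bo I] [TreeEnc Bi Bo α] [TreeEnc Bi Bo β]
  [TreeEnc Bi Bo γ] [TreeEnc Bi Bo δ]

theorem sz_le_of_mem {l : I → List α} (hl : PolyT M l) :
    ∃ p : Polynomial ℕ, ∀ x, ∀ a ∈ l x, sz Bi Bo a ≤ p.eval (sz Bi Bo x) :=
  let ⟨p, hp⟩ := hl.sz_le
  ⟨p, fun x _ ha => (TreeMachine.sz_le_of_mem ha).trans (hp x)⟩

theorem reverse {l : I → List α} (hl : PolyT M l) : PolyT M fun x => (l x).reverse := by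
  have : PolyT M fun x => (l x).foldl (fun b a => a :: b) [] := by
    refine foldl_of_le hl (const _) (cons (snd (snd id)) (fst (snd id))) ?_
    obtain ⟨p, hp⟩ := hl.sz_le_of_mem
    refine ⟨p + 1, fun x b a ha => ?_⟩
    have := hp x a ha
    simp; omega
  exact this.of_eq fun x => by simp

theorem append {l m : I → List α} (hl : PolyT M l) (hm : PolyT M m) :
    PolyT M fun x => l x ++ m x := by
  have : PolyT M fun x => (l x).reverse.foldl (fun b a => a :: b) (m x) := by
    refine foldl_of_le hl.reverse hm (cons (snd (snd id)) (fst (snd id))) ?_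
    obtain ⟨p, hp⟩ := hl.reverse.sz_le_of_mem
    refine ⟨p + 1, fun x b a ha => ?_⟩
    have := hp x a ha
    simp; omega
  exact this.of_eq fun x => by simp

theorem flatMap {l : I → List α} {g : I → α → List β} (hl : PolyT M l)
    (hg : PolyT M fun y : I × α => g y.1 y.2) : PolyT M fun x => (l x).flatMap (g x) := by
  have : PolyT M fun x => (l x).reverse.foldl (fun b a => g x a ++ b) [] := by
    refine foldl_of_le hl.reverse (const _)
      (append (comp hg (pair (fst id) (snd (snd id)))) (fst (snd id))) ?_
    obtain ⟨p, hp⟩ := hl.reverse.sz_le_of_mem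
    obtain ⟨r, hr⟩ := hg.sz_le
    refine ⟨r.comp (p + Polynomial.X + 1), fun x b a ha => ?_⟩
    have h1 := hp x a ha
    have h2 := hr (x, a)
    have h3 := sz_append (Bi := Bi) (Bo := Bo) (g x a) b
    have h4 : sz Bi Bo (x, a) ≤ (p + Polynomial.X + 1).eval (sz Bi Bo x) := by
      simp; omega
    have h5 := eval_mono r h4
    rw [Polynomial.eval_comp]
    simp only at h2
    omega
  refine this.of_eq fun x => ?_
  have key : ∀ (l : List α) (b : List β),
      l.reverse.foldl (fun b a => g x a ++ b) b = l.flatMap (g x) ++ b := by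
    intro l
    induction l with
    | nil => simp
    | cons a l ih => intro b; simp [List.foldl_append, ih]
  simpa using (key (l x) []).symm

theorem map {l : I → List α} {g : I → α → β} (hl : PolyT M l)
    (hg : PolyT M fun y : I × α => g y.1 y.2) : PolyT M fun x => (l x).map (g x) :=
  (flatMap (g := fun x a => [g x a]) hl (cons hg (const _))).of_eq fun x => by
    rw [List.map_eq_flatMap]

theorem filter {l : I → List α} {g : I → α → Bool} (hl : PolyT M l)
    (hg : PolyT M fun y : I × α => g y.1 y.2) : PolyT M fun x => (l x).filter (g x) := by
  refine (flatMap (g := fun x a => if g x a = true then [a] else []) hl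
    (ite hg (cons (snd id) (const _)) (const _))).of_eq fun x => ?_
  induction l x with
  | nil => rfl
  | cons a l ih => by_cases h : g x a <;> simp [h, ih]

theorem tail {l : I → List α} (hl : PolyT M l) : PolyT M fun x => (l x).tail :=
  (listCases hl (f := fun _ => []) (g := fun _ _ m => m) (const _) (snd (snd id))).of_eq
    fun x => by cases l x <;> rfl

theorem headD {l : I → List α} {d : I → α} (hl : PolyT M l) (hd : PolyT M d) :
    PolyT M fun x => (l x).headD (d x) :=
  (listCases hl (f := d) (g := fun _ a _ => a) hd (fst (snd id))).of_eq
    fun x => by cases l x <;> rfl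

theorem isEmpty {l : I → List α} (hl : PolyT M l) : PolyT M fun x => (l x).isEmpty :=
  (listCases hl (f := fun _ => true) (g := fun _ _ _ => false) (const _) (const _)).of_eq
    fun x => by cases l x <;> rfl

theorem any {l : I → List α} {g : I → α → Bool} (hl : PolyT M l)
    (hg : PolyT M fun y : I × α => g y.1 y.2) : PolyT M fun x => (l x).any (g x) :=
  (not (isEmpty (filter hl hg))).of_eq fun x => by
    rw [Bool.eq_iff_iff]; simp [List.filter_eq_nil_iff]

theorem all {l : I → List α} {g : I → α → Bool} (hl : PolyT M l)
    (hg : PolyT M fun y : I × α => g y.1 y.2) : PolyT M fun x => (l x).all (g x) :=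
  (isEmpty (filter (g := fun x a => !g x a) hl (not hg))).of_eq fun x => by
    rw [Bool.eq_iff_iff]; simp [List.filter_eq_nil_iff]

/-! #### Natural numbers, in unary notation -/

/-- A natural number has the same tree as a list of that many elements of `Unit`. Arithmetic thereby
reduces to operations on lists. -/
theorem length {l : I → List α} (hl : PolyT M l) : PolyT M fun x => (l x).length := by
  have : PolyT M fun x => ((l x).map fun _ => ()) := map hl (const _)
  refine Computes.of_eq this (fun _ => rfl) fun x => ?_
  simp only [enc, List.map_map]
  congr 1
  exact (List.eq_replicate_iff.2 (by simp)).symm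

theorem replicate {n : I → ℕ} {f : I → α} (hn : PolyT M n) (hf : PolyT M f) :
    PolyT M fun x => List.replicate (n x) (f x) := by
  have : PolyT M fun x => List.replicate (n x) () := by
    refine Computes.of_eq hn (fun _ => rfl) fun x => ?_
    simp [enc]
  exact (map (g := fun x _ => f x) this (comp hf (fst id))).of_eq fun x => by simp

theorem iterate {n : I → ℕ} {s : I → β} {f : I → β → β} (hn : PolyT M n) (hs : PolyT M s)
    (hf : PolyT M fun x : I × β => f x.1 x.2)
    (hb : ∃ p : Polynomial ℕ, ∀ x b, sz Bi Bo (f x b) ≤ sz Bi Bo b + p.eval (sz Bi Bo x)) :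
    PolyT M fun x => (f x)^[n x] (s x) := by
  refine (foldl_of_le (replicate hn (const ())) hs (f := fun x b _ => f x b)
    (comp hf (pair (fst id) (fst (snd id)))) ?_).of_eq fun x => ?_
  · obtain ⟨p, hp⟩ := hb
    exact ⟨p, fun x b _ _ => hp x b⟩
  · have key : ∀ (n : ℕ) (b : β),
        (List.replicate n ()).foldl (fun b _ => f x b) b = (f x)^[n] b := by
      intro n
      induction n with
      | zero => simp
      | succ n ih => intro b; simp [List.replicate_succ, ih]
    exact (key _ _).symm

theorem drop {n : I → ℕ} {l : I → List α} (hn : PolyT M n) (hl : PolyT M l) :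
    PolyT M fun x => (l x).drop (n x) := by
  refine (iterate (f := fun _ m => m.tail) hn hl (tail (snd id)) ⟨0, fun x b => ?_⟩).of_eq
    fun x => ?_
  · cases b <;> simp
    omega
  · generalize l x = m
    induction n x generalizing m with
    | zero => rfl
    | succ n ih =>
      rw [Function.iterate_succ_apply, ← ih]
      cases m <;> simp

theorem getD {n : I → ℕ} {l : I → List α} {d : I → α} (hn : PolyT M n) (hl : PolyT M l)
    (hd : PolyT M d) : PolyT M fun x => (l x).getD (n x) (d x) :=
  (headD (drop hn hl) hd).of_eq fun x => by simp [List.headD_eq_head?_getD, List.getD]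

theorem take {n : I → ℕ} {l : I → List α} (hn : PolyT M n) (hl : PolyT M l) :
    PolyT M fun x => (l x).take (n x) := by
  have h : PolyT M fun x => (fun s : List α × List α =>
      match s.2 with
      | [] => s
      | a :: m => (a :: s.1, m))^[n x] ([], l x) := by
    refine iterate (f := fun _ (s : List α × List α) => match s.2 with
      | [] => s
      | a :: m => (a :: s.1, m)) hn (pair (const _) hl)
      (listCases (l := fun x : I × (List α × List α) => x.2.2) (f := fun x => x.2)
        (g := fun x a m => (a :: x.2.1, m)) (snd (snd id)) (snd id)
        (pair (cons (fst (snd id)) (fst (snd (fst id)))) (snd (snd id)))) ⟨0, ?_⟩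
    rintro x ⟨a, _ | ⟨b, m⟩⟩
    · simp
    · simp; omega
  refine (reverse (fst h)).of_eq fun x => ?_
  have key : ∀ (n : ℕ) (l m : List α), ((fun s : List α × List α =>
      match s.2 with
      | [] => s
      | a :: m => (a :: s.1, m))^[n] (m, l)).1 = (l.take n).reverse ++ m := by
    intro n
    induction n with
    | zero => simp
    | succ n ih =>
      intro l m
      rw [Function.iterate_succ_apply]
      cases l with
      | nil => simpa using ih [] m
      | cons a l => simpa using ih l (a :: m)
  rw [key]
  simp

theorem add {m n : I → ℕ} (hm : PolyT M m) (hn : PolyT M n) : PolyT M fun x => m x + n x :=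
  (length (append (replicate hm (const ())) (replicate hn (const ())))).of_eq fun x => by simp

theorem mul {m n : I → ℕ} (hm : PolyT M m) (hn : PolyT M n) : PolyT M fun x => m x * n x :=
  (length (flatMap (g := fun x _ => List.replicate (n x) ()) (replicate hm (const ()))
    (comp (replicate hn (const ())) (fst id)))).of_eq fun x => by
      simp [List.length_flatMap]

theorem sub {m n : I → ℕ} (hm : PolyT M m) (hn : PolyT M n) : PolyT M fun x => m x - n x :=
  (length (drop hn (replicate hm (const ())))).of_eq fun x => by simp

theorem le {m n : I → ℕ} (hm : PolyT M m) (hn : PolyT M n) :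
    PolyT M fun x => decide (m x ≤ n x) :=
  (isEmpty (drop hn (replicate hm (const ())))).of_eq fun x => by
    rw [Bool.eq_iff_iff]; simp; omega

theorem eq {m n : I → ℕ} (hm : PolyT M m) (hn : PolyT M n) :
    PolyT M fun x => decide (m x = n x) :=
  (and (le hm hn) (le hn hm)).of_eq fun x => by
    rw [Bool.eq_iff_iff]; simp; omega

theorem sum {l : I → List ℕ} (hl : PolyT M l) : PolyT M fun x => (l x).sum :=
  (length (flatMap (g := fun _ n => List.replicate n ()) hl
    (replicate (snd id) (const ())))).of_eq fun x => by
      simp [List.length_flatMap]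

/-- The length of the list built so far is the next number. -/
theorem range {n : I → ℕ} (hn : PolyT M n) : PolyT M fun x => List.range (n x) := by
  have key : ∀ n : ℕ, (List.replicate n ()).foldl (fun (b : List ℕ) _ => b.length :: b) [] =
      (List.range n).reverse := by
    intro n
    induction n with
    | zero => rfl
    | succ n ih => simp [List.replicate_succ', ih, List.range_succ]
  have : PolyT M fun x => (List.replicate (n x) ()).foldl
      (fun (b : List ℕ) _ => b.length :: b) [] := by
    refine foldl (replicate hn (const ())) (const _)
      (cons (length (fst (snd id))) (fst (snd id))) ?_
    obtain ⟨p, hp⟩ := hn.sz_le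
    refine ⟨p * (p + 1) + 1, fun x j => ?_⟩
    rw [List.take_replicate, key]
    have h1 : ∀ a ∈ (List.range (min j (n x))).reverse, sz Bi Bo a ≤ p.eval (sz Bi Bo x) := by
      intro a ha
      have h2 := hp x
      simp at ha
      simp only [sz_nat] at h2 ⊢
      omega
    refine (sz_le_of_forall h1).trans ?_
    have h2 := hp x
    simp only [sz_nat] at h2
    simp only [List.length_reverse, List.length_range, Polynomial.eval_add, Polynomial.eval_mul,
      Polynomial.eval_one]
    gcongr
    omega
  exact (reverse this).of_eq fun x => by rw [key]; simp

/-- The quotient counts the `j < m x` with `(j + 1) * n x ≤ m x`. The test `1 ≤ n x` yields the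
value `0` for a division by zero. -/
theorem div {m n : I → ℕ} (hm : PolyT M m) (hn : PolyT M n) : PolyT M fun x => m x / n x := by
  refine (length (filter (g := fun x j => decide (1 ≤ n x) && decide ((j + 1) * n x ≤ m x))
    (range hm) (and (le (const 1) (comp hn (fst id)))
      (le (mul (add (snd id) (const 1)) (comp hn (fst id))) (comp hm (fst id)))))).of_eq fun x => ?_
  rcases Nat.eq_zero_or_pos (n x) with h | hn
  · simp [h]
  · have : (List.range (m x)).filter (fun j => decide (1 ≤ n x) && decide ((j + 1) * n x ≤ m x)) =
        List.range (m x / n x) := by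
      have hle : m x / n x ≤ m x := Nat.div_le_self _ _
      have h0 : decide (1 ≤ n x) = true := decide_eq_true hn
      simp only [h0, Bool.true_and]
      obtain ⟨k, hk⟩ := Nat.exists_eq_add_of_le hle
      rw [hk, List.range_add, ← hk, List.filter_append]
      have h1 : (List.range (m x / n x)).filter (fun j => decide ((j + 1) * n x ≤ m x)) =
          List.range (m x / n x) := by
        rw [List.filter_eq_self]
        intro j hj
        simpa using (Nat.le_div_iff_mul_le hn).1 (List.mem_range.1 hj)
      have h2 : ((List.range k).map fun i => m x / n x + i).filter
          (fun j => decide ((j + 1) * n x ≤ m x)) = [] := by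
        rw [List.filter_eq_nil_iff]
        intro j hj
        obtain ⟨i, -, rfl⟩ := List.mem_map.1 hj
        intro h
        have := (Nat.le_div_iff_mul_le hn).2 (of_decide_eq_true h)
        omega
      rw [h1, h2, List.append_nil]
    rw [this, List.length_range]

/-- A function of finitely many entries of a list over a finite alphabet. -/
theorem of_entries [Finite α] [LeafEnc Bi Bo α] (d : α) (k : ℕ) (g : (Fin k → α) → β) :
    PolyT M fun l : List α => g fun p => l.getD p d := by
  induction k with
  | zero => exact (const (g default)).of_eq fun l => by congr 1; exact Subsingleton.elim _ _
  | succ k ih =>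
    refine (finCases (c := fun l : List α => l.headD d)
      (f := fun a l => g (Fin.cons a fun p : Fin k => l.tail.getD p d)) (headD id (const d))
      fun a => comp (g := fun l : List α => g (Fin.cons a fun p : Fin k => l.getD p d))
        (ih fun z => g (Fin.cons a z)) (tail id)).of_eq fun l => ?_
    congr 1
    funext p
    cases l <;> cases p using Fin.cases <;> simp

end PolyT

end TreeMachine

end Turing

/-! ### From programs to Turing machines -/

namespace Turing

namespace TreeMachine

open TreeEnc

variable {Bi Bo : Type}

/-- A polynomial-time subroutine whose results are not longer than its arguments may be called. -/
theorem Computes.call [Inhabited Bi] {I : Type} {e : I → List Bi} {f : I → List Bo}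
    (h : TM2ComputableInPolyTime e (fun l : List Bo => l) f)
    (hlen : ∀ i, (f i).length ≤ (e i).length) :
    Computes h.toTM2ComputableAux (fun i => inWord (e i).reverse)
      (fun i => outWord (f i).reverse) := by
  -- `hlen` bounds the size of the result and the time for collecting it.
  refine ⟨TreeMachine.call, 2 * Polynomial.X + h.time + 3, fun i => ⟨fun w => ?_, ?_⟩⟩
  · refine (runs_call (M := h.toTM2ComputableAux) (h.outputsFun i) w).mono ?_
    have := eval_mono h.time (show (e i).length ≤ 2 * (e i).length + 1 by omega)
    have := hlen i
    simp [size_inWord]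
    omega
  · have := hlen i
    simp [size_inWord, size_outWord]
    omega

/-- The Turing machine that runs a fragment on its input. -/
def machine (M : TM2ComputableAux Bi Bo) [Fintype Bi] [Fintype Bo] [Inhabited Bo]
    (F : MFrag M) : FinTM2 where
  K := OwnStack ⊕ M.tm.K
  kFin := letI := M.tm.kFin; inferInstance
  k₀ := .inl .inp
  k₁ := .inl .out
  Γ := Alphabet M
  Λ := Option ((load.seq F).seq unload).Lab
  main := some ((load.seq F).seq unload).entry
  ΛFin := inferInstance
  σ := Memory M
  initialState := idle M
  σFin := letI := M.tm.σFin; inferInstance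
  Γk₀Fin := ‹Fintype Bi›
  m
    | none => .halt
    | some l => ((load.seq F).seq unload).code l

theorem initList_machine (M : TM2ComputableAux Bi Bo) [Fintype Bi] [Fintype Bo] [Inhabited Bo]
    (F : MFrag M) (l : List Bi) :
    initList (machine M F) l =
      ⟨some (some ((load.seq F).seq unload).entry), idle M,
        conf M l [] [] [] [] [] fun _ => []⟩ := by
  have : (initList (machine M F) l).stk = conf M l [] [] [] [] [] fun _ => [] := by
    funext k
    rcases k with (_ | _ | _ | _ | _ | _) | k <;> rfl
  rw [← this]
  rfl

theorem haltList_machine (M : TM2ComputableAux Bi Bo) [Fintype Bi] [Fintype Bo] [Inhabited Bo]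
    (F : MFrag M) (l : List Bo) :
    haltList (machine M F) l = ⟨none, idle M, conf M [] l [] [] [] [] fun _ => []⟩ := by
  have : (haltList (machine M F) l).stk = conf M [] l [] [] [] [] fun _ => [] := by
    funext k
    rcases k with (_ | _ | _ | _ | _ | _) | k <;> rfl
  rw [← this]
  rfl

theorem Computes.computableInPolyTime {M : TM2ComputableAux Bi Bo} [Fintype Bi] [Fintype Bo]
    [Inhabited Bo] {I : Type} {e : I → List Bi} {f : I → List Bo}
    (h : Computes M (fun i => inWord (e i).reverse) (fun i => outWord (f i).reverse)) :
    Nonempty (TM2ComputableInPolyTime e (id : List Bo → List Bo) f) := by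
  obtain ⟨F, p, hF⟩ := h
  have key : ∀ i, ReachIn (machine M F).step
      ((Polynomial.X + 5 + p.comp (2 * Polynomial.X + 1) +
        p.comp (2 * Polynomial.X + 1)).eval (e i).length)
      (initList (machine M F) (e i)) (haltList (machine M F) (f i)) := by
    intro i
    have h1 := runs_load (M := M) (e i)
    have h2 := (hF i).1 []
    have h3 := runs_unload (M := M) (f i).reverse []
    have h4 := (hF i).2
    simp only [List.append_nil, List.reverse_reverse, List.length_reverse] at h2 h3
    have h5 := ((h1.seq h2).seq h3) _ (machine M F).m (fun o => o) fun l =>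
      (TM2.Stmt.mapLabel_id _).symm
    rw [initList_machine, haltList_machine]
    -- One more step executes the `halt` at the exit label.
    refine (h5.trans (ReachIn.single rfl)).mono ?_
    rw [size_outWord, size_inWord] at h4
    rw [size_inWord]
    simp only [List.length_reverse] at h4 ⊢
    simp
    omega
  refine ⟨{
    tm := machine M F
    inputAlphabet := Equiv.refl Bi
    outputAlphabet := Equiv.refl Bo
    time := Polynomial.X + 5 + p.comp (2 * Polynomial.X + 1) + p.comp (2 * Polynomial.X + 1)
    outputsFun := fun i => ?_ }⟩
  have hi : (e i).map (Equiv.refl Bi).invFun = e i := List.map_id _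
  have ho : (f i).map (Equiv.refl Bo).invFun = f i := List.map_id _
  have h6 := key i
  refine Classical.choice ?_
  obtain ⟨s, hs, hs'⟩ := h6
  refine ⟨⟨⟨s, ?_⟩, hs⟩⟩
  refine Eq.trans ?_ (hs'.trans ?_)
  · exact congrArg
      (fun l => (flip bind (machine M F).step)^[s] (some (initList (machine M F) l))) hi
  · show some (haltList (machine M F) (f i)) = some (haltList (machine M F) _)
    exact congrArg (fun l => some (haltList (machine M F) l)) ho.symm

end TreeMachine

end Turing

/-! ### The regular instance -/

theorem List.sum_flatMap {α : Type*} (l : List α) (f : α → List ℕ) :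
    (l.flatMap f).sum = (l.map fun a => (f a).sum).sum := by
  induction l with
  | nil => rfl
  | cons a l ih => simp [ih]

theorem List.sum_map_sum_map_comm {α β : Type*} (l : List α) (m : List β) (f : α → β → ℕ) :
    (l.map fun a => (m.map fun b => f a b).sum).sum =
      (m.map fun b => (l.map fun a => f a b).sum).sum := by
  induction l with
  | nil => simp
  | cons a l ih => simp [ih, List.sum_map_add]

theorem List.sum_map_filter_of_eq_zero {α : Type*} (l : List α) (p : α → Bool) (f : α → ℕ)
    (h : ∀ a ∈ l, p a = false → f a = 0) : ((l.filter p).map f).sum = (l.map f).sum := by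
  induction l with
  | nil => rfl
  | cons a l ih =>
    have ih := ih fun b hb => h b (List.mem_cons_of_mem _ hb)
    cases hp : p a with
    | true => simp [hp, ih]
    | false => simp [hp, ih, h a List.mem_cons_self hp]

theorem List.sum_map_ite_eq_count (l : List ℕ) (v : ℕ) :
    (l.map fun x => if x = v then 1 else 0).sum = l.count v := by
  induction l with
  | nil => rfl
  | cons x l ih => simp [ih, List.count_cons]; ring

namespace CSPReduction

/-- All choices of one element from each of the lists `ll`; they are listed so often that there are
`T ^ k` of them if each of the lists is of length `T`. -/
def expand (T : ℕ) : ℕ → List (List ℕ) → List (List ℕ)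
  | 0, _ => [[]]
  | k + 1, [] => (List.replicate T ()).flatMap fun _ => expand T k []
  | k + 1, l :: ll => l.flatMap fun x => (expand T k ll).map fun ys => x :: ys

section expand

variable {T : ℕ}

theorem length_expand {k : ℕ} {ll : List (List ℕ)} (h : ∀ l ∈ ll, l.length = T) :
    (expand T k ll).length = T ^ k := by
  induction k generalizing ll with
  | zero => simp [expand]
  | succ k ih =>
    cases ll with
    | nil => simp [expand, List.length_flatMap, ih, pow_succ']
    | cons l ll =>
      have := ih fun m hm => h m (List.mem_cons_of_mem _ hm)
      simp [expand, List.length_flatMap, this, h l List.mem_cons_self, pow_succ']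

theorem forall₂_of_mem_expand {k : ℕ} {ll : List (List ℕ)} (hk : ll.length ≤ k) {ys : List ℕ}
    (h : ys ∈ expand T k ll) : List.Forall₂ (fun y l => y ∈ l) ys ll := by
  induction k generalizing ll ys with
  | zero =>
    obtain rfl : ll = [] := List.length_eq_zero_iff.1 (by omega)
    obtain rfl : ys = [] := by simpa [expand] using h
    exact .nil
  | succ k ih =>
    cases ll with
    | nil =>
      obtain ⟨-, h⟩ : _ ∧ ys ∈ expand T k [] := by simpa [expand] using h
      exact ih (by simp) h
    | cons l ll =>
      obtain ⟨x, hx, zs, hzs, rfl⟩ : ∃ x ∈ l, ∃ zs ∈ expand T k ll, x :: zs = ys := by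
        simpa [expand] using h
      exact .cons hx (ih (by simpa using hk) hzs)

/-- For `k > 0`, each entry of each list is chosen in `T ^ (k - 1)` of the choices. The factor `T`
on the left avoids the truncated exponent. -/
theorem sum_count_expand {k : ℕ} {ll : List (List ℕ)} (hk : ll.length ≤ k)
    (h : ∀ l ∈ ll, l.length = T) (v : ℕ) :
    T * ((expand T k ll).map fun ys => ys.count v).sum =
      T ^ k * (ll.map fun l => l.count v).sum := by
  induction k generalizing ll with
  | zero =>
    obtain rfl : ll = [] := List.length_eq_zero_iff.1 (by omega)
    simp [expand]
  | succ k ih =>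
    cases ll with
    | nil =>
      have := ih (ll := []) (by simp) (by simp)
      simp only [List.map_nil, List.sum_nil, mul_zero, mul_eq_zero] at this
      simp only [expand, List.map_flatMap, List.sum_flatMap]
      rcases this with h | h <;> simp [h]
    | cons l ll =>
      have hl : ∀ m ∈ ll, m.length = T := fun m hm => h m (List.mem_cons_of_mem _ hm)
      have ih := ih (by simpa using hk) hl
      have hlen := length_expand (k := k) hl
      have hT := h l List.mem_cons_self
      simp only [expand, List.map_flatMap, List.map_map, List.sum_flatMap]
      have h1 : ∀ x, ((expand T k ll).map ((fun ys => ys.count v) ∘ fun ys => x :: ys)).sum =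
          ((expand T k ll).map fun ys => ys.count v).sum +
            T ^ k * (if x = v then 1 else 0) := by
        intro x
        rw [← hlen]
        generalize expand T k ll = L
        induction L with
        | nil => simp
        | cons y L ihL =>
          simp only [List.map_cons, Function.comp, List.sum_cons, List.count_cons,
            List.length_cons, beq_iff_eq] at ihL ⊢
          rw [ihL]
          ring
      simp only [h1, List.sum_map_add, List.sum_map_mul_left]
      simp only [List.sum_map_ite_eq_count, List.map_const', List.sum_replicate,
        smul_eq_mul, hT, List.map_cons,
        List.sum_cons]
      rw [mul_add, ih, pow_succ]
      ring

end expand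

/-- The occurrences of the variable `i` in the list `X` of variables. -/
def cloud (X : List ℕ) (i : ℕ) : List ℕ :=
  (List.range X.length).filter fun s => decide (X.getD s 0 = i)

theorem mem_cloud {X : List ℕ} {i s : ℕ} : s ∈ cloud X i ↔ s < X.length ∧ X.getD s 0 = i := by
  simp [cloud]

theorem nodup_cloud (X : List ℕ) (i : ℕ) : (cloud X i).Nodup := List.nodup_range.filter _

theorem length_cloud_le (X : List ℕ) (i : ℕ) : (cloud X i).length ≤ X.length :=
  (List.length_filter_le _ _).trans (by simp)

/-- A list of length `T` in which the occurrences of the variable at `s` are almost equally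
distributed. -/
def slotList (T : ℕ) (X : List ℕ) (s : ℕ) : List ℕ :=
  ((List.replicate (T / (cloud X (X.getD s 0)).length) ()).flatMap fun _ => cloud X (X.getD s 0)) ++
    List.replicate (T - T / (cloud X (X.getD s 0)).length * (cloud X (X.getD s 0)).length) s

section slotList

variable {T : ℕ} {X : List ℕ}

theorem length_slotList (s : ℕ) : (slotList T X s).length = T := by
  have := Nat.div_mul_le_self T (cloud X (X.getD s 0)).length
  simp only [slotList, List.length_append, List.length_flatMap, List.map_const',
    List.length_replicate, List.sum_replicate, smul_eq_mul]
  omega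

theorem mem_cloud_of_mem_slotList {s y : ℕ} (hs : s < X.length) (h : y ∈ slotList T X s) :
    y ∈ cloud X (X.getD s 0) := by
  rcases List.mem_append.1 h with h | h
  · simp only [List.mem_flatMap] at h
    obtain ⟨-, -, h⟩ := h
    exact h
  · rw [List.eq_of_mem_replicate h]
    exact mem_cloud.2 ⟨hs, rfl⟩

theorem sum_map_slotList (s : ℕ) (f : ℕ → ℕ) :
    ((slotList T X s).map f).sum =
      T / (cloud X (X.getD s 0)).length * ((cloud X (X.getD s 0)).map f).sum +
        (T - T / (cloud X (X.getD s 0)).length * (cloud X (X.getD s 0)).length) * f s := by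
  simp [slotList, List.map_flatMap, List.sum_flatMap]

/-- Only the slots in the cloud of `v` contribute. With `D` the size of this cloud, each of its `D`
slots contributes `T / D`, and the slot `v` in addition the remainder. For this reason each list is
filled up with its own slot: the total is exactly `T` although `D` need not divide `T`. -/
theorem sum_count_slotList {v : ℕ} (hv : v < X.length) :
    ((List.range X.length).map fun s => (slotList T X s).count v).sum = T := by
  have h0 : v ∈ cloud X (X.getD v 0) := mem_cloud.2 ⟨hv, rfl⟩
  have hcnt : (cloud X (X.getD v 0)).count v = 1 :=
    List.count_eq_one_of_mem (nodup_cloud _ _) h0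
  have h1 := List.sum_map_filter_of_eq_zero (List.range X.length)
    (fun s => decide (X.getD s 0 = X.getD v 0)) (fun s => (slotList T X s).count v) (by
      intro s hs h
      refine List.count_eq_zero.2 fun hv' => ?_
      have := (mem_cloud.1 (mem_cloud_of_mem_slotList (List.mem_range.1 hs) hv')).2
      simp only [decide_eq_false_iff_not] at h
      exact h this.symm)
  rw [← h1]
  change ((cloud X (X.getD v 0)).map fun s => (slotList T X s).count v).sum = T
  set C := cloud X (X.getD v 0) with hC
  have h2 : ∀ s ∈ C, (slotList T X s).count v =
      T / C.length + (T - T / C.length * C.length) * if s = v then 1 else 0 := by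
    intro s hs
    rw [hC] at hs
    have hXs : X.getD s 0 = X.getD v 0 := (mem_cloud.1 hs).2
    simp only [slotList, hXs, ← hC, List.count_append, List.count_flatMap, hcnt,
      List.map_const', List.length_replicate, List.sum_replicate, smul_eq_mul,
      List.count_replicate, Function.comp_def]
    by_cases h : s = v <;> simp [h]
  rw [List.map_congr_left h2, List.sum_map_add, List.sum_map_mul_left]
  rw [List.sum_map_ite_eq_count, hcnt]
  have := Nat.div_mul_le_self T C.length
  simp only [List.map_const', List.sum_replicate, smul_eq_mul, mul_one]
  rw [mul_comm C.length]
  omega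

end slotList

/-! #### The loss from making an assignment constant on a cloud -/

section loss

variable {A : Type} {T : ℕ}

/-- The number of choices that satisfy `h` under the assignment `χ`. -/
def weight (T k : ℕ) (ll : List (List ℕ)) (h : List A → Bool) (χ : ℕ → A) : ℕ :=
  (expand T k ll).countP fun ys => h (ys.map χ)

theorem weight_succ_cons (k : ℕ) (l : List ℕ) (ll : List (List ℕ)) (h : List A → Bool)
    (χ : ℕ → A) : weight T (k + 1) (l :: ll) h χ =
      (l.map fun x => weight T k ll (fun zs => h (χ x :: zs)) χ).sum := by
  simp [weight, expand, List.countP_flatMap, List.countP_map, Function.comp_def]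

theorem weight_le {k : ℕ} {ll : List (List ℕ)} (hl : ∀ l ∈ ll, l.length = T) (h : List A → Bool)
    (χ : ℕ → A) : weight T k ll h χ ≤ T ^ k :=
  List.countP_le_length.trans (length_expand hl).le

theorem weight_congr {k : ℕ} {ll : List (List ℕ)} (hk : ll.length ≤ k) (h : List A → Bool)
    {χ χ' : ℕ → A} (hχ : ∀ l ∈ ll, ∀ y ∈ l, χ y = χ' y) :
    weight T k ll h χ = weight T k ll h χ' := by
  refine List.countP_congr fun ys hys => ?_
  have h2 := forall₂_of_mem_expand hk hys
  have : ys.map χ = ys.map χ' := by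
    refine List.map_congr_left fun y hy => ?_
    clear hk hys
    induction h2 with
    | nil => simp at hy
    | cons hab _ ih =>
      rcases List.mem_cons.1 hy with rfl | hy
      · exact hχ _ List.mem_cons_self _ hab
      · exact ih (fun l hl => hχ l (List.mem_cons_of_mem _ hl)) hy
  rw [this]

variable {X : List ℕ}

/-- The assignment that has the value `a` on the cloud of `i`. -/
def collapse (X : List ℕ) (i : ℕ) (χ : ℕ → A) (a : A) : ℕ → A :=
  fun y => if X.getD y 0 = i then a else χ y

/-- The scope meets the cloud in at most one slot `s`. Let `D` be the size of the cloud, `T = a * D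
+ b` with `b < D`, `R v` the number of satisfying choices for the other slots if the value at `s` is
`χ v`, and `S` the sum of `R` over the cloud. The original count is `a * S + b * R s`, the average
over the collapsed assignments is `T * S / D`, and so the loss is at most `b * R s ≤ D * T ^ (k -
1)`. The statement clears the denominators `D` and `T`. -/
theorem weight_collapse (i : ℕ) (χ : ℕ → A) (slots : List ℕ) :
    ∀ (k : ℕ) (h : List A → Bool), (slots.map fun s => X.getD s 0).Nodup → slots.length ≤ k →
      (∀ s ∈ slots, s < X.length) →
      T * ((cloud X i).length * weight T k (slots.map (slotList T X)) h χ) ≤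
        T * ((cloud X i).map fun v =>
          weight T k (slots.map (slotList T X)) h (collapse X i χ (χ v))).sum +
        (cloud X i).length * (cloud X i).length * T ^ k := by
  induction slots with
  | nil =>
    intro k h _ _ _
    have : ∀ v, weight T k (([] : List ℕ).map (slotList T X)) h (collapse X i χ (χ v)) =
        weight T k (([] : List ℕ).map (slotList T X)) h χ := fun v =>
      weight_congr (by simp) h (by simp)
    simp only [this, List.map_const', List.sum_replicate, smul_eq_mul]
    omega
  | cons s slots ih =>
    intro k h hnd hk hlt
    obtain ⟨k, rfl⟩ : ∃ k', k = k' + 1 := ⟨k - 1, by simp at hk; omega⟩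
    have hk' : slots.length ≤ k := by simpa using hk
    have hlt' : ∀ s ∈ slots, s < X.length := fun t ht => hlt t (List.mem_cons_of_mem _ ht)
    have hs : s < X.length := hlt s List.mem_cons_self
    rw [List.map_cons, List.nodup_cons] at hnd
    have hlen : ∀ l ∈ slots.map (slotList T X), l.length = T := by
      intro l hl
      obtain ⟨t, -, rfl⟩ := List.mem_map.1 hl
      exact length_slotList t
    simp only [List.map_cons, weight_succ_cons]
    by_cases hi : X.getD s 0 = i
    -- No other slot of the scope belongs to this cloud, so collapsing does not affect the remaining
    -- choices.
    · have h1 : ∀ (g : List A → Bool) v, weight T k (slots.map (slotList T X)) g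
          (collapse X i χ (χ v)) = weight T k (slots.map (slotList T X)) g χ := by
        intro g v
        refine weight_congr (by simpa using hk') g ?_
        intro l hl y hy
        obtain ⟨t, ht, rfl⟩ := List.mem_map.1 hl
        have := (mem_cloud.1 (mem_cloud_of_mem_slotList (hlt' t ht) hy)).2
        rw [collapse, if_neg]
        rw [this]
        intro h'
        exact hnd.1 (List.mem_map.2 ⟨t, ht, h'.trans hi.symm⟩)
      have h2 : ∀ v, ((slotList T X s).map fun x => weight T k (slots.map (slotList T X))
          (fun zs => h (collapse X i χ (χ v) x :: zs)) (collapse X i χ (χ v))).sum =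
          T * weight T k (slots.map (slotList T X)) (fun zs => h (χ v :: zs)) χ := by
        intro v
        rw [List.map_congr_left (g := fun _ =>
          weight T k (slots.map (slotList T X)) (fun zs => h (χ v :: zs)) χ)]
        · simp [length_slotList]
        · intro x hx
          have := (mem_cloud.1 (mem_cloud_of_mem_slotList hs hx)).2
          rw [h1, collapse, if_pos (this.trans hi)]
      simp only [h2]
      rw [sum_map_slotList, hi, List.sum_map_mul_left]
      have hR := weight_le (k := k) hlen (fun zs => h (χ s :: zs)) χ
      generalize weight T k (slots.map (slotList T X)) (fun zs => h (χ s :: zs)) χ = R at *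
      generalize ((cloud X i).map fun x =>
        weight T k (slots.map (slotList T X)) (fun zs => h (χ x :: zs)) χ).sum = S
      set D := (cloud X i).length with hD
      have hD0 : 0 < D := List.length_pos_of_mem (mem_cloud.2 ⟨hs, hi⟩)
      have h4 := Nat.div_add_mod T D
      have h5 := Nat.mod_lt T hD0
      have h6 : T - T / D * D = T % D := by rw [mul_comm]; omega
      rw [h6]
      generalize T / D = a at *
      generalize T % D = b at *
      -- The remainder is the only source of loss.
      have h7 : T * (D * (b * R)) ≤ D * D * T ^ (k + 1) := by
        calc T * (D * (b * R)) ≤ T * (D * (D * T ^ k)) := by gcongr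
          _ = D * D * T ^ (k + 1) := by ring
      have h8 : T * (T * S) = T * (D * (a * S)) + T * (b * S) := by
        conv_lhs => rw [← h4]
        conv_rhs => rw [← h4]
        ring
      rw [h8, mul_add, mul_add]
      omega
    · have h1 : ∀ x ∈ slotList T X s, ∀ v, collapse X i χ (χ v) x = χ x := by
        intro x hx v
        have := (mem_cloud.1 (mem_cloud_of_mem_slotList hs hx)).2
        rw [collapse, if_neg (by rw [this]; exact hi)]
      have h2 : ∀ v, ((slotList T X s).map fun x => weight T k (slots.map (slotList T X))
          (fun zs => h (collapse X i χ (χ v) x :: zs)) (collapse X i χ (χ v))).sum =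
          ((slotList T X s).map fun x => weight T k (slots.map (slotList T X))
          (fun zs => h (χ x :: zs)) (collapse X i χ (χ v))).sum := fun v => by
        refine congrArg List.sum (List.map_congr_left fun x hx => ?_)
        rw [h1 x hx v]
      simp only [h2]
      rw [List.sum_map_sum_map_comm (cloud X i), ← mul_assoc, ← List.sum_map_mul_left,
        ← List.sum_map_mul_left]
      have h3 : ((slotList T X s).map fun x => T * (cloud X i).length *
          weight T k (slots.map (slotList T X)) (fun zs => h (χ x :: zs)) χ).sum ≤
          ((slotList T X s).map fun x => T * ((cloud X i).map fun v =>
            weight T k (slots.map (slotList T X)) (fun zs => h (χ x :: zs))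
              (collapse X i χ (χ v))).sum +
            (cloud X i).length * (cloud X i).length * T ^ k).sum := by
        refine List.sum_le_sum fun x _ => ?_
        rw [mul_assoc]
        exact ih k _ hnd.2 hk' hlt'
      refine h3.trans (le_of_eq ?_)
      rw [List.sum_map_add]
      simp only [List.map_const', List.sum_replicate, smul_eq_mul, length_slotList]
      ring

end loss

end CSPReduction

/-! ### Lists of constraints as instances -/

namespace CSPReduction

variable {q : ℕ} {Λ : CSP q}

/-- The predicates of `Λ`. -/
abbrev Pred (Λ : CSP q) : Type := {P : CSPPredicate q // P ∈ Λ}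

/-- Does the list of values satisfy the predicate? -/
def sat [NeZero q] (P : Pred Λ) (vs : List (Fin q)) : Bool := P.1.holds fun p => vs.getD p 0

/-- The list `c.2` is the scope of a constraint on `n` variables. -/
structure IsConstraint (n : ℕ) (c : Pred Λ × List ℕ) : Prop where
  length_eq : c.2.length = c.1.1.arity
  lt_of_mem : ∀ y ∈ c.2, y < n
  nodup : c.2.Nodup

/-- The constraint with a given list of variables. -/
def toConstraint {n : ℕ} (c : Pred Λ × List ℕ) (h : IsConstraint n c) : CSPConstraint Λ n where
  pred := c.1
  scope := ⟨fun p => ⟨c.2[p.1]'(h.length_eq.symm ▸ p.2), h.lt_of_mem _ (List.getElem_mem _)⟩,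
    fun a b hab => by
      simp only [Fin.mk.injEq] at hab
      exact Fin.ext ((List.Nodup.getElem_inj_iff h.nodup).1 hab)⟩

/-- The word of a constraint. -/
def encodeConstraint (c : Pred Λ × List ℕ) : List (CSPSymbol Λ) :=
  .pred c.1 :: c.2.flatMap fun i => .sep :: List.replicate i .tally

theorem encode_eq {n : ℕ} (C : CSPConstraint Λ n) :
    C.encode = encodeConstraint (C.pred, (List.ofFn C.scope).map Fin.val) := by
  simp only [CSPConstraint.encode, encodeConstraint, List.flatMap_map]

theorem map_ofFn_toConstraint {n : ℕ} (c : Pred Λ × List ℕ) (h : IsConstraint n c) :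
    (List.ofFn (toConstraint c h).scope).map Fin.val = c.2 := by
  apply List.ext_getElem
  · simpa [toConstraint] using h.length_eq.symm
  · intro i _ _
    simp only [List.getElem_map, List.getElem_ofFn]
    rfl

theorem encode_toConstraint {n : ℕ} (c : Pred Λ × List ℕ) (h : IsConstraint n c) :
    (toConstraint c h).encode = encodeConstraint c := by
  rw [encode_eq, map_ofFn_toConstraint]
  rfl

/-- Assignments are extended to all natural numbers, which spares dependent types in the
combinatorics; the additional values are irrelevant. -/
theorem eval_eq [NeZero q] {n : ℕ} (C : CSPConstraint Λ n) (χ : Fin n → Fin q) (χ' : ℕ → Fin q)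
    (hχ : ∀ i : Fin n, χ' i = χ i) :
    C.eval χ = if sat C.pred (((List.ofFn C.scope).map Fin.val).map χ') = true then 1 else 0 := by
  have : (fun p : Fin C.pred.1.arity => χ (C.scope p)) =
      fun p : Fin C.pred.1.arity => (((List.ofFn C.scope).map Fin.val).map χ').getD p 0 := by
    funext p
    rw [List.getD_eq_getElem _ _ (by simp)]
    simp [hχ]
  rw [CSPConstraint.eval, this]
  rfl

theorem eval_toConstraint [NeZero q] {n : ℕ} (c : Pred Λ × List ℕ) (h : IsConstraint n c)
    (χ : Fin n → Fin q) (χ' : ℕ → Fin q) (hχ : ∀ i : Fin n, χ' i = χ i) :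
    (toConstraint c h).eval χ = if sat c.1 (c.2.map χ') = true then 1 else 0 := by
  rw [eval_eq _ χ χ' hχ, map_ofFn_toConstraint]
  rfl

/-- The instance with a given list of constraints. -/
def toInstance (n : ℕ) (cs : List (Pred Λ × List ℕ)) (h : ∀ c ∈ cs, IsConstraint n c) :
    CSPInstance Λ where
  numVars := n
  numConstraints := cs.length
  constraint r := toConstraint cs[r] (h _ (List.getElem_mem _))

theorem encode_toInstance (n : ℕ) (cs : List (Pred Λ × List ℕ))
    (h : ∀ c ∈ cs, IsConstraint n c) :
    (toInstance n cs h).encode = List.replicate n .tally ++ cs.flatMap encodeConstraint := by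
  rw [CSPInstance.encode]
  congr 1
  have : (fun r => ((toInstance n cs h).constraint r).encode) =
      encodeConstraint ∘ cs.get := by
    funext (r : Fin cs.length)
    exact encode_toConstraint cs[r] (h _ (List.getElem_mem _))
  rw [this]
  have h' := congrArg (List.flatMap encodeConstraint) (List.map_get_finRange cs)
  rw [List.flatMap_map] at h'
  exact h'

theorem countP_eq_sum {α : Type*} (l : List α) (p : α → Bool) :
    l.countP p = (l.map fun a => if p a = true then 1 else 0).sum := by
  induction l with
  | nil => rfl
  | cons a l ih => simp [List.countP_cons, ih, add_comm]

/-- As scopes are injective, a constraint contains a variable at most once, and counting constraints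
is counting occurrences. -/
theorem degree_eq_sum (F : CSPInstance Λ) (i : Fin F.numVars) :
    F.degree i = ∑ r, ((List.ofFn (F.constraint r).scope).map Fin.val).count i.1 := by
  rw [CSPInstance.degree, Finset.card_filter]
  refine Finset.sum_congr rfl fun r _ => ?_
  have h : ((List.ofFn (F.constraint r).scope).map Fin.val).Nodup :=
    (List.nodup_ofFn.2 (F.constraint r).scope.injective).map Fin.val_injective
  have : (∃ p, (F.constraint r).scope p = i) ↔
      i.1 ∈ (List.ofFn (F.constraint r).scope).map Fin.val := by
    simp [List.mem_ofFn, Fin.ext_iff]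
  split_ifs with hi
  · exact (List.count_eq_one_of_mem h (this.1 hi)).symm
  · exact (List.count_eq_zero.2 fun h' => hi (this.2 h')).symm

theorem degree_toInstance (n : ℕ) (cs : List (Pred Λ × List ℕ))
    (h : ∀ c ∈ cs, IsConstraint n c) (i : Fin n) :
    (toInstance n cs h).degree i = (cs.map fun c => c.2.count i.1).sum := by
  refine (degree_eq_sum (toInstance n cs h) i).trans ?_
  refine Eq.trans ?_ (Fin.sum_univ_fun_getElem cs fun c : Pred Λ × List ℕ => c.2.count i.1)
  refine Finset.sum_congr rfl fun (r : Fin cs.length) _ => ?_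
  exact congrArg (List.count i.1)
    (map_ofFn_toConstraint cs[r] (h _ (List.getElem_mem r.2)))

/-- The number of constraints that are satisfied by an assignment. -/
def score [NeZero q] (cs : List (Pred Λ × List ℕ)) (χ : ℕ → Fin q) : ℕ :=
  cs.countP fun c => sat c.1 (c.2.map χ)

theorem val_toInstance [NeZero q] (n : ℕ) (cs : List (Pred Λ × List ℕ))
    (h : ∀ c ∈ cs, IsConstraint n c) (χ : Fin n → Fin q) (χ' : ℕ → Fin q)
    (hχ : ∀ i : Fin n, χ' i = χ i) :
    (toInstance n cs h).val χ = (score cs χ' : ℝ) / cs.length := by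
  have : ∀ r : Fin cs.length, ((toInstance n cs h).constraint r).eval χ =
      (fun c : Pred Λ × List ℕ => if sat c.1 (c.2.map χ') = true then (1 : ℝ) else 0) cs[r] :=
    fun r => eval_toConstraint cs[r] (h _ (List.getElem_mem _)) χ χ' hχ
  refine (Finset.mul_sum _ _ _).symm.trans ?_
  refine (congrArg _ ((Finset.sum_congr rfl fun r _ => this r).trans
    (Fin.sum_univ_fun_getElem cs
      fun c : Pred Λ × List ℕ => if sat c.1 (c.2.map χ') = true then (1 : ℝ) else 0))).trans ?_
  rw [score, countP_eq_sum, one_div, mul_comm, div_eq_mul_inv]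
  congr 1
  push_cast
  rw [List.map_map]
  congr 2
  funext c
  simp only [Function.comp]
  split_ifs <;> simp

/-! #### The regular instance of a list of constraints -/

/-- Replace the variables of the constraints by the numbers in `r`, one after the other. -/
def number : List (Pred Λ × List ℕ) → List ℕ → List (Pred Λ × List ℕ)
  | [], _ => []
  | c :: G, r => (c.1, r.take c.2.length) :: number G (r.drop c.2.length)

theorem length_number (G : List (Pred Λ × List ℕ)) (r : List ℕ) :
    (number G r).length = G.length := by
  induction G generalizing r with
  | nil => rfl
  | cons c G ih => simp [number, ih]

theorem flatMap_number (G : List (Pred Λ × List ℕ)) (r : List ℕ)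
    (h : r.length = (G.flatMap Prod.snd).length) : (number G r).flatMap Prod.snd = r := by
  induction G generalizing r with
  | nil =>
    obtain rfl : r = [] := List.length_eq_zero_iff.1 (by simpa using h)
    rfl
  | cons c G ih =>
    simp only [List.flatMap_cons, List.length_append] at h
    rw [number, List.flatMap_cons, ih _ (by rw [List.length_drop]; omega), List.take_append_drop]

theorem map_number (G : List (Pred Λ × List ℕ)) (r : List ℕ) (f : ℕ → ℕ)
    (h : r.map f = G.flatMap Prod.snd) : (number G r).map (fun c => (c.1, c.2.map f)) = G := by
  induction G generalizing r with
  | nil => rfl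
  | cons c G ih =>
    rw [List.flatMap_cons] at h
    rw [number, List.map_cons, ih]
    · rw [List.map_take, h, List.take_left]
    · rw [List.map_drop, h, List.drop_left]

/-- The list of the occurrences of variables in the constraints. -/
def vars (G : List (Pred Λ × List ℕ)) : List ℕ := G.flatMap Prod.snd

/-- The constraints, with different variables for all occurrences of variables. -/
def slots (G : List (Pred Λ × List ℕ)) : List (Pred Λ × List ℕ) :=
  number G (List.range (vars G).length)

theorem length_slots (G : List (Pred Λ × List ℕ)) : (slots G).length = G.length :=
  length_number _ _

theorem flatMap_slots (G : List (Pred Λ × List ℕ)) :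
    (slots G).flatMap Prod.snd = List.range (vars G).length :=
  flatMap_number _ _ (by simp [vars])

/-- The list `vars G` translates slots back into variables, so sums over `G` may be taken over
`slots G`. -/
theorem map_slots (G : List (Pred Λ × List ℕ)) :
    (slots G).map (fun c => (c.1, c.2.map fun s => (vars G).getD s 0)) = G := by
  refine map_number _ _ _ ?_
  change _ = vars G
  apply List.ext_getElem
  · simp
  · intro i _ h
    simp [List.getElem?_eq_getElem h]

theorem lt_of_mem_slots {G : List (Pred Λ × List ℕ)} {c : Pred Λ × List ℕ} (hc : c ∈ slots G)
    {s : ℕ} (hs : s ∈ c.2) : s < (vars G).length := by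
  have : s ∈ (slots G).flatMap Prod.snd := List.mem_flatMap.2 ⟨c, hc, hs⟩
  rw [flatMap_slots] at this
  exact List.mem_range.1 this

theorem mem_of_mem_slots {G : List (Pred Λ × List ℕ)} {c : Pred Λ × List ℕ} (hc : c ∈ slots G) :
    (c.1, c.2.map fun s => (vars G).getD s 0) ∈ G := by
  have := List.mem_map_of_mem (f := fun c : Pred Λ × List ℕ =>
    (c.1, c.2.map fun s => (vars G).getD s 0)) hc
  rwa [map_slots] at this

/-- The constraints of the regular instance. -/
def blowup (T K : ℕ) (G : List (Pred Λ × List ℕ)) : List (Pred Λ × List ℕ) :=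
  (slots G).flatMap fun c =>
    (expand T K (c.2.map (slotList T (vars G)))).map fun ys => (c.1, ys)

section blowup

variable {T K n : ℕ} {G : List (Pred Λ × List ℕ)}

theorem length_eq_of_mem_map_slotList {X : List ℕ} {m : List ℕ} :
    ∀ l ∈ m.map (slotList T X), l.length = T := by
  intro l hl
  obtain ⟨t, -, rfl⟩ := List.mem_map.1 hl
  exact length_slotList t

/-- Slots are only exchanged within their clouds. This gives the distinctness of the new scopes as
well as the exact score of assignments that are constant on clouds. -/
theorem map_getD_of_mem_expand {X : List ℕ} {m ys : List ℕ} (hm : m.length ≤ K)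
    (hlt : ∀ s ∈ m, s < X.length) (h : ys ∈ expand T K (m.map (slotList T X))) :
    ys.map (fun s => X.getD s 0) = m.map (fun s => X.getD s 0) ∧ ∀ y ∈ ys, y < X.length := by
  replace h := forall₂_of_mem_expand (by simpa using hm) h
  rw [List.forall₂_map_right_iff] at h
  clear hm
  induction h with
  | nil => simp
  | @cons y s ys m hy _ ih =>
    have ih := ih fun s hs => hlt s (List.mem_cons_of_mem _ hs)
    have := mem_cloud.1 (mem_cloud_of_mem_slotList (hlt s List.mem_cons_self) hy)
    refine ⟨?_, ?_⟩
    · rw [List.map_cons, List.map_cons, ih.1, this.2]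
    · intro z hz
      rcases List.mem_cons.1 hz with rfl | hz
      · exact this.1
      · exact ih.2 z hz

theorem length_le_of_mem_slots (hG : ∀ c ∈ G, IsConstraint n c)
    (hK : ∀ P : Pred Λ, P.1.arity ≤ K) {c : Pred Λ × List ℕ} (hc : c ∈ slots G) :
    c.2.length ≤ K := by
  have := (hG _ (mem_of_mem_slots hc)).length_eq
  simp only [List.length_map] at this
  exact this.trans_le (hK _)

theorem isConstraint_blowup (hG : ∀ c ∈ G, IsConstraint n c)
    (hK : ∀ P : Pred Λ, P.1.arity ≤ K) :
    ∀ c ∈ blowup T K G, IsConstraint (vars G).length c := by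
  intro c hc
  obtain ⟨d, hd, hc⟩ := List.mem_flatMap.1 hc
  obtain ⟨ys, hys, rfl⟩ := List.mem_map.1 hc
  obtain ⟨h1, h2⟩ := map_getD_of_mem_expand (length_le_of_mem_slots hG hK hd)
    (fun s hs => lt_of_mem_slots hd hs) hys
  have h3 := hG _ (mem_of_mem_slots hd)
  refine ⟨?_, h2, ?_⟩
  · have := congrArg List.length h1
    simp only [List.length_map] at this
    have h4 := h3.length_eq
    simp only [List.length_map] at h4
    exact this.trans h4
  -- The slots of the new scope belong to different old variables, hence they are distinct.
  · exact List.Nodup.of_map (fun s => (vars G).getD s 0) (by rw [h1]; exact h3.nodup)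

theorem getD_vars_lt (hG : ∀ c ∈ G, IsConstraint n c) {y : ℕ} (hy : y < (vars G).length) :
    (vars G).getD y 0 < n := by
  rw [List.getD_eq_getElem _ _ hy]
  obtain ⟨c, hc, h⟩ := List.mem_flatMap.1 (List.getElem_mem hy)
  exact (hG c hc).lt_of_mem _ h

/-- The regular instance. -/
def regularInstance (T K : ℕ) (G : List (Pred Λ × List ℕ)) (hG : ∀ c ∈ G, IsConstraint n c)
    (hK : ∀ P : Pred Λ, P.1.arity ≤ K) : CSPInstance Λ :=
  toInstance (vars G).length (blowup T K G) (isConstraint_blowup hG hK)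

/-- Multiplied by `T`, the degree of `v` is `T ^ K` times the number of occurrences of `v` in all
slot lists, which is `T`. Padding every constraint to `T ^ K` choices makes predicates of different
arities contribute alike. -/
theorem isRegular_regularInstance (hT : 0 < T) (hG : ∀ c ∈ G, IsConstraint n c)
    (hK : ∀ P : Pred Λ, P.1.arity ≤ K) : (regularInstance T K G hG hK).IsRegular := by
  have key : ∀ v : Fin (vars G).length, (regularInstance T K G hG hK).degree v = T ^ K := by
    intro v
    refine (degree_toInstance _ _ _ v).trans ?_
    rw [blowup, List.map_flatMap, List.sum_flatMap]
    simp only [List.map_map, Function.comp_def]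
    refine Nat.eq_of_mul_eq_mul_left hT ?_
    rw [← List.sum_map_mul_left]
    have h1 : ∀ c ∈ slots G, T * ((expand T K (c.2.map (slotList T (vars G)))).map
        fun ys => ys.count v.1).sum =
          T ^ K * (c.2.map fun s => (slotList T (vars G) s).count v.1).sum := by
      intro c hc
      rw [sum_count_expand (by simpa using length_le_of_mem_slots hG hK hc)
        length_eq_of_mem_map_slotList, List.map_map]
      rfl
    rw [List.map_congr_left h1, List.sum_map_mul_left]
    have h2 := List.sum_flatMap (slots G)
      fun c => c.2.map fun s => (slotList T (vars G) s).count v.1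
    have h3 := List.map_flatMap (f := fun s => (slotList T (vars G) s).count v.1)
      (g := Prod.snd) (l := slots G)
    rw [← h2, ← h3, flatMap_slots, sum_count_slotList v.2, mul_comm]
  intro i j
  exact (key i).trans (key j).symm

variable [NeZero q]

theorem score_blowup (χ : ℕ → Fin q) : score (blowup T K G) χ =
    ((slots G).map fun c => weight T K (c.2.map (slotList T (vars G))) (sat c.1) χ).sum := by
  simp [score, blowup, weight, List.countP_flatMap, List.countP_map, Function.comp_def]

/-- All `T ^ K` copies of a constraint see the values that `ψ` gives to the original scope. -/
theorem score_blowup_comp (hG : ∀ c ∈ G, IsConstraint n c) (hK : ∀ P : Pred Λ, P.1.arity ≤ K)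
    (χ : ℕ → Fin q) (ψ : ℕ → Fin q)
    (hψ : ∀ y < (vars G).length, χ y = ψ ((vars G).getD y 0)) :
    score (blowup T K G) χ = T ^ K * score G ψ := by
  rw [score_blowup]
  have h1 : ∀ c ∈ slots G, weight T K (c.2.map (slotList T (vars G))) (sat c.1) χ =
      T ^ K * (fun d : Pred Λ × List ℕ => if sat d.1 (d.2.map ψ) = true then 1 else 0)
        (c.1, c.2.map fun s => (vars G).getD s 0) := by
    intro c hc
    have h2 : ∀ ys ∈ expand T K (c.2.map (slotList T (vars G))),
        ys.map χ = (c.2.map fun s => (vars G).getD s 0).map ψ := by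
      intro ys hys
      obtain ⟨h3, h4⟩ := map_getD_of_mem_expand (length_le_of_mem_slots hG hK hc)
        (fun s hs => lt_of_mem_slots hc hs) hys
      rw [← h3, List.map_map]
      exact List.map_congr_left fun y hy => hψ y (h4 y hy)
    have h5 : weight T K (c.2.map (slotList T (vars G))) (sat c.1) χ =
        (expand T K (c.2.map (slotList T (vars G)))).countP fun _ =>
          sat c.1 ((c.2.map fun s => (vars G).getD s 0).map ψ) :=
      List.countP_congr fun ys hys => by rw [h2 ys hys]
    rw [h5]
    have h6 := length_expand (T := T) (k := K) (ll := c.2.map (slotList T (vars G)))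
      length_eq_of_mem_map_slotList
    dsimp only
    split_ifs with h7
    · rw [h7, List.countP_true, h6, mul_one]
    · rw [Bool.not_eq_true] at h7
      rw [h7, mul_zero]
      exact List.countP_eq_zero.2 (by simp)
  rw [List.map_congr_left h1, List.sum_map_mul_left, score, countP_eq_sum]
  conv_rhs => rw [← map_slots G, List.map_map]
  rfl

theorem score_congr (hG : ∀ c ∈ G, IsConstraint n c) {χ χ' : ℕ → Fin q}
    (h : ∀ y < n, χ y = χ' y) : score G χ = score G χ' := by
  refine List.countP_congr fun c hc => ?_
  rw [List.map_congr_left fun y hy => h y ((hG c hc).lt_of_mem y hy)]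

/-- The loss from making an assignment constant on a cloud in the best possible way. -/
theorem score_le_of_collapse (hG : ∀ c ∈ G, IsConstraint n c) (hK : ∀ P : Pred Λ, P.1.arity ≤ K)
    (i : ℕ) (χ : ℕ → Fin q) (B : ℕ)
    (hB : ∀ a, score (blowup T K G) (collapse (vars G) i χ a) ≤ B) :
    T * score (blowup T K G) χ ≤ T * B + G.length * (vars G).length * T ^ K := by
  set C := cloud (vars G) i with hC
  rcases Nat.eq_zero_or_pos C.length with h0 | h0
  -- If the cloud is empty there is nothing to average over, but collapsing changes no variable of
  -- the instance.
  · have : score (blowup T K G) χ = score (blowup T K G) (collapse (vars G) i χ 0) := by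
      refine score_congr (isConstraint_blowup hG hK) fun y hy => ?_
      rw [collapse, if_neg]
      intro hi
      have : y ∈ C := mem_cloud.2 ⟨hy, hi⟩
      rw [List.length_eq_zero_iff.1 h0] at this
      simp at this
    rw [this]
    have := Nat.mul_le_mul_left T (hB 0)
    omega
  · have h1 : T * (C.length * score (blowup T K G) χ) ≤
        T * (C.map fun v => score (blowup T K G) (collapse (vars G) i χ (χ v))).sum +
          C.length * C.length * T ^ K * G.length := by
      simp only [score_blowup]
      rw [List.sum_map_sum_map_comm, ← List.sum_map_mul_left, ← List.sum_map_mul_left,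
        ← List.sum_map_mul_left, ← length_slots G]
      have h2 : ((slots G).map fun c => T * (C.map fun v => weight T K
            (c.2.map (slotList T (vars G))) (sat c.1) (collapse (vars G) i χ (χ v))).sum).sum +
          C.length * C.length * T ^ K * (slots G).length =
          ((slots G).map fun c => T * (C.map fun v => weight T K
            (c.2.map (slotList T (vars G))) (sat c.1) (collapse (vars G) i χ (χ v))).sum +
            C.length * C.length * T ^ K).sum := by
        rw [List.sum_map_add]
        simp [mul_comm]
      rw [h2]
      refine List.sum_le_sum fun c hc => ?_
      refine weight_collapse i χ c.2 K (sat c.1) ?_ (length_le_of_mem_slots hG hK hc)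
        fun s hs => lt_of_mem_slots hc hs
      exact (hG _ (mem_of_mem_slots hc)).nodup
    have h3 : (C.map fun v => score (blowup T K G) (collapse (vars G) i χ (χ v))).sum ≤
        C.length * B := by
      have := List.sum_le_card_nsmul
        (C.map fun v => score (blowup T K G) (collapse (vars G) i χ (χ v))) B (by
          intro x hx
          obtain ⟨v, -, rfl⟩ := List.mem_map.1 hx
          exact hB _)
      simpa using this
    have h4 : C.length ≤ (vars G).length := length_cloud_le _ _
    -- Of the two factors `C.length` in the loss, one cancels against the average and the other is
    -- at most the number of slots.
    refine Nat.le_of_mul_le_mul_left ?_ h0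
    calc C.length * (T * score (blowup T K G) χ)
        = T * (C.length * score (blowup T K G) χ) := by ring
      _ ≤ T * (C.length * B) + C.length * C.length * T ^ K * G.length := by
          refine h1.trans ?_
          gcongr
      _ ≤ T * (C.length * B) + C.length * (vars G).length * T ^ K * G.length := by gcongr
      _ = C.length * (T * B + G.length * (vars G).length * T ^ K) := by ring

/-! #### Decoding -/

/-- A value that maximizes `f`. -/
def argmax (f : Fin q → ℕ) : Fin q :=
  ((List.finRange q).filter fun a => (List.finRange q).all fun b => decide (f b ≤ f a)).headD 0

theorem le_argmax (f : Fin q → ℕ) (b : Fin q) : f b ≤ f (argmax f) := by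
  obtain ⟨a, ha⟩ := Finite.exists_max f
  have h1 : a ∈ (List.finRange q).filter fun a =>
      (List.finRange q).all fun b => decide (f b ≤ f a) := by simpa using ha
  have h2 : argmax f ∈ (List.finRange q).filter fun a =>
      (List.finRange q).all fun b => decide (f b ≤ f a) := by
    rw [argmax]
    generalize (List.finRange q).filter (fun a =>
      (List.finRange q).all fun b => decide (f b ≤ f a)) = l at *
    cases l with
    | nil => simp at h1
    | cons c l => simp
  simp only [List.mem_filter, List.mem_finRange, true_and, List.all_eq_true,
    decide_eq_true_eq, forall_const] at h2
  exact h2 b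

/-- The assignment that has the values `out` on the first clouds. -/
def assignment (X : List ℕ) (χ out : List (Fin q)) (y : ℕ) : Fin q :=
  out.getD (X.getD y 0) (χ.getD y 0)

/-- Make the assignment constant on the next cloud, in the best possible way. -/
def decodeStep (cs : List (Pred Λ × List ℕ)) (X : List ℕ) (χ out : List (Fin q)) :
    List (Fin q) :=
  out ++ [argmax fun a => score cs (assignment X χ (out ++ [a]))]

/-- Make the assignment constant on the clouds. -/
def decode (cs : List (Pred Λ × List ℕ)) (X : List ℕ) (n : ℕ) (χ : List (Fin q)) :
    List (Fin q) :=
  (decodeStep cs X χ)^[n] []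

theorem length_decode (cs : List (Pred Λ × List ℕ)) (X : List ℕ) (n : ℕ) (χ : List (Fin q)) :
    (decode cs X n χ).length = n := by
  induction n with
  | zero => rfl
  | succ n ih =>
    rw [decode, Function.iterate_succ_apply', ← decode]
    simp [decodeStep, ih]

/-- The length of `out` is the index of the cloud that is treated next, so a decoding step is a
collapse. -/
theorem assignment_append (X : List ℕ) (χ out : List (Fin q)) (a : Fin q) :
    assignment X χ (out ++ [a]) = collapse X out.length (assignment X χ out) a := by
  funext y
  simp only [assignment, collapse]
  generalize X.getD y 0 = i
  rcases lt_trichotomy i out.length with h | rfl | h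
  · rw [if_neg h.ne, List.getD_append _ _ _ _ h]
  · simp
  · rw [if_neg h.ne', List.getD_eq_default (out ++ [a]) _ (by simp; omega),
      List.getD_eq_default out _ (by omega)]

theorem score_decode (hG : ∀ c ∈ G, IsConstraint n c) (hK : ∀ P : Pred Λ, P.1.arity ≤ K)
    (χ : List (Fin q)) (j : ℕ) :
    T * score (blowup T K G) (fun y => χ.getD y 0) ≤
      T * score (blowup T K G) (assignment (vars G) χ (decode (blowup T K G) (vars G) j χ)) +
        j * (G.length * (vars G).length * T ^ K) := by
  induction j with
  | zero =>
    have : assignment (vars G) χ (decode (blowup T K G) (vars G) 0 χ) =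
        fun y => χ.getD y 0 := by
      funext y
      simp [assignment, decode]
    rw [this]
    omega
  | succ j ih =>
    have h1 := score_le_of_collapse (T := T) hG hK j
      (assignment (vars G) χ (decode (blowup T K G) (vars G) j χ))
      (score (blowup T K G) (assignment (vars G) χ (decode (blowup T K G) (vars G) (j + 1) χ)))
      (by
        intro a
        conv_rhs => rw [decode, Function.iterate_succ_apply', ← decode, decodeStep]
        refine le_trans (le_of_eq ?_) (le_argmax (fun a => score (blowup T K G)
          (assignment (vars G) χ (decode (blowup T K G) (vars G) j χ ++ [a]))) a)
        rw [assignment_append, length_decode])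
    rw [add_mul, one_mul]
    omega

/-- The value of the decoded assignment. -/
theorem mul_score_le (hG : ∀ c ∈ G, IsConstraint n c)
    (hK : ∀ P : Pred Λ, P.1.arity ≤ K) (χ : List (Fin q)) :
    T * score (blowup T K G) (fun y => χ.getD y 0) ≤
      T ^ K * (T * score G (fun i => (decode (blowup T K G) (vars G) n χ).getD i 0) +
        n * (G.length * (vars G).length)) := by
  have h1 := score_decode (T := T) hG hK χ n
  -- After `n` rounds every cloud has been treated, and the assignment is constant on all of them.
  rw [score_blowup_comp hG hK (assignment (vars G) χ (decode (blowup T K G) (vars G) n χ))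
    (fun i => (decode (blowup T K G) (vars G) n χ).getD i 0)] at h1
  · refine h1.trans (le_of_eq ?_)
    ring
  · intro y hy
    have := getD_vars_lt hG hy
    have h2 : (vars G).getD y 0 < (decode (blowup T K G) (vars G) n χ).length := by
      rw [length_decode]; exact this
    unfold assignment
    generalize (vars G).getD y 0 = i at h2
    rw [List.getD_eq_getElem _ _ h2, List.getD_eq_getElem _ _ h2]

end blowup

end CSPReduction

/-! ### Rounding the weights -/

namespace CSPReduction

/-! #### Binary arithmetic -/

/-- The number with the given binary digits. -/
def bval : List Bool → ℕ
  | [] => 0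
  | x :: l => x.toNat + 2 * bval l

theorem bval_append (l l' : List Bool) : bval (l ++ l') = bval l + 2 ^ l.length * bval l' := by
  induction l with
  | nil => simp [bval]
  | cons x l ih => simp [bval, ih, pow_succ]; ring

theorem bval_replicate (n : ℕ) : bval (List.replicate n false) = 0 := by
  induction n with
  | zero => rfl
  | succ n ih => simp [List.replicate_succ, bval, ih]

theorem bval_lt (l : List Bool) : bval l < 2 ^ l.length := by
  induction l with
  | nil => simp [bval]
  | cons x l ih => cases x <;> simp [bval, pow_succ] <;> omega

theorem bval_bits (n : ℕ) : bval n.bits = n := by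
  induction n using Nat.binaryRec' with
  | zero => simp [bval]
  | bit b n h ih =>
    rw [Nat.bits_append_bit n b h, bval, ih, Nat.bit_val]
    omega

/-- Subtract `b` and the borrow `c` from `a`; the result consists of a borrow and a difference. -/
def subBits : List Bool → List Bool → Bool → Bool × List Bool
  | [], _, c => (c, [])
  | x :: a, b, c =>
    ((subBits a b.tail ((!x && (b.headD false || c)) || (b.headD false && c))).1,
      xor x (xor (b.headD false) c) ::
        (subBits a b.tail ((!x && (b.headD false || c)) || (b.headD false && c))).2)

theorem length_subBits (a b : List Bool) (c : Bool) : (subBits a b c).2.length = a.length := by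
  induction a generalizing b c with
  | nil => rfl
  | cons x a ih => simp [subBits, ih]

/-- Schoolbook subtraction; the outgoing borrow is worth `2 ^ a.length`. -/
theorem bval_subBits {a b : List Bool} (h : b.length ≤ a.length) (c : Bool) :
    bval (subBits a b c).2 + bval b + c.toNat =
      bval a + 2 ^ a.length * (subBits a b c).1.toNat := by
  induction a generalizing b c with
  | nil =>
    obtain rfl : b = [] := List.length_eq_zero_iff.1 (by simpa using h)
    simp [subBits, bval]
  | cons x a ih =>
    have h' : bval b = (b.headD false).toNat + 2 * bval b.tail := by
      cases b <;> simp [bval]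
    have := ih (b := b.tail) (by simp at h ⊢; omega)
      ((!x && (b.headD false || c)) || (b.headD false && c))
    rw [h', subBits]
    simp only [bval, List.length_cons, pow_succ]
    generalize subBits a b.tail ((!x && (b.headD false || c)) || (b.headD false && c)) = r at *
    have e : 2 ^ a.length * 2 * r.1.toNat = 2 * (2 ^ a.length * r.1.toNat) := by ring
    rw [e]
    generalize b.headD false = y at *
    revert this
    cases x <;> cases y <;> cases c <;> simp <;> omega

/-- The difference has no more digits than `a`, so the final borrow decides the comparison. -/
theorem fst_subBits {a b : List Bool} (h : b.length ≤ a.length) :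
    (subBits a b false).1 = decide (bval a < bval b) := by
  have h1 := bval_subBits h false
  have h2 := bval_lt (subBits a b false).2
  have h3 := bval_lt a
  rw [length_subBits] at h2
  generalize subBits a b false = r at *
  obtain ⟨r, d⟩ := r
  cases r <;> simp at * <;> omega

/-- Subtract `b`, if possible, and count it. -/
def quotStep (b : List Bool) (s : List Bool × ℕ) : List Bool × ℕ :=
  if (subBits s.1 b false).1 = true then s else ((subBits s.1 b false).2, s.2 + 1)

/-- The quotient of `a` by `b`, or `J` if the quotient is greater. -/
def quot (J : ℕ) (a b : List Bool) : ℕ := ((quotStep b)^[J] (a, 0)).2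

/-- Division by repeated subtraction, cut off after `J` rounds: a full quotient may be exponential
in the number of digits. -/
theorem quot_eq (J : ℕ) {a b : List Bool} (h : b.length ≤ a.length) (hb : 0 < bval b) :
    quot J a b = min J (bval a / bval b) := by
  have key : ((quotStep b)^[J] (a, 0)).1.length = a.length ∧
      bval ((quotStep b)^[J] (a, 0)).1 + ((quotStep b)^[J] (a, 0)).2 * bval b = bval a ∧
      ((quotStep b)^[J] (a, 0)).2 = min J (bval a / bval b) := by
    induction J with
    | zero => simp
    | succ J ih =>
      rw [Function.iterate_succ_apply']
      generalize (quotStep b)^[J] (a, 0) = s at *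
      obtain ⟨h1, h2, h3⟩ := ih
      have h4 : b.length ≤ s.1.length := h1 ▸ h
      have h5 : bval a / bval b = s.2 + bval s.1 / bval b := by
        rw [← h2, Nat.add_mul_div_right _ _ hb, add_comm]
      rw [quotStep, fst_subBits h4]
      by_cases hlt : bval s.1 < bval b
      · rw [Nat.div_eq_of_lt hlt] at h5
        simp only [hlt, decide_true, if_true]
        exact ⟨h1, h2, by omega⟩
      · have h6 := bval_subBits h4 false
        have h7 : 1 ≤ bval s.1 / bval b := (Nat.one_le_div_iff hb).2 (by omega)
        rw [fst_subBits h4] at h6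
        simp only [hlt, decide_false, Bool.toNat_false] at h6
        simp only [hlt, decide_false, Bool.false_eq_true, if_false, length_subBits, add_mul]
        refine ⟨h1, by omega, by omega⟩
  exact key.2.2

/-- The length of the filtered range is the least number without the property, so a minimum is found
without an unbounded search. -/
theorem filter_range_of_antitone (p : ℕ → Bool) (F : ℕ)
    (hp : ∀ i j, i ≤ j → p j = true → p i = true) (hF : p F = false) :
    p ((List.range F).filter p).length = false ∧
      ∀ j < ((List.range F).filter p).length, p j = true := by
  have hex : ∃ e, p e = false := ⟨F, hF⟩
  have hk : ((List.range F).filter p).length = Nat.find hex := by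
    obtain ⟨d, hd⟩ := Nat.exists_eq_add_of_le (Nat.find_min' hex hF)
    rw [hd, List.range_add, List.filter_append]
    have h1 : (List.range (Nat.find hex)).filter p = List.range (Nat.find hex) := by
      rw [List.filter_eq_self]
      intro j hj
      simpa using Nat.find_min hex (List.mem_range.1 hj)
    have h2 : ((List.range d).map fun i => Nat.find hex + i).filter p = [] := by
      rw [List.filter_eq_nil_iff]
      intro j hj
      obtain ⟨i, -, rfl⟩ := List.mem_map.1 hj
      intro h
      have := hp _ _ (Nat.le_add_right _ _) h
      rw [Nat.find_spec hex] at this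
      exact absurd this (by simp)
    rw [h1, h2, List.append_nil, List.length_range]
  rw [hk]
  exact ⟨Nat.find_spec hex, fun j hj => by simpa using Nat.find_min hex hj⟩

/-! #### The list of constraints with multiplicities -/

variable {q : ℕ} {Λ : CSP q}

/-- A constraint with the binary digits of the numerator and the denominator of its weight. -/
abbrev Item (Λ : CSP q) : Type := (Pred Λ × List ℕ) × (List Bool × List Bool)

/-- The weight of a constraint, multiplied by `2 ^ e` and rounded. -/
def multiplicity (e N : ℕ) (x : Item Λ) : ℕ :=
  quot (2 * N) (List.replicate e false ++ x.2.1 ++ List.replicate x.2.2.length false) x.2.2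

/-- Is there an assignment that satisfies the predicate? -/
def satisfiable (P : Pred Λ) : Bool := decide (∃ v, P.1.holds v = true)

/-- The least exponent for which one of the multiplicities is at least `N`. -/
def exponent (N : ℕ) (l : List (Item Λ)) : ℕ :=
  ((List.range (N + (l.map fun x => x.2.2.length).sum)).filter fun e =>
    !l.any fun x => decide (N ≤ multiplicity e N x)).length

/-- The constraints with their multiplicities. -/
def copies (e N : ℕ) (l : List (Item Λ)) : List (Pred Λ × List ℕ) :=
  l.flatMap fun x => List.replicate (multiplicity e N x) x.1

/-- The constraints with satisfiable predicates. -/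
def useful (l : List (Item Λ)) : List (Item Λ) := l.filter fun x => satisfiable x.1.1

/-- The unweighted constraints that replace the weighted ones. -/
def rounding (C : ℕ) (l : List (Item Λ)) : List (Pred Λ × List ℕ) :=
  copies (exponent (C * (useful l).length + 1) (useful l)) (C * (useful l).length + 1) (useful l)

/-- Digits start with the least significant one: the `e` zeros in front multiply by `2 ^ e`, and the
zeros at the end only make the dividend as long as the divisor. -/
theorem multiplicity_eq (e N : ℕ) {x : Item Λ} (hx : 0 < bval x.2.2) :
    multiplicity e N x = min (2 * N) (2 ^ e * bval x.2.1 / bval x.2.2) := by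
  rw [multiplicity, quot_eq _ (by simp; omega) hx]
  simp [bval_append, bval_replicate]

theorem le_multiplicity_iff (e N : ℕ) {x : Item Λ} (hx : 0 < bval x.2.2) :
    N ≤ multiplicity e N x ↔ N * bval x.2.2 ≤ 2 ^ e * bval x.2.1 := by
  rw [multiplicity_eq e N hx, le_min_iff, Nat.le_div_iff_mul_le hx]
  exact ⟨fun h => h.2, fun h => ⟨by omega, h⟩⟩

/-- With the preceding exponent all scaled weights are below `N`, so doubling keeps them below `2 *
N` and the cap in `multiplicity` is inactive; for exponent `0` this holds because weights are at
most `1`. The search range is large enough, since `N < 2 ^ N` and a denominator is less than two to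
the number of its digits. -/
theorem exponent_spec {N : ℕ} (hN : 0 < N) {l : List (Item Λ)}
    (hl : ∀ x ∈ l, 0 < bval x.2.2 ∧ bval x.2.1 ≤ bval x.2.2)
    (hpos : ∃ x ∈ l, 0 < bval x.2.1) :
    (∃ x ∈ l, N ≤ multiplicity (exponent N l) N x) ∧
      ∀ x ∈ l, multiplicity (exponent N l) N x =
        2 ^ exponent N l * bval x.2.1 / bval x.2.2 := by
  have h := filter_range_of_antitone
    (fun e => !l.any fun x => decide (N ≤ multiplicity e N x))
    (N + (l.map fun x => x.2.2.length).sum) (by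
      intro i j hij
      simp only [Bool.not_eq_true', List.any_eq_false, decide_eq_true_eq]
      intro h x hx h'
      refine h x hx ?_
      rw [le_multiplicity_iff _ _ (hl x hx).1] at h' ⊢
      refine h'.trans ?_
      gcongr
      omega) (by
      obtain ⟨x, hx, hx0⟩ := hpos
      simp only [Bool.not_eq_false', List.any_eq_true, decide_eq_true_eq]
      refine ⟨x, hx, ?_⟩
      rw [le_multiplicity_iff _ _ (hl x hx).1]
      have h1 := bval_lt x.2.2
      have h2 : x.2.2.length ≤ (l.map fun x => x.2.2.length).sum :=
        List.single_le_sum (by simp) _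
          (List.mem_map_of_mem (f := fun x : Item Λ => x.2.2.length) hx)
      have h3 : N < 2 ^ N := Nat.lt_two_pow_self
      calc N * bval x.2.2 ≤ 2 ^ N * 2 ^ (l.map fun x => x.2.2.length).sum * 1 := by
            rw [mul_one]
            refine Nat.mul_le_mul h3.le (h1.le.trans ?_)
            gcongr
            simp
        _ ≤ 2 ^ (N + (l.map fun x => x.2.2.length).sum) * bval x.2.1 := by
            rw [← pow_add]
            gcongr
            omega)
  rw [← exponent] at h
  simp only [Bool.not_eq_false', List.any_eq_true, decide_eq_true_eq, Bool.not_eq_true',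
    List.any_eq_false] at h
  refine ⟨h.1, fun x hx => ?_⟩
  obtain ⟨h0, h1⟩ := hl x hx
  rw [multiplicity_eq _ _ h0, min_eq_right]
  refine Nat.le_of_lt_succ ((Nat.div_lt_iff_lt_mul h0).2 ?_)
  rcases he : exponent N l with _ | e
  · have : 1 * bval x.2.2 < (2 * N + 1) * bval x.2.2 :=
      Nat.mul_lt_mul_of_pos_right (by omega) h0
    simpa using lt_of_le_of_lt h1 (by simpa using this)
  · have h2 := h.2 e (by omega) x hx
    rw [le_multiplicity_iff _ _ h0, not_le] at h2
    have : 2 ^ (e + 1) * bval x.2.1 < 2 * N * bval x.2.2 := by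
      rw [pow_succ]
      linarith
    refine this.trans_le ?_
    gcongr
    omega

theorem isConstraint_copies {n e N : ℕ} {l : List (Item Λ)}
    (hl : ∀ x ∈ l, IsConstraint n x.1) : ∀ c ∈ copies e N l, IsConstraint n c := by
  intro c hc
  obtain ⟨x, hx, hc⟩ := List.mem_flatMap.1 hc
  rw [List.eq_of_mem_replicate hc]
  exact hl x hx

theorem isConstraint_rounding {n C : ℕ} {l : List (Item Λ)}
    (hl : ∀ x ∈ l, IsConstraint n x.1) : ∀ c ∈ rounding C l, IsConstraint n c :=
  isConstraint_copies fun x hx => hl x (List.mem_of_mem_filter hx)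

section value

variable [NeZero q]

/-- The weight of the satisfied constraints. -/
noncomputable def weightedScore (l : List (Item Λ)) (χ : ℕ → Fin q) : ℝ :=
  (l.map fun x => (bval x.2.1 : ℝ) / bval x.2.2 *
    if sat x.1.1 (x.1.2.map χ) = true then 1 else 0).sum

theorem weightedScore_nonneg (l : List (Item Λ)) (χ : ℕ → Fin q) : 0 ≤ weightedScore l χ := by
  refine List.sum_nonneg fun y hy => ?_
  obtain ⟨x, -, rfl⟩ := List.mem_map.1 hy
  positivity

theorem weightedScore_useful (l : List (Item Λ)) (χ : ℕ → Fin q) :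
    weightedScore (useful l) χ = weightedScore l χ := by
  induction l with
  | nil => rfl
  | cons x l ih =>
    unfold weightedScore useful at ih ⊢
    by_cases h : satisfiable x.1.1 = true
    · rw [List.filter_cons_of_pos (p := fun x : Item Λ => satisfiable x.1.1) h,
        List.map_cons, List.map_cons, List.sum_cons, List.sum_cons, ih]
    · rw [List.filter_cons_of_neg (p := fun x : Item Λ => satisfiable x.1.1) h, ih,
        List.map_cons, List.sum_cons, if_neg, mul_zero, zero_add]
      intro h'
      exact h (decide_eq_true ⟨_, h'⟩)

theorem score_copies (e N : ℕ) (l : List (Item Λ)) (χ : ℕ → Fin q) :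
    score (copies e N l) χ = (l.map fun x => multiplicity e N x *
      if sat x.1.1 (x.1.2.map χ) = true then 1 else 0).sum := by
  rw [score, copies, List.countP_flatMap]
  congr 1
  refine List.map_congr_left fun x _ => ?_
  simp [List.countP_replicate]

/-- The unweighted values are approximately proportional to the weighted ones. -/
theorem score_copies_bounds {e N : ℕ} {l : List (Item Λ)} (hl : ∀ x ∈ l, 0 < bval x.2.2)
    (h : ∀ x ∈ l, multiplicity e N x = 2 ^ e * bval x.2.1 / bval x.2.2) (χ : ℕ → Fin q) :
    (score (copies e N l) χ : ℝ) ≤ 2 ^ e * weightedScore l χ ∧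
      2 ^ e * weightedScore l χ ≤ score (copies e N l) χ + l.length := by
  rw [score_copies, weightedScore]
  induction l with
  | nil => simp
  | cons x l ih =>
    obtain ⟨h1, h2⟩ := ih (fun y hy => hl y (List.mem_cons_of_mem _ hy))
      fun y hy => h y (List.mem_cons_of_mem _ hy)
    simp only [List.map_cons, List.sum_cons, List.length_cons, h x List.mem_cons_self]
    push_cast at h1 h2 ⊢
    have h0 : (0 : ℝ) < bval x.2.2 := by exact_mod_cast hl x List.mem_cons_self
    have h3 : ((2 ^ e * bval x.2.1 / bval x.2.2 : ℕ) : ℝ) ≤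
        2 ^ e * ((bval x.2.1 : ℝ) / bval x.2.2) := by
      have := Nat.cast_div_le (α := ℝ) (m := 2 ^ e * bval x.2.1) (n := bval x.2.2)
      push_cast at this
      rwa [mul_div_assoc] at this
    have h4 : 2 ^ e * ((bval x.2.1 : ℝ) / bval x.2.2) ≤
        ((2 ^ e * bval x.2.1 / bval x.2.2 : ℕ) : ℝ) + 1 := by
      have := Nat.lt_succ_iff.1 (Nat.lt_succ_of_le
        (Nat.lt_mul_div_succ (2 ^ e * bval x.2.1) (hl x List.mem_cons_self)).le)
      rw [← mul_div_assoc, div_le_iff₀ h0]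
      have h5 : ((2 ^ e * bval x.2.1 : ℕ) : ℝ) ≤
          ((bval x.2.2 * (2 ^ e * bval x.2.1 / bval x.2.2 + 1) : ℕ) : ℝ) := by
        exact_mod_cast this
      push_cast at h5
      linarith
    generalize ((2 ^ e * bval x.2.1 / bval x.2.2 : ℕ) : ℝ) = c at *
    generalize (bval x.2.1 : ℝ) / bval x.2.2 = w at *
    split_ifs <;> constructor <;> linarith

/-- The variables of a scope are distinct, so satisfying values can be assigned to them
independently. -/
theorem exists_sat {n : ℕ} {c : Pred Λ × List ℕ} (hc : IsConstraint n c)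
    (hs : satisfiable c.1 = true) : ∃ χ : ℕ → Fin q, sat c.1 (c.2.map χ) = true := by
  obtain ⟨v, hv⟩ := of_decide_eq_true hs
  refine ⟨fun y => (List.ofFn v).getD (c.2.idxOf y) 0, ?_⟩
  rw [sat, ← hv]
  congr 1
  funext p
  have hp : p.1 < c.2.length := hc.length_eq.symm ▸ p.2
  rw [List.getD_eq_getElem _ _ (by simpa using hp)]
  simp [hc.nodup.idxOf_getElem]

/-- Either all weighted values are zero, or the unweighted values are, approximately, large
multiples of them. -/
theorem rounding_spec {n : ℕ} (C : ℕ) {l : List (Item Λ)} (hc : ∀ x ∈ l, IsConstraint n x.1)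
    (hl : ∀ x ∈ l, 0 < bval x.2.2 ∧ bval x.2.1 ≤ bval x.2.2) :
    (∀ χ : ℕ → Fin q, weightedScore l χ = 0) ∨ ∃ c m : ℕ, 0 < c ∧
      (∀ χ : ℕ → Fin q, (score (rounding C l) χ : ℝ) ≤ c * weightedScore l χ ∧
        c * weightedScore l χ ≤ score (rounding C l) χ + m) ∧
      ∃ χ : ℕ → Fin q, C * m + 1 ≤ score (rounding C l) χ := by
  have hc' : ∀ x ∈ useful l, IsConstraint n x.1 := fun x hx => hc x (List.mem_of_mem_filter hx)
  have hl' : ∀ x ∈ useful l, 0 < bval x.2.2 ∧ bval x.2.1 ≤ bval x.2.2 :=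
    fun x hx => hl x (List.mem_of_mem_filter hx)
  by_cases hpos : ∃ x ∈ useful l, 0 < bval x.2.1
  · right
    -- Satisfying the constraint `x` alone scores more than `C` times the total rounding loss. It
    -- can be satisfied because only useful constraints were kept.
    obtain ⟨⟨x, hx, hxN⟩, h2⟩ := exponent_spec
      (Nat.succ_pos (C * (useful l).length)) hl' hpos
    refine ⟨2 ^ exponent (C * (useful l).length + 1) (useful l), (useful l).length, by positivity,
      fun χ => ?_, ?_⟩
    · rw [← weightedScore_useful l]
      push_cast
      exact score_copies_bounds (fun x hx => (hl' x hx).1) h2 χ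
    · obtain ⟨χ, hχ⟩ := exists_sat (hc' x hx) (List.mem_filter.1 hx).2
      refine ⟨χ, hxN.trans ?_⟩
      rw [rounding, score_copies]
      refine le_trans (le_of_eq ?_) (List.single_le_sum (by simp) _ (List.mem_map_of_mem hx))
      rw [if_pos hχ, mul_one]
  · left
    push Not at hpos
    intro χ
    rw [← weightedScore_useful l]
    refine List.sum_eq_zero fun y hy => ?_
    obtain ⟨x, hx, rfl⟩ := List.mem_map.1 hy
    have : bval x.2.1 = 0 := by
      have := hpos x hx
      omega
    simp [this]

end value

end CSPReduction

namespace CSPReduction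

variable {q : ℕ} {Λ : CSP q}

/-! #### The approximation ratio -/

/-- The multiplicity with which the occurrences of variables are replaced. -/
def spread (C n : ℕ) (G : List (Pred Λ × List ℕ)) : ℕ :=
  C * (n * (G.length * (vars G).length)) + 1

/-- Measured in scores on `G`, decoding loses at most `1 / C ≤ δ` and rounding at most `α * m ≤ C *
δ * m`. Together this is at most `δ * (C * m + 1)`, hence at most `δ` times the scaled value of
`χ₀`, and so of every assignment that is at least as good. -/
theorem mul_weightedScore_le [NeZero q] {α δ : ℝ} (hδ : 0 < δ) {C K n : ℕ} (hα : α ≤ C * δ)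
    (hC : 1 ≤ C * δ) {l : List (Item Λ)} (hc : ∀ x ∈ l, IsConstraint n x.1)
    (hl : ∀ x ∈ l, 0 < bval x.2.2 ∧ bval x.2.1 ≤ bval x.2.2)
    (hK : ∀ P : Pred Λ, P.1.arity ≤ K) (χ : List (Fin q))
    (hχ : 0 ≤ α → ∀ χ' : ℕ → Fin q,
      α * score (blowup (spread C n (rounding C l)) K (rounding C l)) χ' ≤
        score (blowup (spread C n (rounding C l)) K (rounding C l)) fun y => χ.getD y 0)
    (ψ : ℕ → Fin q) :
    (α - δ) * weightedScore l ψ ≤ weightedScore l fun i =>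
      (decode (blowup (spread C n (rounding C l)) K (rounding C l)) (vars (rounding C l)) n
        χ).getD i 0 := by
  -- If `α ≤ δ`, in particular if `α` is negative, non-negativity of the values suffices.
  rcases le_or_gt α δ with hαδ | hαδ
  · exact (mul_nonpos_of_nonpos_of_nonneg (by linarith) (weightedScore_nonneg l ψ)).trans
      (weightedScore_nonneg l _)
  have hG := isConstraint_rounding (C := C) hc
  have h1 := mul_score_le (T := spread C n (rounding C l)) hG hK χ
  rcases rounding_spec (q := q) C hc hl with h0 | ⟨c, m, hc0, h2, χ₀, h3⟩
  · rw [h0, h0, mul_zero]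
  generalize (fun i => (decode (blowup (spread C n (rounding C l)) K (rounding C l))
    (vars (rounding C l)) n χ).getD i 0) = A at *
  have hα0 : 0 ≤ α := by linarith
  have hC0 : (0 : ℝ) < C := by
    rcases Nat.eq_zero_or_pos C with h | h
    · simp [h] at hC
      linarith
    · exact_mod_cast h
  have h4 : ∀ ψ : ℕ → Fin q,
      α * score (rounding C l) ψ ≤ score (rounding C l) A + 1 / C := by
    intro ψ
    have h5 := hχ hα0 fun y => ψ ((vars (rounding C l)).getD y 0)
    rw [score_blowup_comp hG hK _ ψ fun _ _ => rfl] at h5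
    have hT : (0 : ℝ) < spread C n (rounding C l) := by exact_mod_cast Nat.succ_pos _
    have hT' : (spread C n (rounding C l) : ℝ) = C * ((n * ((rounding C l).length *
        (vars (rounding C l)).length) : ℕ) : ℝ) + 1 := by
      rw [spread]
      push_cast
      ring
    have h1' : (spread C n (rounding C l) : ℝ) * score (blowup (spread C n (rounding C l)) K
        (rounding C l)) (fun y => χ.getD y 0) ≤ (spread C n (rounding C l) : ℝ) ^ K *
        (spread C n (rounding C l) * score (rounding C l) A + ((n * ((rounding C l).length *
        (vars (rounding C l)).length) : ℕ) : ℝ)) := by exact_mod_cast h1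
    push_cast at h5
    generalize ((n * ((rounding C l).length * (vars (rounding C l)).length) : ℕ) : ℝ) = R at *
    generalize (spread C n (rounding C l) : ℝ) = T at *
    -- The choice of `spread` enters here.
    have hR : R ≤ T * (1 / C) := by
      rw [hT', mul_one_div, le_div_iff₀ hC0]
      linarith
    have h6 : T ^ K * (T * (α * score (rounding C l) ψ)) ≤
        T ^ K * (T * (score (rounding C l) A + 1 / C)) := by
      calc T ^ K * (T * (α * score (rounding C l) ψ))
          = T * (α * (T ^ K * score (rounding C l) ψ)) := by ring
        _ ≤ T ^ K * (T * score (rounding C l) A + R) :=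
          (mul_le_mul_of_nonneg_left h5 hT.le).trans h1'
        _ ≤ T ^ K * (T * (score (rounding C l) A + 1 / C)) := by
          rw [mul_add T]
          gcongr
    exact le_of_mul_le_mul_left (le_of_mul_le_mul_left h6 (by positivity)) hT
  have hc1 : (0 : ℝ) < c := by exact_mod_cast hc0
  have h6 : 1 / (C : ℝ) ≤ δ := by
    rw [div_le_iff₀ hC0]
    linarith
  have h7 : (C : ℝ) * m + 1 ≤ score (rounding C l) χ₀ := by exact_mod_cast h3
  have key : ∀ ψ : ℕ → Fin q, weightedScore l χ₀ ≤ weightedScore l ψ →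
      (α - δ) * weightedScore l ψ ≤ weightedScore l A := by
    intro ψ hψ
    refine le_of_mul_le_mul_left ?_ hc1
    have h8 := mul_le_mul_of_nonneg_left (h2 ψ).2 hα0
    have h9 := h4 ψ
    have h10 := (h2 A).1
    have h11 := mul_le_mul_of_nonneg_left hψ hc1.le
    have h12 := mul_le_mul_of_nonneg_left (h7.trans ((h2 χ₀).1.trans h11)) hδ.le
    have h13 : α * m ≤ C * δ * m := by gcongr
    nlinarith
  -- A `ψ` worse than `χ₀` may be replaced by `χ₀`, since `α - δ` is positive.
  rcases le_total (weightedScore l χ₀) (weightedScore l ψ) with h | h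
  · exact key ψ h
  · exact (mul_le_mul_of_nonneg_left h (by linarith)).trans (key χ₀ le_rfl)

/-! #### Reading an instance -/

/-- The state of the parser: the number of tally marks and the binary digits since the last
separator, the groups since the last predicate, and the constraints. -/
abbrev ParseState (Λ : CSP q) : Type :=
  (ℕ × List Bool) × (List (ℕ × List Bool) × List (Pred Λ × List (ℕ × List Bool)))

/-- Read a symbol. -/
def parseStep (s : ParseState Λ) : CSPSymbol Λ → ParseState Λ
  | .pred P => (s.1, ([], (P, s.2.1) :: s.2.2))
  | .tally => ((s.1.1 + 1, s.1.2), s.2)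
  | .bit b => ((s.1.1, b :: s.1.2), s.2)
  | .sep => ((0, []), (s.1 :: s.2.1, s.2.2))

/-- Read a word, from its end to its beginning. -/
def parseState (w : List (CSPSymbol Λ)) : ParseState Λ :=
  w.foldr (fun a s => parseStep s a) ((0, []), ([], []))

/-- The last two groups of a constraint are the weight, the others are the scope. -/
def toItem (c : Pred Λ × List (ℕ × List Bool)) : Item Λ :=
  ((c.1, (c.2.take (c.2.length - 2)).map Prod.fst),
    ((c.2.getD (c.2.length - 2) (0, [])).2, (c.2.getD (c.2.length - 1) (0, [])).2))

/-- The number of variables and the constraints of the instance that is described by a word. -/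
def parse (w : List (CSPSymbol Λ)) : ℕ × List (Item Λ) :=
  ((parseState w).1.1, (parseState w).2.2.map toItem)

theorem foldr_replicate_tally (t : ℕ) (s : ParseState Λ) :
    (List.replicate t CSPSymbol.tally).foldr (fun a s => parseStep s a) s =
      ((s.1.1 + t, s.1.2), s.2) := by
  induction t with
  | zero => rfl
  | succ t ih =>
    rw [List.replicate_succ, List.foldr_cons, ih]
    rfl

theorem foldr_map_bit (b : List Bool) (s : ParseState Λ) :
    (b.map CSPSymbol.bit).foldr (fun a s => parseStep s a) s = ((s.1.1, b ++ s.1.2), s.2) := by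
  induction b with
  | nil => rfl
  | cons x b ih =>
    rw [List.map_cons, List.foldr_cons, ih]
    rfl

theorem foldr_scope (v : List ℕ) (s : List (ℕ × List Bool) × List (Pred Λ × List (ℕ × List Bool))) :
    (v.flatMap fun i => CSPSymbol.sep :: List.replicate i CSPSymbol.tally).foldr
      (fun a s => parseStep s a) ((0, []), s) =
        ((0, []), (v.map (fun i => (i, [])) ++ s.1, s.2)) := by
  induction v with
  | nil => rfl
  | cons i v ih =>
    rw [List.flatMap_cons, List.foldr_append, ih, List.foldr_cons, foldr_replicate_tally]
    simp [parseStep]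

/-- A constraint with its weight, as it is read from a word. -/
def itemOf {n : ℕ} (C : CSPConstraint Λ n) (w : ℚ≥0) : Item Λ :=
  ((C.pred, (List.ofFn C.scope).map Fin.val), (w.num.bits, w.den.bits))

/-- The constraints of an instance. -/
def itemsOf (F : WeightedCSPInstance Λ) : List (Item Λ) :=
  (List.finRange F.numConstraints).map fun r => itemOf (F.constraint r) (F.weight r)

/-- The groups of a constraint. -/
def groupsOf (x : Item Λ) : Pred Λ × List (ℕ × List Bool) :=
  (x.1.1, x.1.2.map (fun i => (i, [])) ++ [(0, x.2.1), (0, x.2.2)])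

theorem toItem_groupsOf (x : Item Λ) : toItem (groupsOf x) = x := by
  obtain ⟨⟨P, v⟩, num, den⟩ := x
  simp [toItem, groupsOf, Function.comp_def]

/-- Read backwards, a separator completes the group behind it and a predicate symbol completes the
constraint, so the parser needs no lookahead. -/
theorem foldr_constraint {n : ℕ} (C : CSPConstraint Λ n) (w : ℚ≥0)
    (cs : List (Pred Λ × List (ℕ × List Bool))) :
    (C.encode ++ encodeWeight Λ w).foldr (fun a s => parseStep s a) ((0, []), ([], cs)) =
      ((0, []), ([], groupsOf (itemOf C w) :: cs)) := by
  rw [List.foldr_append, encodeWeight, List.foldr_append, List.foldr_cons, foldr_map_bit,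
    List.foldr_cons, foldr_map_bit, encode_eq, encodeConstraint, List.foldr_cons]
  change parseStep (List.foldr (fun a s => parseStep s a)
    ((0, []), ([(0, w.num.bits ++ []), (0, w.den.bits ++ [])], cs)) _) (.pred C.pred) = _
  rw [foldr_scope, List.append_nil, List.append_nil]
  rfl

theorem parse_encode (F : WeightedCSPInstance Λ) : parse F.encode = (F.numVars, itemsOf F) := by
  have key : ∀ m : List (Fin F.numConstraints),
      (m.flatMap fun r => (F.constraint r).encode ++ encodeWeight Λ (F.weight r)).foldr
        (fun a s => parseStep s a) ((0, []), ([], [])) =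
      ((0, []), ([], m.map fun r => groupsOf (itemOf (F.constraint r) (F.weight r)))) := by
    intro m
    induction m with
    | nil => rfl
    | cons r m ih => rw [List.flatMap_cons, List.foldr_append, ih, foldr_constraint]; rfl
  have h : parseState F.encode = ((F.numVars, []), ([], (List.finRange F.numConstraints).map
      fun r => groupsOf (itemOf (F.constraint r) (F.weight r)))) := by
    rw [parseState, WeightedCSPInstance.encode, List.foldr_append, key, foldr_replicate_tally]
    simp
  rw [parse, h]
  simp only [List.map_map, itemsOf]
  congr 2
  funext r
  exact toItem_groupsOf _

theorem isConstraint_itemsOf (F : WeightedCSPInstance Λ) :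
    ∀ x ∈ itemsOf F, IsConstraint F.numVars x.1 := by
  intro x hx
  obtain ⟨r, -, rfl⟩ := List.mem_map.1 hx
  refine ⟨by simp [itemOf], fun y hy => ?_, ?_⟩
  · obtain ⟨i, -, rfl⟩ := List.mem_map.1 hy
    exact i.2
  · exact (List.nodup_ofFn.2 (F.constraint r).scope.injective).map Fin.val_injective

/-- Non-negative weights with sum `1` are at most `1`; the search for the exponent starts from this.
-/
theorem weight_itemsOf (F : WeightedCSPInstance Λ) :
    ∀ x ∈ itemsOf F, 0 < bval x.2.2 ∧ bval x.2.1 ≤ bval x.2.2 := by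
  intro x hx
  obtain ⟨r, -, rfl⟩ := List.mem_map.1 hx
  simp only [itemOf, bval_bits]
  refine ⟨(F.weight r).den_pos, ?_⟩
  have h1 : F.weight r ≤ 1 := by
    rw [← F.weight_sum]
    exact Finset.single_le_sum (f := F.weight) (fun _ _ => zero_le) (Finset.mem_univ r)
  rw [← NNRat.num_div_den (F.weight r), div_le_one (by exact_mod_cast (F.weight r).den_pos)] at h1
  exact_mod_cast h1

theorem val_eq_weightedScore [NeZero q] (F : WeightedCSPInstance Λ) (χ : Fin F.numVars → Fin q)
    (χ' : ℕ → Fin q) (hχ : ∀ i : Fin F.numVars, χ' i = χ i) :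
    F.val χ = weightedScore (itemsOf F) χ' := by
  rw [WeightedCSPInstance.val, weightedScore, itemsOf, List.map_map]
  rw [← List.ofFn_eq_map, List.sum_ofFn]
  refine Finset.sum_congr rfl fun r _ => ?_
  rw [eval_eq _ χ χ' hχ]
  simp only [Function.comp, itemOf, bval_bits]
  congr 1
  conv_lhs => rw [← NNRat.num_div_den (F.weight r)]
  push_cast
  rfl

end CSPReduction

/-! ### The reduction is computable in polynomial time -/

namespace Turing

namespace TreeMachine

open TreeEnc

namespace PolyT

/-! ### Lists of numbers and of binary digits -/

section lists

variable {Bi Bo : Type} {M : TM2ComputableAux Bi Bo}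
variable {I : Type} [TreeEnc Bi Bo I]

theorem cloud {X : I → List ℕ} {i : I → ℕ} (hX : PolyT M X) (hi : PolyT M i) :
    PolyT M fun x => CSPReduction.cloud (X x) (i x) :=
  filter (g := fun x s => decide ((X x).getD s 0 = i x)) (range (length hX))
    (eq (getD (snd id) (comp hX (fst id)) (const 0)) (comp hi (fst id)))

theorem slotList {T s : I → ℕ} {X : I → List ℕ} (hT : PolyT M T) (hX : PolyT M X)
    (hs : PolyT M s) : PolyT M fun x => CSPReduction.slotList (T x) (X x) (s x) := by
  have hC : PolyT M fun x => CSPReduction.cloud (X x) ((X x).getD (s x) 0) :=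
    cloud hX (getD hs hX (const 0))
  exact append (flatMap (g := fun x _ => CSPReduction.cloud (X x) ((X x).getD (s x) 0))
    (replicate (div hT (length hC)) (const ())) (comp hC (fst id)))
    (replicate (sub hT (mul (div hT (length hC)) (length hC))) hs)

/-- Here `k` is a constant and not part of the input: the recursion is unfolded into `k` nested
loops. The type `I` varies in the induction because inner loops see more data. -/
theorem expand (k : ℕ) : ∀ {I : Type} [TreeEnc Bi Bo I] {T : I → ℕ} {ll : I → List (List ℕ)},
    PolyT M T → PolyT M ll → PolyT M fun x => CSPReduction.expand (T x) k (ll x) := by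
  induction k with
  | zero => exact fun _ _ => const _
  | succ k ih =>
    intro I _ T ll hT hll
    refine (listCases hll
      (f := fun x => (List.replicate (T x) ()).flatMap fun _ => CSPReduction.expand (T x) k [])
      (g := fun x l ll => l.flatMap fun a =>
        (CSPReduction.expand (T x) k ll).map fun ys => a :: ys) ?_ ?_).of_eq fun x => ?_
    · exact flatMap (g := fun x _ => CSPReduction.expand (T x) k []) (replicate hT (const ()))
        (ih (comp hT (fst id)) (const []))
    · refine flatMap (g := fun (x : I × List ℕ × List (List ℕ)) (a : ℕ) =>
        (CSPReduction.expand (T x.1) k x.2.2).map fun ys => a :: ys) (fst (snd id)) ?_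
      exact map (g := fun (x : (I × List ℕ × List (List ℕ)) × ℕ) ys => x.2 :: ys)
        (ih (comp hT (fst (fst id))) (snd (snd (fst id)))) (cons (snd (fst id)) (snd id))
    · cases ll x <;> rfl

theorem subBits {a b : I → List Bool} {c : I → Bool} (ha : PolyT M a) (hb : PolyT M b)
    (hc : PolyT M c) : PolyT M fun x => CSPReduction.subBits (a x) (b x) (c x) := by
  -- The recursion becomes a fold; the state consists of the remaining digits of `b`, the borrow and
  -- the reversed difference.
  let f : List Bool × Bool × List Bool → Bool → List Bool × Bool × List Bool := fun s x =>
    (s.1.tail, ((!x && (s.1.headD false || s.2.1)) || (s.1.headD false && s.2.1),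
      xor x (xor (s.1.headD false) s.2.1) :: s.2.2))
  have key : ∀ (a b : List Bool) (c : Bool) (out : List Bool),
      (a.foldl f (b, c, out)).2 = ((CSPReduction.subBits a b c).1,
        (CSPReduction.subBits a b c).2.reverse ++ out) := by
    intro a
    induction a with
    | nil => intros; rfl
    | cons x a ih =>
      intro b c out
      rw [List.foldl_cons, ih]
      simp [CSPReduction.subBits]
  have hxor : PolyT M fun x : Bool × Bool => xor x.1 x.2 :=
    (ite (fst id) (not (snd id)) (snd id)).of_eq fun x => by rcases x with ⟨_ | _, _ | _⟩ <;> rfl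
  have hxor' : ∀ {f g : I × (List Bool × Bool × List Bool) × Bool → Bool}, PolyT M f →
      PolyT M g → PolyT M fun y => xor (f y) (g y) := fun hf hg =>
    comp (g := fun x : Bool × Bool => xor x.1 x.2) hxor (pair hf hg)
  have hf : PolyT M fun y : I × (List Bool × Bool × List Bool) × Bool => f y.2.1 y.2.2 := by
    have h1 : PolyT M fun y : I × (List Bool × Bool × List Bool) × Bool => y.2.1.1.headD false :=
      headD (fst (fst (snd id))) (const false)
    have h2 : PolyT M fun y : I × (List Bool × Bool × List Bool) × Bool => y.2.1.2.1 :=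
      fst (snd (fst (snd id)))
    have h3 : PolyT M fun y : I × (List Bool × Bool × List Bool) × Bool => y.2.2 := snd (snd id)
    exact pair (tail (fst (fst (snd id)))) (pair (or (and (not h3) (or h1 h2)) (and h1 h2))
      (cons (hxor' h3 (hxor' h1 h2)) (snd (snd (fst (snd id))))))
  have h := foldl_of_le (f := fun _ => f) ha (pair hb (pair hc (const []))) hf
    ⟨2, fun x s x' _ => by
    obtain ⟨s, c, out⟩ := s
    simp only [f, sz_mk, sz_leaf, sz_list_leaf, List.length_tail, List.length_cons,
      Polynomial.eval_ofNat]
    omega⟩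
  refine (pair (fst (snd h)) (reverse (snd (snd h)))).of_eq fun x => ?_
  simp [key]

theorem quot {J : I → ℕ} {a b : I → List Bool} (hJ : PolyT M J) (ha : PolyT M a)
    (hb : PolyT M b) : PolyT M fun x => CSPReduction.quot (J x) (a x) (b x) := by
  have h : PolyT M fun y : I × List Bool × ℕ => CSPReduction.subBits y.2.1 (b y.1) false :=
    subBits (fst (snd id)) (comp hb (fst id)) (const false)
  refine snd (iterate (f := fun x => CSPReduction.quotStep (b x)) hJ (pair ha (const 0))
    (ite (fst h) (snd id) (pair (snd h) (add (snd (snd id)) (const 1)))) ⟨2, fun x s => ?_⟩)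
  rw [CSPReduction.quotStep]
  split_ifs
  · omega
  · obtain ⟨s, c⟩ := s
    simp only [sz_mk, sz_list_leaf, CSPReduction.length_subBits, sz_nat, Polynomial.eval_ofNat]
    omega

end lists

variable {q : ℕ} {Λ : CSP q}

instance : TreeEnc (CSPSymbol Λ) (Fin q) (CSPReduction.Pred Λ) :=
  ⟨fun P => .leaf (.inr (.inl (.pred P)))⟩

instance : LeafEnc (CSPSymbol Λ) (Fin q) (CSPReduction.Pred Λ) :=
  ⟨fun P => .inr (.inl (.pred P)), fun P P' h => by simpa using h, fun _ => rfl⟩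

instance : Finite (CSPSymbol Λ) := by
  refine Finite.of_surjective (α := CSPReduction.Pred Λ ⊕ Bool ⊕ Bool) (fun
    | .inl P => .pred P
    | .inr (.inl b) => .bit b
    | .inr (.inr b) => if b then .tally else .sep) ?_
  rintro (P | _ | b | _)
  · exact ⟨.inl P, rfl⟩
  · exact ⟨.inr (.inr true), rfl⟩
  · exact ⟨.inr (.inl b), rfl⟩
  · exact ⟨.inr (.inr false), rfl⟩

variable {M : TM2ComputableAux (CSPSymbol Λ) (Fin q)}
variable {I : Type} [TreeEnc (CSPSymbol Λ) (Fin q) I]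

/-! #### The regular instance -/

theorem vars {G : I → List (CSPReduction.Pred Λ × List ℕ)} (hG : PolyT M G) :
    PolyT M fun x => CSPReduction.vars (G x) :=
  flatMap (g := fun _ => Prod.snd) hG (snd (snd id))

theorem number {G : I → List (CSPReduction.Pred Λ × List ℕ)} {r : I → List ℕ} (hG : PolyT M G)
    (hr : PolyT M r) : PolyT M fun x => CSPReduction.number (G x) (r x) := by
  let f : List ℕ × List (CSPReduction.Pred Λ × List ℕ) → CSPReduction.Pred Λ × List ℕ →
      List ℕ × List (CSPReduction.Pred Λ × List ℕ) := fun s c =>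
    (s.1.drop c.2.length, (c.1, s.1.take c.2.length) :: s.2)
  have key : ∀ (G : List (CSPReduction.Pred Λ × List ℕ)) r out,
      (G.foldl f (r, out)).2 = (CSPReduction.number G r).reverse ++ out := by
    intro G
    induction G with
    | nil => intros; rfl
    | cons c G ih =>
      intro r out
      rw [List.foldl_cons, ih]
      simp [CSPReduction.number]
  have hf : PolyT M fun y : I × (List ℕ × List (CSPReduction.Pred Λ × List ℕ)) ×
      CSPReduction.Pred Λ × List ℕ => f y.2.1 y.2.2 :=
    pair (drop (length (snd (snd (snd id)))) (fst (fst (snd id))))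
      (cons (pair (fst (snd (snd id))) (take (length (snd (snd (snd id)))) (fst (fst (snd id)))))
        (snd (fst (snd id))))
  have h := foldl_of_le (f := fun _ => f) hG (pair hr (const [])) hf ⟨4, fun x s c _ => by
    obtain ⟨s, out⟩ := s
    have := sz_take_add_sz_drop (Bi := CSPSymbol Λ) (Bo := Fin q) s c.2.length
    simp only [f, sz_mk, sz_cons, sz_leaf, Polynomial.eval_ofNat]
    omega⟩
  refine (reverse (snd h)).of_eq fun x => ?_
  simp [key]

theorem slots {G : I → List (CSPReduction.Pred Λ × List ℕ)} (hG : PolyT M G) :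
    PolyT M fun x => CSPReduction.slots (G x) :=
  number hG (range (length (vars hG)))

theorem blowup {T : I → ℕ} (K : ℕ) {G : I → List (CSPReduction.Pred Λ × List ℕ)}
    (hT : PolyT M T) (hG : PolyT M G) : PolyT M fun x => CSPReduction.blowup (T x) K (G x) :=
  flatMap (g := fun x (c : CSPReduction.Pred Λ × List ℕ) => (CSPReduction.expand (T x) K
      (c.2.map (CSPReduction.slotList (T x) (CSPReduction.vars (G x))))).map fun ys => (c.1, ys))
    (slots hG)
    (map (g := fun (x : I × CSPReduction.Pred Λ × List ℕ) ys => (x.2.1, ys))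
      (expand K (comp hT (fst id))
        (map (g := fun (x : I × CSPReduction.Pred Λ × List ℕ) =>
            CSPReduction.slotList (T x.1) (CSPReduction.vars (G x.1)))
          (snd (snd id))
          (slotList (comp hT (fst (fst id))) (vars (comp hG (fst (fst id)))) (snd id))))
      (pair (fst (snd (fst id))) (snd id)))

/-! #### The weights -/

theorem multiplicity {e N : I → ℕ} {y : I → CSPReduction.Item Λ} (he : PolyT M e)
    (hN : PolyT M N) (hy : PolyT M y) :
    PolyT M fun x => CSPReduction.multiplicity (e x) (N x) (y x) :=
  quot (mul (const 2) hN) (append (append (replicate he (const false)) (fst (snd hy)))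
    (replicate (length (snd (snd hy))) (const false))) (snd (snd hy))

theorem exponent {N : I → ℕ} {l : I → List (CSPReduction.Item Λ)} (hN : PolyT M N)
    (hl : PolyT M l) : PolyT M fun x => CSPReduction.exponent (N x) (l x) :=
  length (filter (g := fun x e =>
      !(l x).any fun y => decide (N x ≤ CSPReduction.multiplicity e (N x) y))
    (range (add hN (sum (map (g := fun _ (y : CSPReduction.Item Λ) => y.2.2.length) hl
      (length (snd (snd (snd id))))))))
    (not (any (g := fun (x : I × ℕ) (y : CSPReduction.Item Λ) =>
        decide (N x.1 ≤ CSPReduction.multiplicity x.2 (N x.1) y)) (comp hl (fst id))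
      (le (comp hN (fst (fst id)))
        (multiplicity (snd (fst id)) (comp hN (fst (fst id))) (snd id))))))

theorem copies {e N : I → ℕ} {l : I → List (CSPReduction.Item Λ)} (he : PolyT M e)
    (hN : PolyT M N) (hl : PolyT M l) :
    PolyT M fun x => CSPReduction.copies (e x) (N x) (l x) :=
  flatMap (g := fun x (y : CSPReduction.Item Λ) =>
      List.replicate (CSPReduction.multiplicity (e x) (N x) y) y.1) hl
    (replicate (multiplicity (comp he (fst id)) (comp hN (fst id)) (snd id)) (fst (snd id)))

theorem useful {l : I → List (CSPReduction.Item Λ)} (hl : PolyT M l) :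
    PolyT M fun x => CSPReduction.useful (l x) :=
  filter (g := fun _ (y : CSPReduction.Item Λ) => CSPReduction.satisfiable y.1.1) hl
    (comp (of_finite CSPReduction.satisfiable) (fst (fst (snd id))))

theorem rounding (C : ℕ) {l : I → List (CSPReduction.Item Λ)} (hl : PolyT M l) :
    PolyT M fun x => CSPReduction.rounding C (l x) :=
  have hN : PolyT M fun x => C * (CSPReduction.useful (l x)).length + 1 :=
    add (mul (const C) (length (useful hl))) (const 1)
  copies (exponent hN (useful hl)) hN (useful hl)

theorem spread (C : ℕ) {n : I → ℕ} {G : I → List (CSPReduction.Pred Λ × List ℕ)}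
    (hn : PolyT M n) (hG : PolyT M G) : PolyT M fun x => CSPReduction.spread C (n x) (G x) :=
  add (mul (const C) (mul hn (mul (length hG) (length (vars hG))))) (const 1)

/-! #### Decoding -/

section decode

variable [NeZero q]

/-- There are finitely many predicates, and each of them inspects a fixed number of entries. -/
theorem sat {P : I → CSPReduction.Pred Λ} {vs : I → List (Fin q)} (hP : PolyT M P)
    (hvs : PolyT M vs) : PolyT M fun x => CSPReduction.sat (P x) (vs x) :=
  finCases (f := fun P x => CSPReduction.sat P (vs x)) hP fun P =>
    comp (of_entries 0 P.1.arity P.1.holds) hvs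

theorem score {cs : I → List (CSPReduction.Pred Λ × List ℕ)} {χ : I → ℕ → Fin q}
    (hcs : PolyT M cs) (hχ : PolyT M fun y : I × ℕ => χ y.1 y.2) :
    PolyT M fun x => CSPReduction.score (cs x) (χ x) :=
  (length (filter (g := fun x (c : CSPReduction.Pred Λ × List ℕ) =>
      CSPReduction.sat c.1 (c.2.map (χ x))) hcs
    (sat (fst (snd id)) (map (g := fun (y : I × CSPReduction.Pred Λ × List ℕ) => χ y.1)
      (snd (snd id)) (comp hχ (pair (fst (fst id)) (snd id))))))).of_eq fun _ =>
    List.countP_eq_length_filter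

theorem argmax {f : I → Fin q → ℕ} (hf : PolyT M fun y : I × Fin q => f y.1 y.2) :
    PolyT M fun x => CSPReduction.argmax (f x) :=
  headD (filter (g := fun x a => (List.finRange q).all fun b => decide (f x b ≤ f x a))
    (const (List.finRange q))
    (all (g := fun (x : I × Fin q) b => decide (f x.1 b ≤ f x.1 x.2)) (const (List.finRange q))
      (le (comp hf (pair (fst (fst id)) (snd id))) (comp hf (fst id))))) (const 0)

theorem assignment {X : I → List ℕ} {χ out : I → List (Fin q)} {y : I → ℕ} (hX : PolyT M X)
    (hχ : PolyT M χ) (hout : PolyT M out) (hy : PolyT M y) :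
    PolyT M fun x => CSPReduction.assignment (X x) (χ x) (out x) (y x) :=
  getD (getD hy hX (const 0)) hout (getD hy hχ (const 0))

theorem decode {cs : I → List (CSPReduction.Pred Λ × List ℕ)} {X : I → List ℕ} {n : I → ℕ}
    {χ : I → List (Fin q)} (hcs : PolyT M cs) (hX : PolyT M X) (hn : PolyT M n)
    (hχ : PolyT M χ) : PolyT M fun x => CSPReduction.decode (cs x) (X x) (n x) (χ x) := by
  refine iterate (f := fun x => CSPReduction.decodeStep (cs x) (X x) (χ x)) hn (const [])
    (append (snd id) (cons (argmax (f := fun (y : I × List (Fin q)) a => CSPReduction.score (cs y.1)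
      (CSPReduction.assignment (X y.1) (χ y.1) (y.2 ++ [a])))
      (score (χ := fun (y : (I × List (Fin q)) × Fin q) => CSPReduction.assignment (X y.1.1)
          (χ y.1.1) (y.1.2 ++ [y.2])) (comp hcs (fst (fst id)))
        (assignment (comp hX (fst (fst (fst id)))) (comp hχ (fst (fst (fst id))))
          (append (snd (fst (fst id))) (cons (snd (fst id)) (const []))) (snd id))))
      (const []))) ⟨2, fun x out => ?_⟩
  simp only [CSPReduction.decodeStep, sz_list_leaf, List.length_append, List.length_singleton,
    Polynomial.eval_ofNat]
  omega

end decode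

/-! #### Reading and writing words -/

theorem parse {w : I → List (CSPSymbol Λ)} (hw : PolyT M w) :
    PolyT M fun x => CSPReduction.parse (w x) := by
  have hstep : PolyT M fun y : I × CSPReduction.ParseState Λ × CSPSymbol Λ =>
      CSPReduction.parseStep y.2.1 y.2.2 := by
    refine finCases (c := fun y : I × CSPReduction.ParseState Λ × CSPSymbol Λ => y.2.2)
      (f := fun a y => CSPReduction.parseStep y.2.1 a) (snd (snd id)) fun a => ?_
    have h : PolyT M fun y : I × CSPReduction.ParseState Λ × CSPSymbol Λ => y.2.1 := fst (snd id)
    cases a with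
    | pred P => exact pair (fst h) (pair (const []) (cons (pair (const P) (fst (snd h)))
        (snd (snd h))))
    | tally => exact pair (pair (add (fst (fst h)) (const 1)) (snd (fst h))) (snd h)
    | bit b => exact pair (pair (fst (fst h)) (cons (const b) (snd (fst h)))) (snd h)
    | sep => exact pair (const (0, [])) (pair (cons (fst h) (fst (snd h))) (snd (snd h)))
  have h : PolyT M fun x => CSPReduction.parseState (w x) := by
    refine (foldl_of_le (f := fun _ => CSPReduction.parseStep) (reverse hw)
      (const ((0, []), ([], []))) hstep ⟨10, fun x s a _ => ?_⟩).of_eq fun x => ?_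
    · obtain ⟨⟨t, b⟩, g, cs⟩ := s
      cases a <;> simp only [CSPReduction.parseStep, sz_mk, sz_cons, sz_nil, sz_nat, sz_leaf,
        Polynomial.eval_ofNat] <;> omega
    · rw [List.foldl_reverse]
      rfl
  have hitem : PolyT M fun c : CSPReduction.Pred Λ × List (ℕ × List Bool) =>
      CSPReduction.toItem c := by
    have h : PolyT M fun c : CSPReduction.Pred Λ × List (ℕ × List Bool) => c.2.length :=
      length (snd id)
    exact pair (pair (fst id) (map (g := fun _ => Prod.fst) (take (sub h (const 2)) (snd id))
      (fst (snd id)))) (pair (snd (getD (sub h (const 2)) (snd id) (const (0, []))))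
        (snd (getD (sub h (const 1)) (snd id) (const (0, [])))))
  exact pair (fst (fst h)) (map (g := fun _ => CSPReduction.toItem) (snd (snd h))
    (comp hitem (snd id)))

theorem encodeConstraint {c : I → CSPReduction.Pred Λ × List ℕ} (hc : PolyT M c) :
    PolyT M fun x => CSPReduction.encodeConstraint (c x) :=
  cons (comp (of_finite CSPSymbol.pred) (fst hc))
    (flatMap (g := fun _ i => CSPSymbol.sep :: List.replicate i CSPSymbol.tally) (snd hc)
      (cons (const _) (replicate (snd id) (const _))))

end PolyT

end TreeMachine

end Turing

/-! ### The reduction and the recovery of assignments -/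

namespace CSPReduction

variable {q : ℕ} {Λ : CSP q}

/-- A bound for the arities of the predicates. -/
def maxArity (Λ : CSP q) : ℕ := Λ.sup CSPPredicate.arity

theorem arity_le_maxArity (P : Pred Λ) : P.1.arity ≤ maxArity Λ :=
  Finset.le_sup (f := CSPPredicate.arity) P.2

theorem spread_pos (C n : ℕ) (G : List (Pred Λ × List ℕ)) : 0 < spread C n G := Nat.succ_pos _

/-- The regular instance that replaces a weighted instance. -/
def reduced (C : ℕ) (F : WeightedCSPInstance Λ) : {F : CSPInstance Λ // F.IsRegular} :=
  ⟨regularInstance (spread C F.numVars (rounding C (itemsOf F))) (maxArity Λ)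
    (rounding C (itemsOf F)) (isConstraint_rounding (isConstraint_itemsOf F)) arity_le_maxArity,
    isRegular_regularInstance (spread_pos _ _ _) _ _⟩

/-- The constraints of the regular instance that replaces a weighted instance. -/
def reducedConstraints (C : ℕ) (F : WeightedCSPInstance Λ) : List (Pred Λ × List ℕ) :=
  blowup (spread C F.numVars (rounding C (itemsOf F))) (maxArity Λ) (rounding C (itemsOf F))

theorem encode_reduced (C : ℕ) (F : WeightedCSPInstance Λ) : (reduced C F).1.encode =
    List.replicate (vars (rounding C (itemsOf F))).length .tally ++
      (reducedConstraints C F).flatMap encodeConstraint :=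
  encode_toInstance _ _
    (isConstraint_blowup (isConstraint_rounding (isConstraint_itemsOf F)) arity_le_maxArity)

/-- The variables are listed in the word of an instance, so an assignment is no longer than its
input. This permits the use of `Computes.call`. -/
theorem length_numVars_le (F : CSPInstance Λ) : F.numVars ≤ F.encode.length := by
  rw [CSPInstance.encode, List.length_append, List.length_replicate]
  omega

variable [NeZero q]

/-- The assignment to a weighted instance that is obtained from one to the regular instance. -/
def recovered (C : ℕ) (F : WeightedCSPInstance Λ) (χ : List (Fin q)) : List (Fin q) :=
  decode (reducedConstraints C F) (vars (rounding C (itemsOf F))) F.numVars χ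

theorem getD_ofFn {n : ℕ} (χ : Fin n → Fin q) (i : Fin n) : (List.ofFn χ).getD i 0 = χ i := by
  rw [List.getD_eq_getElem _ _ (by simp)]
  simp

theorem mul_score_le_of_mul_iSup_le {α : ℝ} (hα : 0 ≤ α) (n : ℕ) (cs : List (Pred Λ × List ℕ))
    (h : ∀ c ∈ cs, IsConstraint n c) (χ : Fin n → Fin q)
    (hχ : (toInstance n cs h).val χ ≥ α * ⨆ χ', (toInstance n cs h).val χ') (χ' : ℕ → Fin q) :
    α * score cs χ' ≤ score cs fun y => (List.ofFn χ).getD y 0 := by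
  have h1 : α * (toInstance n cs h).val (fun i : Fin n => χ' i) ≤ (toInstance n cs h).val χ :=
    (mul_le_mul_of_nonneg_left
      (le_ciSup (f := (toInstance n cs h).val) (Set.finite_range _).bddAbove _) hα).trans hχ
  rw [val_toInstance n cs h _ χ' fun _ => rfl,
    val_toInstance n cs h χ (fun y => (List.ofFn χ).getD y 0) (getD_ofFn χ)] at h1
  -- Without constraints the values are divisions by zero, but then the scores vanish.
  rcases Nat.eq_zero_or_pos cs.length with h0 | h0
  · rw [List.length_eq_zero_iff.1 h0]
    simp [score]
  · rw [← mul_div_assoc] at h1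
    exact (div_le_div_iff_of_pos_right (by exact_mod_cast h0)).1 h1

theorem val_recovered {α δ : ℝ} (hδ : 0 < δ) {C : ℕ} (hα : α ≤ C * δ) (hC : 1 ≤ C * δ)
    (F : WeightedCSPInstance Λ) (χ : Fin (reduced C F).1.numVars → Fin q)
    (hχ : (reduced C F).1.val χ ≥ α * ⨆ χ', (reduced C F).1.val χ') :
    F.val (fun i => (recovered C F (List.ofFn χ)).getD i 0) ≥ (α - δ) * ⨆ ψ, F.val ψ := by
  obtain ⟨ψ, hψ⟩ := exists_eq_ciSup_of_finite (f := F.val)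
  rw [← hψ, val_eq_weightedScore F ψ (fun i => (List.ofFn ψ).getD i 0) (getD_ofFn ψ),
    val_eq_weightedScore F _ (fun i => (recovered C F (List.ofFn χ)).getD i 0) fun _ => rfl]
  exact mul_weightedScore_le hδ hα hC (isConstraint_itemsOf F) (weight_itemsOf F)
    arity_le_maxArity _ (fun h0 => mul_score_le_of_mul_iSup_le h0 _ _
      (isConstraint_blowup (isConstraint_rounding (isConstraint_itemsOf F)) arity_le_maxArity)
      χ hχ) _

end CSPReduction

/-! ### The complete algorithm -/

namespace Turing

/-- A function on a class of objects that is computable in polynomial time is so on a class of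
objects that are described by them. -/
def TM2ComputableInPolyTime.reindex {I J A B β : Type} {e : I → List A} {e' : β → List B}
    {f : I → β} (h : TM2ComputableInPolyTime e e' f) (g : J → I) :
    TM2ComputableInPolyTime (fun j => e (g j)) e' fun j => f (g j) where
  toTM2ComputableAux := h.toTM2ComputableAux
  time := h.time
  outputsFun j := h.outputsFun (g j)

namespace TreeMachine

variable {q : ℕ} {Λ : CSP q}

instance : TreeEnc (CSPSymbol Λ) (Fin q) (WeightedCSPInstance Λ) :=
  ⟨fun F => inWord F.encode.reverse⟩

variable {M : TM2ComputableAux (CSPSymbol Λ) (Fin q)}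

/-- The tree of an instance is by definition that of its reversed word, which is what `load` leaves
on the stack. All data of the instance are obtained by parsing it. -/
theorem PolyT.parse_weightedCSPInstance :
    PolyT M fun F : WeightedCSPInstance Λ => (F.numVars, CSPReduction.itemsOf F) := by
  have h : PolyT M fun F : WeightedCSPInstance Λ => F.encode.reverse :=
    (Computes.refl fun F : WeightedCSPInstance Λ => inWord F.encode.reverse).of_eq
      (fun _ => rfl) fun _ => rfl
  refine (parse (reverse h)).of_eq fun F => ?_
  rw [List.reverse_reverse, CSPReduction.parse_encode]

theorem PolyT.rounding_itemsOf (C : ℕ) :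
    PolyT M fun F : WeightedCSPInstance Λ =>
      CSPReduction.rounding C (CSPReduction.itemsOf F) :=
  rounding C (snd parse_weightedCSPInstance)

theorem PolyT.reducedConstraints (C : ℕ) :
    PolyT M fun F : WeightedCSPInstance Λ => CSPReduction.reducedConstraints C F :=
  blowup _ (spread C (fst parse_weightedCSPInstance) (rounding_itemsOf C)) (rounding_itemsOf C)

theorem PolyT.encode_reduced (C : ℕ) :
    PolyT M fun F : WeightedCSPInstance Λ => (CSPReduction.reduced C F).1.encode :=
  (append (replicate (length (vars (rounding_itemsOf C))) (const CSPSymbol.tally))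
    (flatMap (g := fun _ => CSPReduction.encodeConstraint) (reducedConstraints C)
      (encodeConstraint (snd id)))).of_eq fun F => CSPReduction.encode_reduced C F

theorem PolyT.recovered [NeZero q] (C : ℕ) {χ : WeightedCSPInstance Λ → List (Fin q)}
    (hχ : PolyT M χ) : PolyT M fun F => CSPReduction.recovered C F (χ F) :=
  decode (reducedConstraints C) (vars (rounding_itemsOf C)) (fst parse_weightedCSPInstance) hχ

end TreeMachine

end Turing

theorem theorem1 (q : ℕ) (hq : 1 ≤ q) (Λ : CSP q) (α : ℝ)
    (h : HasRegularMaxCSPApprox Λ α) :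
    ∀ δ : ℝ, 0 < δ → HasWeightedMaxCSPApprox Λ (α - δ) := by
  intro δ hδ
  obtain ⟨A, ⟨hA⟩, hval⟩ := h
  have : NeZero q := ⟨by omega⟩
  have : Inhabited (CSPSymbol Λ) := ⟨.sep⟩
  have : Fintype (CSPSymbol Λ) := Fintype.ofFinite _
  -- The two lower bounds control the losses from rounding and from decoding.
  obtain ⟨C, hC⟩ := exists_nat_ge (max (α / δ) (1 / δ))
  have hC1 := (div_le_iff₀ hδ).1 ((le_max_left _ _).trans hC)
  have hC2 := (div_le_iff₀ hδ).1 ((le_max_right _ _).trans hC)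
  -- The given algorithm is only ever called on the instances `reduced C F`, which are regular.
  let hB := hA.reindex (CSPReduction.reduced C)
  have hcall := Turing.TreeMachine.Computes.call hB fun F => by
    simpa using CSPReduction.length_numVars_le (CSPReduction.reduced C F).1
  have hχ : Turing.TreeMachine.PolyT hB.toTM2ComputableAux fun F : WeightedCSPInstance Λ =>
      List.ofFn (A (CSPReduction.reduced C F)) := by
    have : Turing.TreeMachine.PolyT hB.toTM2ComputableAux fun F : WeightedCSPInstance Λ =>
        (List.ofFn (A (CSPReduction.reduced C F))).reverse :=
      (Turing.TreeMachine.PolyT.reverse (Turing.TreeMachine.PolyT.encode_reduced C)).trans hcall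
    exact (Turing.TreeMachine.PolyT.reverse this).of_eq fun F => (List.reverse_reverse _).symm
  refine ⟨fun F i => (CSPReduction.recovered C F
    (List.ofFn (A (CSPReduction.reduced C F)))).getD i 0, ?_, fun F =>
      CSPReduction.val_recovered hδ hC1 hC2 F _ (hval _)⟩
  have hfn : ∀ F : WeightedCSPInstance Λ, List.ofFn (fun i : Fin F.numVars =>
      (CSPReduction.recovered C F (List.ofFn (A (CSPReduction.reduced C F)))).getD i 0) =
      CSPReduction.recovered C F (List.ofFn (A (CSPReduction.reduced C F))) := by
    intro F
    have hlen : (CSPReduction.recovered C F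
        (List.ofFn (A (CSPReduction.reduced C F)))).length = F.numVars :=
      CSPReduction.length_decode _ _ _ _
    refine List.ext_getElem (by simp [hlen]) fun i h1 h2 => ?_
    rw [List.getElem_ofFn, List.getD_eq_getElem _ _ h2]
  simp only [hfn]
  exact Turing.TreeMachine.Computes.computableInPolyTime
    (Turing.TreeMachine.PolyT.reverse (Turing.TreeMachine.PolyT.recovered C hχ))
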